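/- **Setting.** Let $\mathfrak g$ be a finite-dimensional real Lie algebra with an inner product $Q$ satisfying $Q([X,Y],Z)=Q(X,[Y,Z])$, let $\mathfrak h<\mathfrak g$ be a proper subalgebra, and let $\mathcal A$ be a compact group of $Q$-isometric automorphisms of $\mathfrak g$ preserving $\mathfrak h$. Let $\tilde{\mathcal J}$ be the poset of all $\mathcal A$-invariant subalgebras $\mathfrak k$ with $\mathfrak h<\mathfrak k\le\mathfrak g$. For a set $K$ of subalgebras, $\Delta(K)$ is the set of finite totally ordered subsets (flags) of $K$. Operators on $\mathfrak g$ are symmetric with respect to $Q$; for a subalgebra $\mathfrak k$ let $1_{\mathfrak k}$ be the orthogonal projection onto $\mathfrak k$, and for $\mathfrak k\ne\mathfrak g$ let $\bar\chi^{\mathfrak k}=\frac1{\dim(\mathfrak g/\mathfrak k)}(1_{\mathfrak g}-1_{\mathfrak k})$. **Cells.** *Coarse version* $\mathbb V=\mathbb D$: let $W_{\rm draft}$ be the set of nonnegative symmetric operators $A$ of trace $1$ which commute with $\mathcal A$ and satisfy $AX=0$ and $A\,\mathrm{ad}(X)=\mathrm{ad}(X)A$ for all $X\in\mathfrak h$ and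 also for some $X\notin\mathfrak h$; put $\mathbb D[\mathfrak k]=\{A\in W_{\rm draft}: A\mathfrak k=0,\ [A,\mathrm{ad}(\mathfrak k)]=0\}$. *Fine version* $\mathbb V=\mathbb X$: for a symmetric operator $A$ let $F_a=\mathrm{span}\{X: AX=rX \text{ for some } r\le a\}$, and call $A$ filtering if $[F_a,F_b]\subset F_{a+b}$ for all $a,b\in\mathbb R$; let $\mathbb W$ be the set of nonnegative filtering operators $A$ of trace $1$ which commute with $\mathcal A$ and satisfy $\mathfrak h<F_0=\ker A<\mathfrak g$; put $\mathbb X[\mathfrak k]=\{A\in\mathbb W: A\mathfrak k=0\}$. In both versions $\mathbb V[\mathfrak g]=\emptyset$. **Butterflies.** For a flag $\varphi=(\mathfrak f_1>\dots>\mathfrak f_r)$, $r\ge1$, of elements of $\tilde{\mathcal J}$, the butterfly $\mathbb V[\varphi]$ is $\mathbb V[\mathfrak f_1]$ if $r=1$; the simplex $\mathrm{conv}\{\bar\chi^{\mathfrak f_i}: i\ge2\}$ if $r>1$ and $\mathfrak f_1=\mathfrak g$; and the union of all segments joining a point of $\mathbb V[\mathfrak f_1]$ to a point of $\mathrm{conv}\{\bar\chi^{\mathfrak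 f_i}: i\ge2\}$ if $r>1$ and $\mathfrak f_1\ne\mathfrak g$. For a set $\Phi$ of flags, $\mathbb V[\Phi]=\bigcup_{\varphi\in\Phi}\mathbb V[\varphi]$. **Admissible ideals.** A subset $\mathcal J\subset\tilde{\mathcal J}$ is an admissible order ideal if $\mathfrak l\le\mathfrak j$, $\mathfrak l\in\tilde{\mathcal J}$, $\mathfrak j\in\mathcal J$ imply $\mathfrak l\in\mathcal J$, if $\mathfrak g\notin\mathcal J$, and if $\mathcal J$ and $\tilde{\mathcal J}\setminus\mathcal J$ are compact semialgebraic subsets of the manifold of vector subspaces of $\mathfrak g$ (where a subspace is identified with its orthogonal projection). Put $$\mathbb I=\{\varphi\in\Delta(\tilde{\mathcal J})\setminus\Delta(\mathcal J): \varphi\setminus\{\max\varphi\}\subset\mathcal J\},\qquad \mathbb J=\{\varphi\in\Delta(\tilde{\mathcal J})\setminus\Delta(\mathcal J): \varphi\setminus\{\mathfrak g\}\subset\mathcal J\}.$$ **Theorem 6.1 (second retraction theorem).** Let $\mathcal J$ be an admissible order ideal in $\tilde{\mathcal J}$. Then, in the coarse version ($\mathbb V=\mathbb D$) as well as in the fine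 version ($\mathbb V=\mathbb X$), the space $$\mathbb V[\tilde{\mathcal J}\setminus\mathcal J]=\bigcup_{\mathfrak f\in\tilde{\mathcal J}\setminus\mathcal J}\mathbb V[\mathfrak f]$$ is a strong deformation retract of $\mathbb V[\mathbb I]\setminus\mathbb V[\mathbb J]$ (with the topology induced from $\mathfrak{gl}(\mathfrak g)$). This also holds in the semialgebraic category: the strong deformation retraction $(\mathbb V[\mathbb I]\setminus\mathbb V[\mathbb J])\times[0,1]\to\mathbb V[\mathbb I]\setminus\mathbb V[\mathbb J]$ can be chosen to be a continuous map with semialgebraic graph. -/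

import Mathlib

open scoped InnerProductSpace

/-! ### Semialgebraic sets and strong deformation retracts -/

/-- The algebra of real polynomial functions on a real vector space, i.e. the algebra of functions
generated by the linear functionals (and the constants). -/
def polyFunctions (V : Type*) [AddCommGroup V] [Module ℝ V] : Subalgebra ℝ (V → ℝ) :=
  Algebra.adjoin ℝ (Set.range fun f : Module.Dual ℝ V => (f : V → ℝ))

/-- Semialgebraic subsets of a finite dimensional real vector space: the smallest family of subsets
that contains all sets `{x | 0 < p x}`, `p` a polynomial function, and is closed under complements
and finite unions (hence under finite intersections; `p x = 0` and `0 ≤ p x` are covered too). -/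
inductive IsSemialgebraic {V : Type*} [AddCommGroup V] [Module ℝ V] : Set V → Prop
  | pos (p : V → ℝ) (hp : p ∈ polyFunctions V) : IsSemialgebraic {x | 0 < p x}
  | compl (S : Set V) (hS : IsSemialgebraic S) : IsSemialgebraic Sᶜ
  | union (S T : Set V) (hS : IsSemialgebraic S) (hT : IsSemialgebraic T) :
      IsSemialgebraic (S ∪ T)

/-- `H` restricts to a strong deformation retraction of the space `X` onto its subspace `T`:
a continuous map `X × [0,1] → X` which is the identity at time `0`, maps `X` into `T` at time `1`
and fixes every point of `T` at all times. (Values of `H` outside `X × [0,1]` are irrelevant.) -/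
structure IsStrongDeformationRetraction {V : Type*} [TopologicalSpace V]
    (H : V × ℝ → V) (X T : Set V) : Prop where
  subset : T ⊆ X
  continuousOn : ContinuousOn H (X ×ˢ Set.Icc (0 : ℝ) 1)
  mapsTo : ∀ x ∈ X, ∀ t ∈ Set.Icc (0 : ℝ) 1, H (x, t) ∈ X
  at_zero : ∀ x ∈ X, H (x, 0) = x
  at_one : ∀ x ∈ X, H (x, 1) ∈ T
  fixed : ∀ x ∈ T, ∀ t ∈ Set.Icc (0 : ℝ) 1, H (x, t) = x

/-- The graph of the restriction of `H` to `X × [0,1]`. -/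
def deformationGraph {V : Type*} (H : V × ℝ → V) (X : Set V) : Set (V × ℝ × V) :=
  {p | p.1 ∈ X ∧ p.2.1 ∈ Set.Icc (0 : ℝ) 1 ∧ p.2.2 = H (p.1, p.2.1)}

/-- `T` is a strong deformation retract of `X`, also in the semialgebraic category: there is a
strong deformation retraction of `X` onto `T` which is a semialgebraic map, i.e. whose graph is
a semialgebraic set. -/
def IsSemialgebraicStrongDeformationRetract {V : Type*} [AddCommGroup V] [Module ℝ V]
    [TopologicalSpace V] (T X : Set V) : Prop :=
  ∃ H : V × ℝ → V, IsStrongDeformationRetraction H X T ∧ IsSemialgebraic (deformationGraph H X)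

/-! ### Compact Lie algebras and filtering operators -/

/-- A real Lie algebra `𝔤` together with an inner product `Q = ⟪·,·⟫` satisfying
`Q([X,Y],Z) = Q(X,[Y,Z])`. The finite dimensional ones are the compact Lie algebras with a fixed
invariant Euclidean metric. -/
class MetricLieAlgebra (𝔤 : Type*) extends
    NormedAddCommGroup 𝔤, LieRing 𝔤, InnerProductSpace ℝ 𝔤, LieAlgebra ℝ 𝔤 where
  inner_lie : ∀ X Y Z : 𝔤, ⟪⁅X, Y⁆, Z⟫_ℝ = ⟪X, ⁅Y, Z⁆⟫_ℝ

section

variable {𝔤 : Type*} [MetricLieAlgebra 𝔤]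

/-- `F_a = span {X | ∃ r ≤ a, A X = r X}`. -/
def eigenFiltration (A : 𝔤 →L[ℝ] 𝔤) (a : ℝ) : Submodule ℝ 𝔤 :=
  Submodule.span ℝ {X | ∃ r ≤ a, A X = r • X}

/-- A symmetric operator is filtering if `[F_a, F_b] ⊆ F_{a+b}` for all real `a`, `b`. -/
def IsFiltering (A : 𝔤 →L[ℝ] 𝔤) : Prop :=
  A.toLinearMap.IsSymmetric ∧
    ∀ a b : ℝ, ∀ X ∈ eigenFiltration A a, ∀ Y ∈ eigenFiltration A b,
      ⁅X, Y⁆ ∈ eigenFiltration A (a + b)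

/-- The trace of an operator on `𝔤`. -/
noncomputable def opTrace (A : 𝔤 →L[ℝ] 𝔤) : ℝ := LinearMap.trace ℝ 𝔤 A.toLinearMap

/-- `𝔉₊`: the filtering symmetric operators with nonnegative spectrum and trace `1`. -/
def filteringOperators (𝔤 : Type*) [MetricLieAlgebra 𝔤] : Set (𝔤 →L[ℝ] 𝔤) :=
  {A | IsFiltering A ∧ A.IsPositive ∧ opTrace A = 1}

/-- The operators commuting with a group `𝒜` of isometries of `𝔤`. -/
def invariantOperators (𝒜 : Subgroup (𝔤 ≃ₗᵢ[ℝ] 𝔤)) : Set (𝔤 →L[ℝ] 𝔤) :=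
  {A | ∀ a ∈ 𝒜, ∀ X : 𝔤, A (a X) = a (A X)}

/-- The space `𝕎` of all `𝒜`-invariant operators in `𝔉₊` which are degenerate with respect to
`𝔥`, that is `𝔥 < F_0 = ker A < 𝔤`. -/
def fineSpace (𝒜 : Subgroup (𝔤 ≃ₗᵢ[ℝ] 𝔤)) (𝔥 : LieSubalgebra ℝ 𝔤) : Set (𝔤 →L[ℝ] 𝔤) :=
  {A | A ∈ filteringOperators 𝔤 ∧ A ∈ invariantOperators 𝒜 ∧
    𝔥.toSubmodule < eigenFiltration A 0 ∧
    eigenFiltration A 0 = LinearMap.ker A.toLinearMap ∧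
    LinearMap.ker A.toLinearMap < ⊤}

/-- The coarse version of `𝕎`: all `𝒜`-invariant, `ad(𝔥)`-invariant symmetric operators `A` with
nonnegative spectrum and trace `1` satisfying `A X = 0` and `A ad(X) = ad(X) A` for all `X ∈ 𝔥` and
also for some `X ∉ 𝔥`. -/
def coarseSpace (𝒜 : Subgroup (𝔤 ≃ₗᵢ[ℝ] 𝔤)) (𝔥 : LieSubalgebra ℝ 𝔤) : Set (𝔤 →L[ℝ] 𝔤) :=
  {A | A.IsPositive ∧ opTrace A = 1 ∧ A ∈ invariantOperators 𝒜 ∧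
    (∀ X ∈ 𝔥, A X = 0 ∧ ∀ Y : 𝔤, A ⁅X, Y⁆ = ⁅X, A Y⁆) ∧
    ∃ X : 𝔤, X ∉ 𝔥 ∧ A X = 0 ∧ ∀ Y : 𝔤, A ⁅X, Y⁆ = ⁅X, A Y⁆}

/-- The first kind butterfly `𝕏[𝔨] = {A ∈ 𝕎 | A 𝔨 = 0}` (fine version). It is empty for `𝔨 = 𝔤`,
because of the trace condition. -/
def fineCell (𝒜 : Subgroup (𝔤 ≃ₗᵢ[ℝ] 𝔤)) (𝔥 𝔨 : LieSubalgebra ℝ 𝔤) : Set (𝔤 →L[ℝ] 𝔤) :=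
  {A | A ∈ fineSpace 𝒜 𝔥 ∧ ∀ X ∈ 𝔨, A X = 0}

/-- The first kind butterfly `𝔻[𝔨]` (coarse version): the operators `A` of the coarse space with
`A 𝔨 = 0` and `[A, ad(𝔨)] = 0`. It is empty for `𝔨 = 𝔤`, because of the trace condition. -/
def coarseCell (𝒜 : Subgroup (𝔤 ≃ₗᵢ[ℝ] 𝔤)) (𝔥 𝔨 : LieSubalgebra ℝ 𝔤) : Set (𝔤 →L[ℝ] 𝔤) :=
  {A | A ∈ coarseSpace 𝒜 𝔥 ∧ ∀ X ∈ 𝔨, A X = 0 ∧ ∀ Y : 𝔤, A ⁅X, Y⁆ = ⁅X, A Y⁆}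

/-! ### Invariant subalgebras, flags, admissible order ideals -/

/-- The poset of all `𝒜`-invariant subalgebras `𝔨` with `𝔥 < 𝔨 ≤ 𝔤`. -/
def invariantSubalgebras (𝒜 : Subgroup (𝔤 ≃ₗᵢ[ℝ] 𝔤)) (𝔥 : LieSubalgebra ℝ 𝔤) :
    Set (LieSubalgebra ℝ 𝔤) :=
  {𝔨 | 𝔥 < 𝔨 ∧ ∀ a ∈ 𝒜, ∀ X ∈ 𝔨, a X ∈ 𝔨}

/-- `Δ(K)`: the set of finite totally ordered subsets of `K`, the flags of elements of `K`
(the empty flag included). -/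
def flags (K : Set (LieSubalgebra ℝ 𝔤)) : Set (Finset (LieSubalgebra ℝ 𝔤)) :=
  {φ | (φ : Set (LieSubalgebra ℝ 𝔤)) ⊆ K ∧ IsChain (· ≤ ·) (φ : Set (LieSubalgebra ℝ 𝔤))}

/-- For an ideal `J` of `K`, the flags `φ ∈ Δ(K) ∖ Δ(J)` with `φ ∖ (max φ) ⊆ J`. -/
def flagsI (K J : Set (LieSubalgebra ℝ 𝔤)) : Set (Finset (LieSubalgebra ℝ 𝔤)) :=
  {φ | φ ∈ flags K ∧ φ ∉ flags J ∧
    ∀ m, IsGreatest (φ : Set (LieSubalgebra ℝ 𝔤)) m → ∀ 𝔩 ∈ φ, 𝔩 ≠ m → 𝔩 ∈ J}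

/-- For an ideal `J` of `K`, the flags `φ ∈ Δ(K) ∖ Δ(J)` with `φ ∖ (𝔤) ⊆ J`. -/
def flagsJ (K J : Set (LieSubalgebra ℝ 𝔤)) : Set (Finset (LieSubalgebra ℝ 𝔤)) :=
  {φ | φ ∈ flags K ∧ φ ∉ flags J ∧ ∀ 𝔩 ∈ φ, 𝔩 ≠ ⊤ → 𝔩 ∈ J}

variable [FiniteDimensional ℝ 𝔤]

/-- `1_𝔨`: the `Q`-orthogonal projection of `𝔤` onto `𝔨`. -/
noncomputable def subalgebraProjection (𝔨 : LieSubalgebra ℝ 𝔤) : 𝔤 →L[ℝ] 𝔤 :=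
  𝔨.toSubmodule.starProjection

/-- An admissible order ideal `J` of the poset of invariant subalgebras: a lower set not containing
`𝔤`, such that `J` and its complement are compact semialgebraic subsets of the manifold of vector
subspaces of `𝔤`. That manifold is realized, as usual, as the set of orthogonal projections. -/
structure IsAdmissibleIdeal (𝒜 : Subgroup (𝔤 ≃ₗᵢ[ℝ] 𝔤)) (𝔥 : LieSubalgebra ℝ 𝔤)
    (J : Set (LieSubalgebra ℝ 𝔤)) : Prop where
  subset : J ⊆ invariantSubalgebras 𝒜 𝔥
  lower : ∀ 𝔩 ∈ invariantSubalgebras 𝒜 𝔥, ∀ 𝔧 ∈ J, 𝔩 ≤ 𝔧 → 𝔩 ∈ J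
  top_notMem : ⊤ ∉ J
  isCompact : IsCompact (subalgebraProjection '' J)
  isSemialgebraic : IsSemialgebraic (subalgebraProjection '' J)
  isCompact_compl : IsCompact (subalgebraProjection '' (invariantSubalgebras 𝒜 𝔥 \ J))
  isSemialgebraic_compl : IsSemialgebraic (subalgebraProjection '' (invariantSubalgebras 𝒜 𝔥 \ J))

/-! ### Butterflies -/

/-- `χ̄^𝔨 = (dim 𝔤/𝔨)⁻¹ (1_𝔤 - 1_𝔨)`, used for proper subalgebras `𝔨 < 𝔤` only. -/
noncomputable def chiBar (𝔨 : LieSubalgebra ℝ 𝔤) : 𝔤 →L[ℝ] 𝔤 :=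
  (Module.finrank ℝ (𝔤 ⧸ 𝔨.toSubmodule) : ℝ)⁻¹ • (1 - subalgebraProjection 𝔨)

/-- The butterfly of a nonempty flag `φ = (𝔣₁ > ... > 𝔣ᵣ)`, for a given choice `V` of butterflies of
the first kind (`𝔻[·]` or `𝕏[·]`).
First kind (`r = 1`): `V[𝔣₁]`.
Second kind (`r > 1`, `𝔣₁ = 𝔤`): the simplex spanned by the `χ̄^𝔣ᵢ`, `i ≥ 2`.
Third kind (`r > 1`, `𝔣₁ ≠ 𝔤`): the union of all segments that join a point of `V[𝔣₁]` with a point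
of the simplex spanned by the `χ̄^𝔣ᵢ`, `i ≥ 2`. -/
def butterfly (V : LieSubalgebra ℝ 𝔤 → Set (𝔤 →L[ℝ] 𝔤)) (φ : Finset (LieSubalgebra ℝ 𝔤)) :
    Set (𝔤 →L[ℝ] 𝔤) :=
  {A | ∃ m, IsGreatest (φ : Set (LieSubalgebra ℝ 𝔤)) m ∧
    ((φ = {m} ∧ A ∈ V m) ∨
      (φ ≠ {m} ∧ m = ⊤ ∧
        A ∈ convexHull ℝ (chiBar '' ((φ : Set (LieSubalgebra ℝ 𝔤)) \ {m}))) ∨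
      (φ ≠ {m} ∧ m ≠ ⊤ ∧
        A ∈ convexJoin ℝ (V m)
          (convexHull ℝ (chiBar '' ((φ : Set (LieSubalgebra ℝ 𝔤)) \ {m})))))}

/-- `V[Φ] = ⋃_{φ ∈ Φ} V[φ]` for a set `Φ` of flags. -/
def butterflyUnion (V : LieSubalgebra ℝ 𝔤 → Set (𝔤 →L[ℝ] 𝔤))
    (Φ : Set (Finset (LieSubalgebra ℝ 𝔤))) : Set (𝔤 →L[ℝ] 𝔤) :=
  ⋃ φ ∈ Φ, butterfly V φ

end

/-! Write `K` for the complement of the ideal `J`. The space to be retracted consists exactly of the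
trace-one operators `A = W + c • B` with `c > 0`, `B` in the cell of some `𝔮 ∈ K`, and `W` a
nonnegative combination of operators `1 - 1_𝔭ᵢ` along a chain `𝔮 ≥ 𝔭₁ ≥ ⋯` in `J`; the points of
`V[𝕁]` are chain sums without the remainder `c • B` (`IsProperIdeal.mem_diff_iff`). The retraction
moves `A` to `B` on a straight line, along which only the sizes of `W` and of `c` change.

This requires that `A` determines `B`. Let `μ` be the sum of the coefficients of `W`. On `𝔮` the
operators `A` and `W` agree, with eigenvalues at most `μ`, so `𝔮 ≤ F_μ(A)`; but for `0 ≤ lam < μ`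
the space `F_lam(A)` lies in a member of `J` (`ChainSum.exists_lower_bound`). Since `J` is a lower
set, `𝔮` lies in no member of `J`. Hence `μ` is the least nonnegative level at which `F_μ(A)`
escapes all members of `J`, and it depends on `A` alone. Finally `A - W` is the spectral truncation
`max(A - μ, 0)` (`splitting_apply_eigenvector`), which proves `IsSplitting.unique`.

Continuity of `W` in `A` follows from compactness and uniqueness: chains have bounded length, `J`
and `K` are compact, and the conditions on a splitting are closed (`continuousOn_of_isSplitting`).

The graph is described by a first-order formula over the reals in which subalgebras are represented
by their projections, so it is semialgebraic by Tarski–Seidenberg. That theorem is proved by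
Cohen–Hörmander elimination (`exists_finite_signs_determine_diagram`): the signs of finitely many
coefficient expressions determine the sign diagram of a family of polynomials up to an order
isomorphism of the line. -/

/-! ### Extending order isomorphisms of the real line -/

/-- Finite partial order isomorphisms of `ℝ` extend to `ℝ`. -/
theorem exists_orderIso_eqOn_finset (S : Finset ℝ) (m : ℝ → ℝ) (hm : StrictMonoOn m S) :
    ∃ ψ : ℝ ≃o ℝ, ∀ x ∈ S, ψ x = m x := by
  induction S using Finset.induction_on_max with
  | empty => exact ⟨OrderIso.refl ℝ, by simp⟩
  | insert b S hb ih =>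
    obtain ⟨ψ, hψ⟩ := ih (hm.mono (by simp))
    rcases S.eq_empty_or_nonempty with rfl | hS
    · exact ⟨OrderIso.addRight (m b - b), by simp⟩
    · set a := S.max' hS with ha
      have haS : a ∈ S := S.max'_mem hS
      have hab : a < b := hb a haS
      have hmab : m a < m b := hm (by simp [haS]) (by simp) hab
      set k : ℝ := (m b - m a) / (b - a) with hk
      have hk0 : 0 < k := div_pos (sub_pos.2 hmab) (sub_pos.2 hab)
      -- Beyond the largest point `a` treated so far, `ψ` is replaced by the affine function through
      -- `(a, m a)` and `(b, m b)`.
      let g : ℝ → ℝ := fun x => if x ≤ a then ψ x else m a + k * (x - a)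
      have hg : StrictMono g := by
        intro x y hxy
        by_cases hy : y ≤ a
        · simp only [g, if_pos hy, if_pos (hxy.le.trans hy)]
          exact ψ.strictMono hxy
        · by_cases hx : x ≤ a
          · simp only [g, if_neg hy, if_pos hx]
            have h1 : ψ x ≤ ψ a := ψ.monotone hx
            rw [hψ a haS] at h1
            have : 0 < k * (y - a) := mul_pos hk0 (by linarith)
            linarith
          · simp only [g, if_neg hy, if_neg hx]
            have : k * (x - a) < k * (y - a) := by gcongr
            linarith
      have hgs : Function.Surjective g := by
        intro y
        by_cases hy : y ≤ m a
        · refine ⟨ψ.symm y, ?_⟩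
          have : ψ.symm y ≤ a := by
            rw [OrderIso.symm_apply_le, hψ a haS]; exact hy
          simp [g, if_pos this]
        · refine ⟨a + (y - m a) / k, ?_⟩
          have : ¬ a + (y - m a) / k ≤ a := by
            have : 0 < (y - m a) / k := div_pos (by linarith) hk0
            linarith
          simp only [g, if_neg this]
          field_simp
          ring
      refine ⟨StrictMono.orderIsoOfSurjective g hg hgs, fun x hx => ?_⟩
      rw [StrictMono.coe_orderIsoOfSurjective]
      rcases Finset.mem_insert.1 hx with rfl | hx
      · have hne : x - a ≠ 0 := by linarith
        simp only [g, if_neg (not_le.2 hab), hk, div_mul_cancel₀ _ hne]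
        ring
      · have hxa : x ≤ a := S.le_max' x hx
        simp only [g, if_pos hxa, hψ x hx]

/-- `x` and `y` are in the same position with respect to the points of `Z`. -/
def SamePosition (Z : Finset ℝ) (x y : ℝ) : Prop :=
  ∀ z ∈ Z, (z < x ↔ z < y) ∧ (x < z ↔ y < z)

namespace SamePosition

variable {Z : Finset ℝ} {x y w : ℝ}

theorem refl (Z : Finset ℝ) (x : ℝ) : SamePosition Z x x := fun _ _ => ⟨Iff.rfl, Iff.rfl⟩

theorem symm (h : SamePosition Z x y) : SamePosition Z y x :=
  fun z hz => ⟨(h z hz).1.symm, (h z hz).2.symm⟩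

theorem trans (h : SamePosition Z x y) (h' : SamePosition Z y w) : SamePosition Z x w :=
  fun z hz => ⟨(h z hz).1.trans (h' z hz).1, (h z hz).2.trans (h' z hz).2⟩

theorem eq_of_mem (h : SamePosition Z x y) (hx : x ∈ Z) : y = x := by
  have := h x hx
  simp only [lt_irrefl, false_iff, not_lt] at this
  exact le_antisymm this.1 this.2

theorem notMem (h : SamePosition Z x y) (hx : x ∉ Z) : y ∉ Z := fun hy =>
  hx (h.symm.eq_of_mem hy ▸ hy)

theorem of_mem_Icc (h : SamePosition Z x y) (hw : w ∈ Set.Icc x y) : SamePosition Z x w := by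
  intro z hz
  have := h z hz
  obtain ⟨h1, h2⟩ := hw
  constructor <;> constructor <;> intro h3
  · linarith
  · exact this.1.2 (by linarith)
  · exact lt_of_le_of_lt h2 (this.2.1 h3)
  · linarith

theorem of_mem_uIcc (h : SamePosition Z x y) (hw : w ∈ Set.uIcc x y) : SamePosition Z x w := by
  rcases le_total x y with hxy | hxy
  · exact h.of_mem_Icc (by rwa [Set.uIcc_of_le hxy] at hw)
  · exact h.trans (h.symm.of_mem_Icc (by rwa [Set.uIcc_of_ge hxy] at hw))

theorem of_forall_notMem (hxy : x ≤ y) (h : ∀ z ∈ Z, z ∉ Set.Icc x y) : SamePosition Z x y := by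
  intro z hz
  have := h z hz
  simp only [Set.mem_Icc, not_and, not_le] at this
  constructor <;> constructor <;> intro h3
  · linarith
  · by_contra h4; push Not at h4; linarith [this h4]
  · exact this h3.le
  · linarith

end SamePosition

/-- A finite set of reals misses some neighbourhood of every point outside of it. -/
theorem exists_Icc_samePosition (Z : Finset ℝ) {x : ℝ} (hx : x ∉ Z) :
    ∃ a b, a < x ∧ x < b ∧ SamePosition Z a x ∧ SamePosition Z x b := by
  have : (↑Z : Set ℝ)ᶜ ∈ nhds x := Z.finite_toSet.isClosed.isOpen_compl.mem_nhds (by simpa using hx)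
  obtain ⟨ε, hε, h⟩ := Metric.mem_nhds_iff.1 this
  have key : ∀ z ∈ Z, ¬ |z - x| < ε := fun z hz hlt => h (by simpa [Real.dist_eq] using hlt) hz
  refine ⟨x - ε / 2, x + ε / 2, by linarith, by linarith, ?_, ?_⟩ <;>
  · refine SamePosition.of_forall_notMem (by linarith) fun z hz hz' => key z hz ?_
    rw [abs_lt]
    constructor <;> linarith [hz'.1, hz'.2]

/-- A continuous function without zeros between `x` and `y` has the same sign at `x` and `y`. -/
theorem sign_eq_of_forall_ne_zero {f : ℝ → ℝ} (hf : Continuous f) {x y : ℝ}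
    (h : ∀ w ∈ Set.uIcc x y, f w ≠ 0) : SignType.sign (f x) = SignType.sign (f y) := by
  by_contra hne
  have h0 : (0 : ℝ) ∈ Set.uIcc (f x) (f y) := by
    have hx := h x Set.left_mem_uIcc
    have hy := h y Set.right_mem_uIcc
    rw [Set.mem_uIcc]
    rcases lt_or_gt_of_ne hx with hx | hx <;> rcases lt_or_gt_of_ne hy with hy | hy
    · simp [sign_neg hx, sign_neg hy] at hne
    · exact Or.inl ⟨hx.le, hy.le⟩
    · exact Or.inr ⟨hy.le, hx.le⟩
    · simp [sign_pos hx, sign_pos hy] at hne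
  obtain ⟨w, hw, hw0⟩ := intermediate_value_uIcc hf.continuousOn h0
  exact h w hw hw0

/-- Values of the same sign, for functions increasing to the right. -/
theorem exists_pos_right {F G : ℝ → ℝ} {Z : Finset ℝ} {x : ℝ} (hG : Continuous G)
    (hFm : ∀ b, x < b → (∀ z ∈ Z, z ∉ Set.Ioo x b) → F x < F b)
    (hGm : ∀ b, x < b → (∀ z ∈ Z, z ∉ Set.Ioo x b) → G x < G b)
    (hZ : ∀ z ∈ Z, 0 < F z → 0 < G z)
    (hGt : Filter.Tendsto (fun y => |G y|) Filter.atTop Filter.atTop)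
    (hx : x ∉ Z) (hpos : 0 < F x) : ∃ y, SamePosition Z x y ∧ 0 < G y := by
  by_cases hne : (Z.filter (fun z => x < z)).Nonempty
  · set b := (Z.filter (fun z => x < z)).min' hne with hb
    have hbm := (Z.filter (fun z => x < z)).min'_mem hne
    rw [← hb, Finset.mem_filter] at hbm
    have hfree : ∀ z ∈ Z, z ∉ Set.Ioo x b := fun z hz hz' =>
      absurd ((Z.filter (fun z => x < z)).min'_le z (by simp [hz, hz'.1])) (not_le.2 hz'.2)
    have hGb : 0 < G b := hZ b hbm.1 (hpos.trans (hFm b hbm.2 hfree))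
    have h1 : ∀ᶠ y in nhdsWithin b (Set.Iio b), 0 < G y :=
      (hG.continuousAt.eventually (lt_mem_nhds hGb)).filter_mono nhdsWithin_le_nhds
    have h2 : ∀ᶠ y in nhdsWithin b (Set.Iio b), y ∈ Set.Ioo x b := Ioo_mem_nhdsLT hbm.2
    obtain ⟨y, hy1, hy2⟩ := (h1.and h2).exists
    refine ⟨y, SamePosition.of_forall_notMem hy2.1.le fun z hz hz' => ?_, hy1⟩
    rcases eq_or_lt_of_le hz'.1 with h | h
    · exact hx (h ▸ hz)
    · exact hfree z hz ⟨h, hz'.2.trans_lt hy2.2⟩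
  · have hfree : ∀ z ∈ Z, ¬ x < z := by
      intro z hz h; exact hne ⟨z, by simp [hz, h]⟩
    obtain ⟨y, hy1, hy2⟩ :=
      ((Filter.tendsto_atTop.1 hGt (|G x| + 1)).and (Filter.eventually_gt_atTop x)).exists
    -- Since `G` increases to the right of `x`, a value with `|G y| > |G x|` cannot be nonpositive.
    have hlt := hGm y hy2 fun z hz hz' => hfree z hz hz'.1
    refine ⟨y, SamePosition.of_forall_notMem hy2.le fun z hz hz' => ?_, ?_⟩
    · rcases eq_or_lt_of_le hz'.1 with h | h
      · exact hx (h ▸ hz)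
      · exact hfree z hz h
    · by_contra hle
      push Not at hle
      rw [abs_of_nonpos hle, abs_of_nonpos (by linarith)] at hy1
      linarith

/-- Two functions which, on every interval without interior points in `Z`, are both strictly
increasing or both strictly decreasing, which have the same signs on `Z` and which are unbounded
at infinity. -/
structure ComonotonePair (F G : ℝ → ℝ) (Z : Finset ℝ) : Prop where
  cont_left : Continuous F
  cont_right : Continuous G
  mono : ∀ a b, a < b → (∀ z ∈ Z, z ∉ Set.Ioo a b) →
    (StrictMonoOn F (Set.Icc a b) ∧ StrictMonoOn G (Set.Icc a b)) ∨
      (StrictAntiOn F (Set.Icc a b) ∧ StrictAntiOn G (Set.Icc a b))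
  sign_eq : ∀ z ∈ Z, SignType.sign (F z) = SignType.sign (G z)
  top_left : Filter.Tendsto (fun y => |F y|) Filter.atTop Filter.atTop
  top_right : Filter.Tendsto (fun y => |G y|) Filter.atTop Filter.atTop
  bot_left : Filter.Tendsto (fun y => |F y|) Filter.atBot Filter.atTop
  bot_right : Filter.Tendsto (fun y => |G y|) Filter.atBot Filter.atTop

/-! ### Matching the signs of a comonotone pair -/

namespace ComonotonePair

variable {F G : ℝ → ℝ} {Z : Finset ℝ}

theorem symm (h : ComonotonePair F G Z) : ComonotonePair G F Z where
  cont_left := h.cont_right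
  cont_right := h.cont_left
  mono a b hab hz := (h.mono a b hab hz).imp And.symm And.symm
  sign_eq z hz := (h.sign_eq z hz).symm
  top_left := h.top_right
  top_right := h.top_left
  bot_left := h.bot_right
  bot_right := h.bot_left

theorem neg (h : ComonotonePair F G Z) : ComonotonePair (-F) (-G) Z where
  cont_left := h.cont_left.neg
  cont_right := h.cont_right.neg
  mono a b hab hz := (h.mono a b hab hz).symm.imp (fun h => ⟨h.1.neg, h.2.neg⟩)
    (fun h => ⟨h.1.neg, h.2.neg⟩)
  sign_eq z hz := by simp [Left.sign_neg, h.sign_eq z hz]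
  top_left := by simpa using h.top_left
  top_right := by simpa using h.top_right
  bot_left := by simpa using h.bot_left
  bot_right := by simpa using h.bot_right

/-- The direction of monotonicity is constant on a component of the complement of `Z`. -/
theorem direction (h : ComonotonePair F G Z) {x : ℝ} (hx : x ∉ Z) :
    (∀ a b, a < b → a ≤ x → x ≤ b → (∀ z ∈ Z, z ∉ Set.Ioo a b) →
      (StrictMonoOn F (Set.Icc a b) ∧ StrictMonoOn G (Set.Icc a b))) ∨
    (∀ a b, a < b → a ≤ x → x ≤ b → (∀ z ∈ Z, z ∉ Set.Ioo a b) →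
      (StrictAntiOn F (Set.Icc a b) ∧ StrictAntiOn G (Set.Icc a b))) := by
  obtain ⟨a₀, b₀, ha₀, hb₀, hca, hcb⟩ := exists_Icc_samePosition Z hx
  have hfree : ∀ z ∈ Z, z ∉ Set.Ioo a₀ b₀ := by
    intro z hz hz'
    have h1 := (hca z hz).2.1 hz'.1
    have h2 := (hcb z hz).1.2 hz'.2
    linarith
  -- Every admissible interval around `x` shares a nondegenerate interval with the small one, so
  -- both have the same direction of monotonicity.
  have overlap : ∀ a b, a < b → a ≤ x → x ≤ b → ∃ u v, u < v ∧ u ∈ Set.Icc a b ∧ v ∈ Set.Icc a b ∧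
      u ∈ Set.Icc a₀ b₀ ∧ v ∈ Set.Icc a₀ b₀ := by
    intro a b hab hax hxb
    refine ⟨max a a₀, min b b₀, ?_, ⟨le_max_left _ _, ?_⟩, ⟨?_, min_le_left _ _⟩,
      ⟨le_max_right _ _, ?_⟩, ⟨?_, min_le_right _ _⟩⟩
    · rw [max_lt_iff, lt_min_iff, lt_min_iff]
      exact ⟨⟨hab, by linarith⟩, ⟨by linarith, by linarith⟩⟩
    · exact max_le hab.le (by linarith)
    · exact le_min hab.le (by linarith)
    · exact max_le (by linarith) (by linarith)
    · exact le_min (by linarith) (by linarith)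
  rcases h.mono a₀ b₀ (by linarith) hfree with h0 | h0
  · refine Or.inl fun a b hab hax hxb hz => ?_
    rcases h.mono a b hab hz with h1 | h1
    · exact h1
    · obtain ⟨u, v, huv, hu, hv, hu', hv'⟩ := overlap a b hab hax hxb
      exact absurd (h0.1 hu' hv' huv) (h1.1 hu hv huv).asymm
  · refine Or.inr fun a b hab hax hxb hz => ?_
    rcases h.mono a b hab hz with h1 | h1
    · obtain ⟨u, v, huv, hu, hv, hu', hv'⟩ := overlap a b hab hax hxb
      exact absurd (h0.1 hu' hv' huv) (h1.1 hu hv huv).asymm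
    · exact h1

/-- A function of the pair is injective on each component of the complement of `Z`. -/
theorem injective_left (h : ComonotonePair F G Z) {x y : ℝ} (hxy : SamePosition Z x y)
    (he : F x = F y) : x = y := by
  have key : ∀ x y, x < y → SamePosition Z x y → F x ≠ F y := by
    intro x y hlt hxy
    have hfree : ∀ z ∈ Z, z ∉ Set.Ioo x y := by
      intro z hz hz'
      have := (hxy z hz).2.1 hz'.1
      linarith [hz'.2]
    have hx : x ∈ Set.Icc x y := Set.left_mem_Icc.2 hlt.le
    have hy : y ∈ Set.Icc x y := Set.right_mem_Icc.2 hlt.le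
    rcases h.mono x y hlt hfree with h1 | h1
    · exact (h1.1 hx hy hlt).ne
    · exact (h1.1 hx hy hlt).ne'
  rcases lt_trichotomy x y with h1 | h1 | h1
  · exact absurd he (key x y h1 hxy)
  · exact h1
  · exact absurd he.symm (key y x h1 hxy.symm)

/-- In the direction in which `F` and `G` grow, the component ends at a point of `Z`, where `F` and
therefore `G` is positive, or at infinity, where `|G|` is unbounded. In both cases `G` becomes
positive inside the component. -/
theorem exists_pos (h : ComonotonePair F G Z) {x : ℝ} (hx : x ∉ Z) (hpos : 0 < F x) :
    ∃ y, SamePosition Z x y ∧ 0 < G y := by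
  have hZ : ∀ z ∈ Z, 0 < F z → 0 < G z := fun z hz hz' => by
    rw [← sign_eq_one_iff] at hz' ⊢; rw [← h.sign_eq z hz, hz']
  rcases h.direction hx with hd | hd
  · exact exists_pos_right h.cont_right
      (fun b hb hz => (hd x b hb le_rfl hb.le hz).1 (Set.left_mem_Icc.2 hb.le)
        (Set.right_mem_Icc.2 hb.le) hb)
      (fun b hb hz => (hd x b hb le_rfl hb.le hz).2 (Set.left_mem_Icc.2 hb.le)
        (Set.right_mem_Icc.2 hb.le) hb) hZ h.top_right hx hpos
  -- The decreasing case is the increasing one for `F (-t)` and `G (-t)`, with `Z` reflected.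
  · have hfree : ∀ b, (∀ z ∈ Z.image Neg.neg, z ∉ Set.Ioo (-x) b) →
        ∀ z ∈ Z, z ∉ Set.Ioo (-b) x := by
      intro b hz z hzZ hz'
      exact hz (-z) (Finset.mem_image_of_mem _ hzZ) ⟨by linarith [hz'.2], by linarith [hz'.1]⟩
    obtain ⟨y, hy, hpos⟩ := exists_pos_right (F := fun t => F (-t)) (G := fun t => G (-t))
      (Z := Z.image Neg.neg) (x := -x) (h.cont_right.comp continuous_neg)
      (fun b hb hz => (hd (-b) x (by linarith) (by linarith) le_rfl (hfree b hz)).1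
        (by constructor <;> linarith) (by constructor <;> linarith) (by linarith))
      (fun b hb hz => (hd (-b) x (by linarith) (by linarith) le_rfl (hfree b hz)).2
        (by constructor <;> linarith) (by constructor <;> linarith) (by linarith))
      (by
        intro z hz
        obtain ⟨w, hw, rfl⟩ := Finset.mem_image.1 hz
        simpa using hZ w hw)
      (h.bot_right.comp Filter.tendsto_neg_atTop_atBot)
      (by simpa using hx) (by simpa using hpos)
    refine ⟨-y, fun z hz => ?_, hpos⟩
    have := hy (-z) (Finset.mem_image_of_mem _ hz)
    rw [neg_lt_neg_iff, neg_lt_neg_iff] at this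
    rw [← neg_lt (a := z) , lt_neg (a := z)] at *
    constructor
    · exact this.2
    · exact this.1

/-- Off `Z` a zero of `F` is a sign change, by strict monotonicity nearby. So `G` takes both signs
on the same component and vanishes in between. -/
theorem exists_sign_eq (h : ComonotonePair F G Z) (x : ℝ) :
    ∃ y, SamePosition Z x y ∧ SignType.sign (F x) = SignType.sign (G y) := by
  by_cases hx : x ∈ Z
  · exact ⟨x, SamePosition.refl Z x, h.sign_eq x hx⟩
  have hneg : ∀ x, x ∉ Z → F x < 0 → ∃ y, SamePosition Z x y ∧ G y < 0 := fun x hx hF => by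
    obtain ⟨y, hy, hy'⟩ := h.neg.exists_pos hx (by simpa using hF)
    exact ⟨y, hy, by simpa using hy'⟩
  rcases lt_trichotomy (F x) 0 with hF | hF | hF
  · obtain ⟨y, hy, hy'⟩ := hneg x hx hF
    exact ⟨y, hy, by rw [sign_neg hF, sign_neg hy']⟩
  · obtain ⟨a, b, ha, hb, hca, hcb⟩ := exists_Icc_samePosition Z hx
    have hfree : ∀ z ∈ Z, z ∉ Set.Ioo a b := by
      intro z hz hz'
      have h1 := (hca z hz).2.1 hz'.1
      have h2 := (hcb z hz).1.2 hz'.2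
      linarith
    have hxm : x ∈ Set.Icc a b := ⟨ha.le, hb.le⟩
    have ham : a ∈ Set.Icc a b := Set.left_mem_Icc.2 (by linarith)
    have hbm : b ∈ Set.Icc a b := Set.right_mem_Icc.2 (by linarith)
    have key : ∃ u v, SamePosition Z x u ∧ SamePosition Z x v ∧ 0 < F u ∧ F v < 0 := by
      rcases h.mono a b (by linarith) hfree with h1 | h1
      · exact ⟨b, a, hcb, hca.symm, hF ▸ h1.1 hxm hbm hb, hF ▸ h1.1 ham hxm ha⟩
      · exact ⟨a, b, hca.symm, hcb, hF ▸ h1.1 ham hxm ha, hF ▸ h1.1 hxm hbm hb⟩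
    obtain ⟨u, v, hu, hv, hFu, hFv⟩ := key
    obtain ⟨u', hu', hGu⟩ := h.exists_pos (hu.notMem hx) hFu
    obtain ⟨v', hv', hGv⟩ := hneg v (hv.notMem hx) hFv
    obtain ⟨w, hw, hw0⟩ := intermediate_value_uIcc (h.cont_right.continuousOn (s := Set.uIcc u' v'))
      (Set.mem_uIcc.2 (Or.inr ⟨hGv.le, hGu.le⟩) : (0 : ℝ) ∈ _)
    exact ⟨w, (hu.trans hu').trans
      (((hu.trans hu').symm.trans (hv.trans hv')).of_mem_uIcc hw), by rw [hF, hw0]⟩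
  · obtain ⟨y, hy, hy'⟩ := h.exists_pos hx hF
    exact ⟨y, hy, by rw [sign_pos hF, sign_pos hy']⟩

/-- The sign functions of a comonotone pair agree up to an order isomorphism that fixes `Z`. -/
theorem exists_orderIso (h : ComonotonePair F G Z) (U : Finset ℝ) (hU : ∀ x, F x = 0 → x ∈ U) :
    ∃ ψ : ℝ ≃o ℝ, (∀ z ∈ Z, ψ z = z) ∧
      ∀ x, SignType.sign (F x) = SignType.sign (G (ψ x)) := by
  classical
  choose m hm1 hm2 using h.exists_sign_eq
  -- On `S` the isomorphism is prescribed: points of `Z` stay fixed and zeros of `F` go to zeros of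
  -- `G`. A component contains at most one zero, so the prescription is increasing.
  set S : Finset ℝ := Z ∪ U.filter (fun x => F x = 0) with hS
  have hmS : StrictMonoOn m S := by
    intro x hx x' hx' hlt
    by_cases hc : SamePosition Z x x'
    · have hxZ : x ∉ Z := fun hxZ => hlt.ne' (hc.eq_of_mem hxZ)
      have hxZ' : x' ∉ Z := hc.notMem hxZ
      have h1 : F x = 0 := by
        have := Finset.mem_coe.1 hx
        simp only [hS, Finset.mem_union, hxZ, Finset.mem_filter, false_or] at this
        exact this.2
      have h2 : F x' = 0 := by
        have := Finset.mem_coe.1 hx'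
        simp only [hS, Finset.mem_union, hxZ', Finset.mem_filter, false_or] at this
        exact this.2
      exact absurd (h.injective_left hc (h1.trans h2.symm)) hlt.ne
    · have : ∃ z ∈ Z, z ∈ Set.Icc x x' := by
        by_contra hno
        push Not at hno
        exact hc (SamePosition.of_forall_notMem hlt.le hno)
      obtain ⟨z, hz, hz1, hz2⟩ := this
      have e1 := hm1 x z hz
      have e2 := hm1 x' z hz
      rcases eq_or_lt_of_le hz1 with rfl | hz1
      · rw [(hm1 x).eq_of_mem hz]
        exact e2.1.1 hlt
      · exact (e1.2.1 hz1).trans_le (not_lt.1 fun h' => absurd (e2.2.2 h') (not_lt.2 hz2))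
  obtain ⟨ψ, hψ⟩ := exists_orderIso_eqOn_finset S m hmS
  have hψZ : ∀ z ∈ Z, ψ z = z := fun z hz => by
    rw [hψ z (by simp [hS, hz]), (hm1 z).eq_of_mem hz]
  have hψc : ∀ x, SamePosition Z x (ψ x) := by
    intro x z hz
    nth_rewrite 2 [← hψZ z hz]
    nth_rewrite 4 [← hψZ z hz]
    simp
  refine ⟨ψ, hψZ, fun x => ?_⟩
  by_cases hxS : x ∈ S
  · rw [hψ x hxS, hm2]
  have hxZ : x ∉ Z := fun hx => hxS (by simp [hS, hx])
  have hF0 : F x ≠ 0 := fun h0 => hxS (by simp [hS, h0, hU x h0])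
  rw [hm2 x]
  by_contra hne
  have hcy : SamePosition Z (m x) (ψ x) := (hm1 x).symm.trans (hψc x)
  -- Different signs would give a zero `w` of `G` in the component, hence a zero `u` of `F` there
  -- with `ψ u = w`. Then `x` and `ψ x` lie on the same side of `u` and `w` respectively, and
  -- comonotonicity makes the signs agree after all.
  have : ∃ w ∈ Set.uIcc (m x) (ψ x), G w = 0 := by
    by_contra hno
    push Not at hno
    exact hne (sign_eq_of_forall_ne_zero h.cont_right hno)
  obtain ⟨w, hw, hw0⟩ := this
  have hcw : SamePosition Z x w := (hm1 x).trans (hcy.of_mem_uIcc hw)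
  obtain ⟨u, hu, hu'⟩ := h.symm.exists_sign_eq w
  rw [hw0, sign_zero, eq_comm, sign_eq_zero_iff] at hu'
  have hcu : SamePosition Z x u := hcw.trans hu
  have huS : u ∈ S := by simp [hS, hu', hU u hu']
  have hψu : ψ u = w := by
    rw [hψ u huS]
    refine h.symm.injective_left ((hm1 u).symm.trans hu.symm) ?_
    have := hm2 u
    rw [hu', sign_zero, eq_comm, sign_eq_zero_iff] at this
    rw [this, hw0]
  have hwψ : SamePosition Z w (ψ x) := hcw.symm.trans (hψc x)
  apply hne
  rw [← hm2 x]
  have hfree : ∀ a b, SamePosition Z a b → ∀ z ∈ Z, z ∉ Set.Ioo a b := by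
    intro a b hab z hz hz'
    have := (hab z hz).2.1 hz'.1
    linarith [hz'.2]
  rcases lt_or_gt_of_ne (fun h0 => hF0 (h0 ▸ hu') : u ≠ x) with hlt | hlt
  · have hlt' : w < ψ x := hψu ▸ ψ.strictMono hlt
    set a := min u w
    set b := max x (ψ x)
    have hab : SamePosition Z a b := by
      have h1 : SamePosition Z x a := by
        rcases min_choice u w with h | h <;> simp only [a, h] <;> assumption
      have h2 : SamePosition Z x b := by
        rcases max_choice x (ψ x) with h | h <;> simp only [b, h]
        exacts [SamePosition.refl Z x, hψc x]
      exact h1.symm.trans h2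
    have h1 : u ∈ Set.Icc a b := ⟨min_le_left _ _, hlt.le.trans (le_max_left _ _)⟩
    have h2 : x ∈ Set.Icc a b := ⟨h1.1.trans hlt.le, le_max_left _ _⟩
    have h3 : w ∈ Set.Icc a b := ⟨min_le_right _ _, hlt'.le.trans (le_max_right _ _)⟩
    have h4 : ψ x ∈ Set.Icc a b := ⟨h3.1.trans hlt'.le, le_max_right _ _⟩
    rcases h.mono a b (h1.1.trans_lt (hlt.trans_le h2.2)) (hfree a b hab) with hd | hd
    · rw [sign_pos (hu' ▸ hd.1 h1 h2 hlt), sign_pos (hw0 ▸ hd.2 h3 h4 hlt')]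
    · rw [sign_neg (hu' ▸ hd.1 h1 h2 hlt), sign_neg (hw0 ▸ hd.2 h3 h4 hlt')]
  · have hlt' : ψ x < w := hψu ▸ ψ.strictMono hlt
    set a := min x (ψ x)
    set b := max u w
    have hab : SamePosition Z a b := by
      have h1 : SamePosition Z x b := by
        rcases max_choice u w with h | h <;> simp only [b, h] <;> assumption
      have h2 : SamePosition Z x a := by
        rcases min_choice x (ψ x) with h | h <;> simp only [a, h]
        exacts [SamePosition.refl Z x, hψc x]
      exact h2.symm.trans h1
    have h1 : u ∈ Set.Icc a b := ⟨(min_le_left _ _).trans hlt.le, le_max_left _ _⟩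
    have h2 : x ∈ Set.Icc a b := ⟨min_le_left _ _, hlt.le.trans h1.2⟩
    have h3 : w ∈ Set.Icc a b := ⟨(min_le_right _ _).trans hlt'.le, le_max_right _ _⟩
    have h4 : ψ x ∈ Set.Icc a b := ⟨min_le_right _ _, hlt'.le.trans h3.2⟩
    rcases h.mono a b (h2.1.trans_lt (hlt.trans_le h1.2)) (hfree a b hab) with hd | hd
    · rw [sign_neg (hu' ▸ hd.1 h2 h1 hlt), sign_neg (hw0 ▸ hd.2 h4 h3 hlt')]
    · rw [sign_pos (hu' ▸ hd.1 h2 h1 hlt), sign_pos (hw0 ▸ hd.2 h4 h3 hlt')]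

end ComonotonePair

/-! ### Elimination of one variable -/

section Elimination

open Polynomial

/-- Pseudo-division. -/
theorem Polynomial.exists_pseudo_division {R : Type*} [CommRing R] (q : R[X])
    (hq : 0 < q.natDegree) (p : R[X]) :
    ∃ (e : ℕ) (s r : R[X]), C q.leadingCoeff ^ e * p = q * s + r ∧ r.natDegree < q.natDegree := by
  induction hn : p.natDegree using Nat.strong_induction_on generalizing p with
  | _ n ih =>
    by_cases hlt : p.natDegree < q.natDegree
    · exact ⟨0, 0, p, by simp, hlt⟩
    push Not at hlt
    -- The leading terms cancel without division, at the cost of one factor `q.leadingCoeff`.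
    set p' := C q.leadingCoeff * p - C p.leadingCoeff * X ^ (p.natDegree - q.natDegree) * q with hp'
    have hdeg : p'.natDegree < n := by
      have hle : p'.natDegree ≤ n := by
        refine (natDegree_sub_le _ _).trans (max_le ((natDegree_C_mul_le _ _).trans hn.le) ?_)
        refine natDegree_mul_le.trans ?_
        have := natDegree_C_mul_X_pow_le p.leadingCoeff (p.natDegree - q.natDegree)
        omega
      refine lt_of_le_of_ne hle fun heq => ?_
      have hc : p'.coeff n = 0 := by
        rw [hp', coeff_sub, coeff_C_mul, mul_assoc, coeff_C_mul, coeff_X_pow_mul', if_pos (by omega),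
          show n - (p.natDegree - q.natDegree) = q.natDegree by omega, ← hn, coeff_natDegree,
          coeff_natDegree]
        ring
      rw [← heq, coeff_natDegree, leadingCoeff_eq_zero] at hc
      rw [hc, natDegree_zero] at heq
      omega
    obtain ⟨e, s, r, h, hr⟩ := ih _ hdeg p' rfl
    refine ⟨e + 1, s + C q.leadingCoeff ^ e * C p.leadingCoeff * X ^ (p.natDegree - q.natDegree),
      r, ?_, hr⟩
    rw [hp'] at h
    linear_combination h

/-- Pseudo-remainder of `p` by `q` (zero if `q` is constant). -/
theorem Polynomial.exists_pseudo_remainder {R : Type*} [CommRing R] (p q : R[X]) {m : ℕ}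
    (hm : 0 < m) (hq : q.natDegree ≤ m) :
    ∃ r : R[X], r.natDegree < m ∧ (0 < q.natDegree → ∃ e : ℕ, ∀ (σ : R →+* ℝ) (x : ℝ),
      eval₂ σ x q = 0 → σ q.leadingCoeff ^ e * eval₂ σ x p = eval₂ σ x r) := by
  by_cases h0 : 0 < q.natDegree
  · obtain ⟨e, s, r, h, hr⟩ := q.exists_pseudo_division h0 p
    refine ⟨r, hr.trans_le hq, fun _ => ⟨e, fun σ x hx => ?_⟩⟩
    have := congrArg (eval₂ σ x) h
    simpa [eval₂_mul, eval₂_add, eval₂_pow, hx] using this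
  · exact ⟨0, by simpa using hm, fun h => absurd h h0⟩

/-- Adding a polynomial to a family whose derivative, and whose remainders at the zeros of the
members of the family, are under control. -/
theorem exists_orderIso_sign_insert (L : Set (ℝ[X] × ℝ[X])) (hL : L.Finite) (F G : ℝ[X])
    (φ : ℝ ≃o ℝ) (hF : 0 < F.natDegree) (hG : 0 < G.natDegree)
    (h0 : ∀ p ∈ L, p.1 ≠ 0)
    (hφ : ∀ p ∈ L, ∀ x, SignType.sign (p.1.eval x) = SignType.sign (p.2.eval (φ x)))
    (hder : (derivative F, derivative G) ∈ L)
    (hrem : ∀ p ∈ L, ∀ x, p.1.eval x = 0 →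
      SignType.sign (F.eval x) = SignType.sign (G.eval (φ x))) :
    ∃ ψ : ℝ ≃o ℝ, (∀ p ∈ L, ∀ x, SignType.sign (p.1.eval x) = SignType.sign (p.2.eval (ψ x))) ∧
      ∀ x, SignType.sign (F.eval x) = SignType.sign (G.eval (ψ x)) := by
  classical
  -- `Z` collects the zeros of all members of `L`. On its gaps the derivatives of `F` and `G` have
  -- matching constant signs, so `F` and `G ∘ φ` are comonotone there.
  set Z : Finset ℝ := hL.toFinset.biUnion (fun p => p.1.roots.toFinset) with hZ
  have hmem : ∀ z, z ∈ Z ↔ ∃ p ∈ L, p.1.eval z = 0 := by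
    intro z
    simp only [hZ, Finset.mem_biUnion, Set.Finite.mem_toFinset, Multiset.mem_toFinset]
    exact exists_congr fun p => and_congr_right fun hp => by rw [mem_roots (h0 p hp)]; rfl
  have hcont : ∀ p : ℝ[X], Continuous fun x => p.eval x := fun p => p.continuous
  have hfree : ∀ p ∈ L, ∀ x y, (∀ w ∈ Set.uIcc x y, w ∉ Z) →
      SignType.sign (p.1.eval x) = SignType.sign (p.1.eval y) := by
    intro p hp x y hw
    exact sign_eq_of_forall_ne_zero (hcont p.1) fun w hw' h => hw w hw' ((hmem w).2 ⟨p, hp, h⟩)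
  have hpair : ComonotonePair (fun x => F.eval x) (fun x => G.eval (φ x)) Z := by
    refine ⟨hcont F, (hcont G).comp φ.continuous, ?_, ?_, F.abs_tendsto_atTop
      (natDegree_pos_iff_degree_pos.1 hF), (G.abs_tendsto_atTop
      (natDegree_pos_iff_degree_pos.1 hG)).comp φ.tendsto_atTop, F.abs_tendsto_atBot
      (natDegree_pos_iff_degree_pos.1 hF), (G.abs_tendsto_atBot
      (natDegree_pos_iff_degree_pos.1 hG)).comp φ.tendsto_atBot⟩
    · intro a b hab hz
      have hsign : ∀ x ∈ Set.Ioo a b, ∀ y ∈ Set.Ioo a b,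
          SignType.sign ((derivative F).eval x) = SignType.sign ((derivative F).eval y) :=
        fun x hx y hy => hfree _ hder x y fun w hw hwZ => hz w hwZ
          (Set.OrdConnected.uIcc_subset Set.ordConnected_Ioo hx hy hw)
      have hG' : ∀ y ∈ Set.Ioo (φ a) (φ b), ∀ x ∈ Set.Ioo a b,
          SignType.sign ((derivative G).eval y) = SignType.sign ((derivative F).eval x) := by
        intro y hy x hx
        have hy' : φ.symm y ∈ Set.Ioo a b :=
          ⟨φ.lt_symm_apply.2 hy.1, φ.symm_apply_lt.2 hy.2⟩
        have := hφ _ hder (φ.symm y)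
        rw [φ.apply_symm_apply] at this
        rw [← this]
        exact hsign _ hy' x hx
      set c := (a + b) / 2
      have hc : c ∈ Set.Ioo a b := ⟨by simp only [c]; linarith, by simp only [c]; linarith⟩
      have hφab : φ a < φ b := φ.strictMono hab
      have hc0 : (derivative F).eval c ≠ 0 := fun h => hz c ((hmem c).2 ⟨_, hder, h⟩) hc
      rcases lt_or_gt_of_ne hc0 with hneg | hpos
      · right
        rw [← sign_eq_neg_one_iff] at hneg
        refine ⟨strictAntiOn_of_deriv_neg (convex_Icc a b) (hcont F).continuousOn ?_, ?_⟩
        · intro x hx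
          rw [interior_Icc] at hx
          rw [Polynomial.deriv, ← sign_eq_neg_one_iff, hsign x hx c hc, hneg]
        · have : StrictAntiOn (fun y => G.eval y) (Set.Icc (φ a) (φ b)) := by
            refine strictAntiOn_of_deriv_neg (convex_Icc _ _) (hcont G).continuousOn ?_
            intro x hx
            rw [interior_Icc] at hx
            rw [Polynomial.deriv, ← sign_eq_neg_one_iff, hG' x hx c hc, hneg]
          intro x hx y hy hxy
          exact this ⟨φ.monotone hx.1, φ.monotone hx.2⟩ ⟨φ.monotone hy.1, φ.monotone hy.2⟩
            (φ.strictMono hxy)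
      · left
        replace hpos : SignType.sign ((derivative F).eval c) = 1 := sign_pos hpos
        refine ⟨strictMonoOn_of_deriv_pos (convex_Icc a b) (hcont F).continuousOn ?_, ?_⟩
        · intro x hx
          rw [interior_Icc] at hx
          rw [Polynomial.deriv, ← sign_eq_one_iff, hsign x hx c hc, hpos]
        · have : StrictMonoOn (fun y => G.eval y) (Set.Icc (φ a) (φ b)) := by
            refine strictMonoOn_of_deriv_pos (convex_Icc _ _) (hcont G).continuousOn ?_
            intro x hx
            rw [interior_Icc] at hx
            rw [Polynomial.deriv, ← sign_eq_one_iff, hG' x hx c hc, hpos]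
          intro x hx y hy hxy
          exact this ⟨φ.monotone hx.1, φ.monotone hx.2⟩ ⟨φ.monotone hy.1, φ.monotone hy.2⟩
            (φ.strictMono hxy)
    · intro z hz
      obtain ⟨p, hp, hpz⟩ := (hmem z).1 hz
      exact hrem p hp z hpz
  have hF0 : F ≠ 0 := by rintro rfl; simp at hF
  obtain ⟨ψ, hψZ, hψ⟩ := hpair.exists_orderIso F.roots.toFinset
    (fun x hx => by rw [Multiset.mem_toFinset, mem_roots hF0]; exact hx)
  -- `ψ` fixes `Z` and hence preserves each gap of `Z`, so applying it before `φ` does not disturb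
  -- the signs already matched.
  refine ⟨ψ.trans φ, fun p hp x => ?_, hψ⟩
  rw [OrderIso.trans_apply, ← hφ p hp (ψ x)]
  by_cases hx : x ∈ Z
  · rw [hψZ x hx]
  · refine hfree p hp x (ψ x) fun w hw hwZ => ?_
    have h1 := hψZ w hwZ
    rcases Set.mem_uIcc.1 hw with h | h
    · have hwx : x ≠ w := fun h => hx (h ▸ hwZ)
      have := ψ.strictMono (lt_of_le_of_ne h.1 hwx)
      linarith [h.2]
    · have hwx : w ≠ x := fun h => hx (h ▸ hwZ)
      have := ψ.strictMono (lt_of_le_of_ne h.2 hwx)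
      linarith [h.1]

/-- **Elimination theorem** (Cohen, Hörmander): the sign diagram of a finite family of polynomials
is determined by the signs of finitely many elements of the ring of coefficients. -/
theorem exists_finite_signs_determine_diagram {R : Type*} [CommRing R] (L : Multiset R[X]) :
    ∃ D : Set R, D.Finite ∧ ∀ σ τ : R →+* ℝ,
      (∀ d ∈ D, SignType.sign (σ d) = SignType.sign (τ d)) →
      ∃ φ : ℝ ≃o ℝ, ∀ p ∈ L, ∀ x,
        SignType.sign (eval₂ σ x p) = SignType.sign (eval₂ τ (φ x) p) := by
  classical
  -- Induction on the multiset of degrees in the Dershowitz–Manna order: a polynomial may be traded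
  -- for any finite number of polynomials of smaller degree.
  induction L using (InvImage.wf (fun L : Multiset R[X] => L.map natDegree)
    Multiset.wellFounded_isDershowitzMannaLT).induction with
  | _ L ih =>
    simp only [InvImage] at ih
    by_cases hconst : ∀ p ∈ L, p.natDegree = 0
    · refine ⟨(fun p => coeff p 0) '' {p | p ∈ L}, ?_, fun σ τ h => ⟨OrderIso.refl ℝ, ?_⟩⟩
      · exact (Multiset.finite_toSet L).image _
      · intro p hp x
        have := h (p.coeff 0) ⟨p, hp, rfl⟩
        rw [eq_C_of_natDegree_eq_zero (hconst p hp)]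
        simpa using this
    push Not at hconst
    obtain ⟨p, hpL, hpmax⟩ : ∃ p ∈ L, ∀ q ∈ L, q.natDegree ≤ p.natDegree := by
      obtain ⟨p₀, hp₀, -⟩ := hconst
      obtain ⟨p, hp, h⟩ := L.toFinset.exists_max_image natDegree ⟨p₀, by simpa using hp₀⟩
      exact ⟨p, by simpa using hp, fun q hq => h q (by simpa using hq)⟩
    have hm : 0 < p.natDegree := by
      obtain ⟨p₀, hp₀, h⟩ := hconst
      exact (Nat.pos_of_ne_zero h).trans_le (hpmax p₀ hp₀)
    obtain ⟨L', rfl⟩ := Multiset.exists_cons_of_mem hpL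
    -- deleting a leading coefficient
    have hlead : ∀ q ∈ p ::ₘ L', 0 < q.natDegree → ∃ D : Set R, D.Finite ∧ ∀ σ τ : R →+* ℝ,
        (∀ d ∈ D, SignType.sign (σ d) = SignType.sign (τ d)) →
        σ q.leadingCoeff = 0 → τ q.leadingCoeff = 0 →
        ∃ φ : ℝ ≃o ℝ, ∀ p' ∈ p ::ₘ L', ∀ x,
          SignType.sign (eval₂ σ x p') = SignType.sign (eval₂ τ (φ x) p') := by
      intro q hq hq0
      obtain ⟨M, hM⟩ := Multiset.exists_cons_of_mem hq
      rw [hM]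
      obtain ⟨D, hD, h⟩ := ih (q.eraseLead ::ₘ M) (by
        rw [hM]
        refine ⟨M.map natDegree, {q.eraseLead.natDegree}, {q.natDegree}, by simp, ?_, ?_, ?_⟩
        · rw [Multiset.map_cons, add_comm, Multiset.singleton_add]
        · rw [Multiset.map_cons, add_comm, Multiset.singleton_add]
        · intro y hy
          refine ⟨q.natDegree, by simp, ?_⟩
          rw [Multiset.mem_singleton.1 hy]
          have := q.eraseLead_natDegree_le
          omega)
      refine ⟨D, hD, fun σ τ hs hσ hτ => ?_⟩
      obtain ⟨φ, hφ⟩ := h σ τ hs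
      have herase : ∀ (σ : R →+* ℝ), σ q.leadingCoeff = 0 → ∀ x,
          eval₂ σ x q = eval₂ σ x q.eraseLead := by
        intro σ hσ x
        have := congrArg (eval₂ σ x) q.eraseLead_add_C_mul_X_pow
        rw [eval₂_add, eval₂_mul, eval₂_C, hσ, zero_mul, add_zero] at this
        exact this.symm
      refine ⟨φ, fun p' hp' x => ?_⟩
      rcases Multiset.mem_cons.1 hp' with rfl | hp'
      · rw [herase σ hσ, herase τ hτ]
        exact hφ _ (Multiset.mem_cons_self _ _) x
      · exact hφ p' (Multiset.mem_cons_of_mem hp') x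
    choose! D₁ hD₁ hD₁' using hlead
    -- replacing the polynomial by its derivative and its remainders
    set L₀ : Multiset R[X] := derivative p ::ₘ L' with hL₀
    have hder : (derivative p).natDegree < p.natDegree := natDegree_derivative_lt hm.ne'
    have hL₀deg : ∀ q ∈ L₀, q.natDegree ≤ p.natDegree := by
      intro q hq
      rcases Multiset.mem_cons.1 hq with rfl | hq
      · exact hder.le
      · exact hpmax q (Multiset.mem_cons_of_mem hq)
    have hrem : ∀ q ∈ L₀, ∃ r : R[X], r.natDegree < p.natDegree ∧ (0 < q.natDegree → ∃ e : ℕ,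
        ∀ (σ : R →+* ℝ) (x : ℝ), eval₂ σ x q = 0 →
          σ q.leadingCoeff ^ e * eval₂ σ x p = eval₂ σ x r) :=
      fun q hq => p.exists_pseudo_remainder q hm (hL₀deg q hq)
    choose! r hr hr' using hrem
    obtain ⟨D₂, hD₂, hD₂'⟩ := ih (L₀ + L₀.map r) (by
      refine ⟨L'.map natDegree, (derivative p).natDegree ::ₘ (L₀.map r).map natDegree,
        {p.natDegree}, by simp, ?_, ?_, ?_⟩
      · rw [hL₀, Multiset.map_add, Multiset.map_cons, Multiset.cons_add, Multiset.add_cons]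
      · rw [Multiset.map_cons, add_comm, Multiset.singleton_add]
      · intro y hy
        refine ⟨p.natDegree, by simp, ?_⟩
        rcases Multiset.mem_cons.1 hy with rfl | hy
        · exact hder
        · simp only [Multiset.mem_map] at hy
          obtain ⟨_, ⟨q, hq, rfl⟩, rfl⟩ := hy
          exact hr q hq)
    -- `D₁ q` serves the case in which the leading coefficient of `q` is mapped to zero, and `D₂`
    -- the generic case. The leading coefficients are included so that `σ` and `τ` fall into the
    -- same case.
    refine ⟨(⋃ q ∈ {q | q ∈ p ::ₘ L' ∧ 0 < q.natDegree}, D₁ q) ∪ D₂ ∪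
      leadingCoeff '' {q | q ∈ p ::ₘ L₀}, ?_, fun σ τ hs => ?_⟩
    · refine ((Set.Finite.biUnion ?_ fun q hq => hD₁ q hq.1 hq.2).union hD₂).union
        ((Multiset.finite_toSet _).image _)
      exact (Multiset.finite_toSet (p ::ₘ L')).subset fun q hq => hq.1
    have hsl : ∀ q ∈ p ::ₘ L₀, SignType.sign (σ q.leadingCoeff) = SignType.sign (τ q.leadingCoeff) :=
      fun q hq => hs _ (Or.inr ⟨q, hq, rfl⟩)
    have hzero : ∀ q ∈ p ::ₘ L₀, σ q.leadingCoeff = 0 → τ q.leadingCoeff = 0 := by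
      intro q hq h
      have := hsl q hq
      rwa [h, sign_zero, eq_comm, sign_eq_zero_iff] at this
    by_cases hex : ∃ q ∈ p ::ₘ L', 0 < q.natDegree ∧ σ q.leadingCoeff = 0
    · obtain ⟨q, hq, hq0, hσ⟩ := hex
      refine hD₁' q hq hq0 σ τ (fun d hd => hs d (Or.inl (Or.inl ?_))) hσ (hzero q ?_ hσ)
      · exact Set.mem_biUnion (x := q) ⟨hq, hq0⟩ hd
      · rcases Multiset.mem_cons.1 hq with rfl | hq
        · exact Multiset.mem_cons_self _ _
        · exact Multiset.mem_cons_of_mem (Multiset.mem_cons_of_mem hq)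
    push Not at hex
    obtain ⟨φ, hφ⟩ := hD₂' σ τ fun d hd => hs d (Or.inl (Or.inr hd))
    have hσp : σ p.leadingCoeff ≠ 0 := hex p (Multiset.mem_cons_self _ _) hm
    have hne_iff : ∀ q ∈ p ::ₘ L₀, σ q.leadingCoeff ≠ 0 → τ q.leadingCoeff ≠ 0 := by
      intro q hq h h'
      have := hsl q hq
      rw [h', sign_zero, sign_eq_zero_iff] at this
      exact h this
    have hτp : τ p.leadingCoeff ≠ 0 := hne_iff p (Multiset.mem_cons_self _ _) hσp
    -- `R` may have torsion, so the derivative could lose more than one degree. But its coefficient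
    -- in degree `p.natDegree - 1` is mapped to `p.natDegree * σ p.leadingCoeff`, which is nonzero
    -- in `ℝ`.
    have hderlc : σ (derivative p).leadingCoeff ≠ 0 := by
      have hcoeff : σ ((derivative p).coeff (p.natDegree - 1)) ≠ 0 := by
        rw [coeff_derivative, Nat.sub_add_cancel hm, coeff_natDegree, map_mul]
        refine mul_ne_zero hσp ?_
        rw [map_add, map_natCast, map_one]
        positivity
      have hle : p.natDegree - 1 ≤ (derivative p).natDegree :=
        le_natDegree_of_ne_zero fun h => hcoeff (by rw [h, map_zero])
      rwa [show p.natDegree - 1 = (derivative p).natDegree by omega] at hcoeff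
    -- The remaining members with vanishing leading coefficient are constants mapped to zero. They
    -- are left out of the family passed on, whose members must be nonzero, and their signs agree
    -- trivially.
    have hsplit : ∀ q ∈ L₀, σ q.leadingCoeff = 0 → q.natDegree = 0 := by
      intro q hq h
      rcases Multiset.mem_cons.1 hq with rfl | hq
      · exact absurd h hderlc
      · by_contra hq0
        exact hex q (Multiset.mem_cons_of_mem hq) (Nat.pos_of_ne_zero hq0) h
    obtain ⟨ψ, hψ, hψp⟩ := exists_orderIso_sign_insert
      ((fun q : R[X] => (q.map σ, q.map τ)) '' {q | q ∈ L₀ ∧ σ q.leadingCoeff ≠ 0})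
      (((Multiset.finite_toSet L₀).subset fun q hq => hq.1).image _) (p.map σ) (p.map τ) φ
      (by rwa [natDegree_map_of_leadingCoeff_ne_zero _ hσp])
      (by rwa [natDegree_map_of_leadingCoeff_ne_zero _ hτp])
      (by
        rintro _ ⟨q, hq, rfl⟩
        intro (h0 : q.map σ = 0)
        have := leadingCoeff_map_of_leadingCoeff_ne_zero σ hq.2
        rw [h0, leadingCoeff_zero] at this
        exact hq.2 this.symm)
      (by
        rintro _ ⟨q, hq, rfl⟩ x
        simp only [eval_map]
        exact hφ q (Multiset.mem_add.2 (Or.inl hq.1)) x)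
      ⟨derivative p, ⟨Multiset.mem_cons_self _ _, hderlc⟩, by simp only [derivative_map]⟩
      (by
        rintro _ ⟨q, ⟨hq, hqσ⟩, rfl⟩ x hx
        simp only [eval_map] at hx ⊢
        have hq0 : 0 < q.natDegree := by
          by_contra h0
          have h0 : q.natDegree = 0 := by omega
          rw [leadingCoeff, h0] at hqσ
          rw [eq_C_of_natDegree_eq_zero h0, eval₂_C] at hx
          exact hqσ hx
        have hy : eval₂ τ (φ x) q = 0 := by
          have := hφ q (Multiset.mem_add.2 (Or.inl hq)) x
          rwa [hx, sign_zero, eq_comm, sign_eq_zero_iff] at this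
        obtain ⟨e, he⟩ := hr' q hq hq0
        -- At a zero of `q` the remainder equals `p` times a power of the leading coefficient;
        -- cancelling the equal nonzero signs of that power compares the signs of `p`.
        have h1 := hφ (r q) (Multiset.mem_add.2 (Or.inr (Multiset.mem_map_of_mem r hq))) x
        rw [← he σ x hx, ← he τ (φ x) hy, sign_mul, sign_mul, sign_pow, sign_pow,
          hsl q (Multiset.mem_cons_of_mem hq)] at h1
        refine mul_left_cancel₀ (pow_ne_zero e ?_) h1
        exact sign_ne_zero.2 (hne_iff q (Multiset.mem_cons_of_mem hq) hqσ))
    refine ⟨ψ, fun q hq x => ?_⟩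
    rcases Multiset.mem_cons.1 hq with rfl | hq
    · simpa only [eval_map] using hψp x
    · have hqL₀ : q ∈ L₀ := Multiset.mem_cons_of_mem hq
      by_cases hσ : σ q.leadingCoeff = 0
      · have hτ := hzero q (Multiset.mem_cons_of_mem hqL₀) hσ
        have h0 := hsplit q hqL₀ hσ
        rw [leadingCoeff, h0] at hσ hτ
        rw [eq_C_of_natDegree_eq_zero h0, eval₂_C, eval₂_C, hσ, hτ]
      · simpa only [eval_map] using hψ _ ⟨q, ⟨hqL₀, hσ⟩, rfl⟩ x

end Elimination

/-! ### Calculus of semialgebraic sets -/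

section Semialgebraic

variable {V W U : Type*} [AddCommGroup V] [Module ℝ V] [AddCommGroup W] [Module ℝ W]
  [AddCommGroup U] [Module ℝ U]

/-! ### Boolean operations and sign vectors -/

namespace IsSemialgebraic

theorem inter {S T : Set V} (hS : IsSemialgebraic S) (hT : IsSemialgebraic T) :
    IsSemialgebraic (S ∩ T) := by
  rw [← compl_compl (S ∩ T), Set.compl_inter]
  exact .compl _ (.union _ _ (.compl _ hS) (.compl _ hT))

theorem univ : IsSemialgebraic (Set.univ : Set V) := by
  convert IsSemialgebraic.pos (fun _ : V => (1 : ℝ)) (one_mem (polyFunctions V))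
  simp

theorem empty : IsSemialgebraic (∅ : Set V) := by
  rw [← Set.compl_univ]; exact .compl _ univ

theorem biUnion {ι : Type*} {I : Set ι} (hI : I.Finite) {S : ι → Set V}
    (h : ∀ i ∈ I, IsSemialgebraic (S i)) : IsSemialgebraic (⋃ i ∈ I, S i) := by
  induction I, hI using Set.Finite.induction_on with
  | empty => simpa using empty
  | insert _ _ ih =>
    rw [Set.biUnion_insert]
    exact .union _ _ (h _ (Set.mem_insert _ _)) (ih fun i hi => h i (Set.mem_insert_of_mem _ hi))

theorem biInter {ι : Type*} {I : Set ι} (hI : I.Finite) {S : ι → Set V}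
    (h : ∀ i ∈ I, IsSemialgebraic (S i)) : IsSemialgebraic (⋂ i ∈ I, S i) := by
  rw [← compl_compl (⋂ i ∈ I, S i)]
  simp only [Set.compl_iInter]
  exact .compl _ (biUnion hI fun i hi => .compl _ (h i hi))

theorem sign_eq {p : V → ℝ} (hp : p ∈ polyFunctions V) (s : SignType) :
    IsSemialgebraic {x | SignType.sign (p x) = s} := by
  have h1 := IsSemialgebraic.pos p hp
  have h2 : IsSemialgebraic {x | p x < 0} := by
    simpa using IsSemialgebraic.pos (-p) (neg_mem hp)
  rcases s with _ | _ | _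
  · have : {x | SignType.sign (p x) = 0} = ({x | 0 < p x} ∪ {x | p x < 0})ᶜ := by
      ext x
      simp only [Set.mem_ofPred_eq, sign_eq_zero_iff, Set.mem_compl_iff, Set.mem_union, not_or,
        not_lt]
      exact ⟨fun h => ⟨h.le, h.ge⟩, fun h => le_antisymm h.1 h.2⟩
    exact this ▸ .compl _ (.union _ _ h1 h2)
  · simpa only [SignType.neg_eq_neg_one, sign_eq_neg_one_iff] using h2
  · simpa only [SignType.pos_eq_one, sign_eq_one_iff] using h1

theorem eq_zero {p : V → ℝ} (hp : p ∈ polyFunctions V) : IsSemialgebraic {x | p x = 0} := by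
  simpa using sign_eq hp 0

theorem nonneg {p : V → ℝ} (hp : p ∈ polyFunctions V) : IsSemialgebraic {x | 0 ≤ p x} := by
  have := IsSemialgebraic.compl _ (IsSemialgebraic.pos (-p) (neg_mem hp))
  simpa [Set.compl_ofPred] using this

/-- Semialgebraic sets are determined by the signs of finitely many polynomial functions. -/
theorem exists_finite_signs {S : Set V} (hS : IsSemialgebraic S) :
    ∃ D : Set (V → ℝ), D.Finite ∧ D ⊆ polyFunctions V ∧ ∀ v w,
      (∀ d ∈ D, SignType.sign (d v) = SignType.sign (d w)) → (v ∈ S → w ∈ S) := by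
  have : ∃ D : Set (V → ℝ), D.Finite ∧ D ⊆ polyFunctions V ∧ ∀ v w,
      (∀ d ∈ D, SignType.sign (d v) = SignType.sign (d w)) → (v ∈ S ↔ w ∈ S) := by
    induction hS with
    | pos p hp =>
      refine ⟨{p}, Set.finite_singleton _, by simpa using hp, fun v w h => ?_⟩
      simp only [Set.mem_ofPred_eq, ← sign_eq_one_iff, h p rfl]
    | compl S _ ih =>
      obtain ⟨D, h1, h2, h3⟩ := ih
      exact ⟨D, h1, h2, fun v w h => not_congr (h3 v w h)⟩
    | union S T _ _ ih ih' =>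
      obtain ⟨D, h1, h2, h3⟩ := ih
      obtain ⟨D', h1', h2', h3'⟩ := ih'
      exact ⟨D ∪ D', h1.union h1', Set.union_subset h2 h2', fun v w h =>
        or_congr (h3 v w fun d hd => h d (Or.inl hd)) (h3' v w fun d hd => h d (Or.inr hd))⟩
  obtain ⟨D, h1, h2, h3⟩ := this
  exact ⟨D, h1, h2, fun v w h => (h3 v w h).1⟩

/-- There are finitely many sign vectors on `D`, and `S` is the union of the loci of those realised
by points of `S`. -/
theorem of_finite_signs {S : Set V} {D : Set (V → ℝ)} (hD : D.Finite) (hDp : D ⊆ polyFunctions V)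
    (h : ∀ v w, (∀ d ∈ D, SignType.sign (d v) = SignType.sign (d w)) → (v ∈ S → w ∈ S)) :
    IsSemialgebraic S := by
  have : Finite D := hD
  have hS : S = ⋃ s ∈ {s : D → SignType | ∃ v ∈ S, ∀ d : D, SignType.sign (d.1 v) = s d},
      ⋂ d ∈ (Set.univ : Set D), {w | SignType.sign (d.1 w) = s d} := by
    ext w
    simp only [Set.mem_ofPred_eq, Set.mem_iUnion, Set.mem_iInter, Set.mem_univ, true_implies]
    constructor
    · exact fun hw => ⟨fun d => SignType.sign (d.1 w), ⟨w, hw, fun _ => rfl⟩, fun _ => rfl⟩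
    · rintro ⟨s, ⟨v, hv, hvs⟩, hws⟩
      exact h v w (fun d hd => (hvs ⟨d, hd⟩).trans (hws ⟨d, hd⟩).symm) hv
  rw [hS]
  exact biUnion (Set.toFinite _) fun s _ => biInter Set.finite_univ fun d _ => sign_eq (hDp d.2) _

end IsSemialgebraic

/-- Polynomial maps between real vector spaces. -/
def IsPolynomialMap (g : V → W) : Prop :=
  ∀ f : Module.Dual ℝ W, (fun v => f (g v)) ∈ polyFunctions V

/-! ### Polynomial maps and substitution -/

namespace IsPolynomialMap

theorem comp_mem {g : V → W} (hg : IsPolynomialMap g) {p : W → ℝ} (hp : p ∈ polyFunctions W) :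
    (fun v => p (g v)) ∈ polyFunctions V := by
  induction hp using Algebra.adjoin_induction with
  | mem p hp =>
    obtain ⟨f, rfl⟩ := hp
    exact hg f
  | algebraMap r => exact (polyFunctions V).algebraMap_mem r
  | add p q _ _ ih ih' => exact add_mem ih ih'
  | mul p q _ _ ih ih' => exact mul_mem ih ih'

theorem mem_polyFunctions {p : V → ℝ} (hp : IsPolynomialMap p) : p ∈ polyFunctions V := by
  simpa using hp LinearMap.id

theorem linear (g : V →ₗ[ℝ] W) : IsPolynomialMap g := fun f =>
  Algebra.subset_adjoin ⟨f ∘ₗ g, rfl⟩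

theorem const (w : W) : IsPolynomialMap fun _ : V => w := fun f =>
  (polyFunctions V).algebraMap_mem (f w)

theorem comp {g : W → U} {g' : V → W} (hg : IsPolynomialMap g) (hg' : IsPolynomialMap g') :
    IsPolynomialMap fun v => g (g' v) := fun f => hg'.comp_mem (hg f)

theorem add {g g' : V → W} (hg : IsPolynomialMap g) (hg' : IsPolynomialMap g') :
    IsPolynomialMap fun v => g v + g' v := fun f => by
  simpa only [map_add] using! add_mem (hg f) (hg' f)

theorem sub {g g' : V → W} (hg : IsPolynomialMap g) (hg' : IsPolynomialMap g') :
    IsPolynomialMap fun v => g v - g' v := fun f => by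
  simpa only [map_sub] using! sub_mem (hg f) (hg' f)

theorem prodMk {g : V → W} {g' : V → U} (hg : IsPolynomialMap g) (hg' : IsPolynomialMap g') :
    IsPolynomialMap fun v => (g v, g' v) := fun f => by
  have : (fun v => f (g v, g' v)) =
      (fun v => (f ∘ₗ LinearMap.inl ℝ W U) (g v)) + fun v => (f ∘ₗ LinearMap.inr ℝ W U) (g' v) := by
    ext v
    simp [← map_add]
  rw [this]
  exact add_mem (hg _) (hg' _)

theorem fst {g : V → W × U} (hg : IsPolynomialMap g) : IsPolynomialMap fun v => (g v).1 :=
  (linear (LinearMap.fst ℝ W U)).comp hg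

theorem snd {g : V → W × U} (hg : IsPolynomialMap g) : IsPolynomialMap fun v => (g v).2 :=
  (linear (LinearMap.snd ℝ W U)).comp hg

theorem id : IsPolynomialMap fun v : V => v := linear LinearMap.id

theorem bilinear {U' : Type*} [AddCommGroup U'] [Module ℝ U'] [FiniteDimensional ℝ W]
    (b : W →ₗ[ℝ] U →ₗ[ℝ] U') {g : V → W} {g' : V → U} (hg : IsPolynomialMap g)
    (hg' : IsPolynomialMap g') : IsPolynomialMap fun v => b (g v) (g' v) := fun f => by
  set e := Module.finBasis ℝ W
  -- Expanding the first argument in a basis leaves products of a coordinate and a linear functional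
  -- of the second argument.
  have : (fun v => f (b (g v) (g' v))) =
      ∑ i, (fun v => e.coord i (g v)) * fun v => (f ∘ₗ b (e i)) (g' v) := by
    ext v
    conv_lhs => rw [← e.sum_repr (g v), map_sum]
    simp
  rw [this]
  exact sum_mem fun i _ => mul_mem (hg _) (hg' _)

theorem smul {g : V → ℝ} {g' : V → W} (hg : IsPolynomialMap g) (hg' : IsPolynomialMap g') :
    IsPolynomialMap fun v => g v • g' v :=
  bilinear (LinearMap.lsmul ℝ W) hg hg'

end IsPolynomialMap

/-! ### Projections and first-order formulas -/

namespace IsSemialgebraic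

theorem preimage {g : V → W} (hg : IsPolynomialMap g) {S : Set W} (hS : IsSemialgebraic S) :
    IsSemialgebraic (g ⁻¹' S) := by
  induction hS with
  | pos p hp => exact .pos (fun v => p (g v)) (hg.comp_mem hp)
  | compl S _ ih => exact .compl _ ih
  | union S T _ _ ih ih' => exact .union _ _ ih ih'

/-- Evaluation of polynomial functions at a point. -/
def polyFunctionsEval (v : V) : polyFunctions V →+* ℝ :=
  (Pi.evalRingHom (fun _ : V => ℝ) v).comp (polyFunctions V).val.toRingHom

/-- Polynomial functions on `V × ℝ` are polynomials in the second variable. -/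
theorem exists_polynomial_of_mem {p : V × ℝ → ℝ} (hp : p ∈ polyFunctions (V × ℝ)) :
    ∃ q : Polynomial (polyFunctions V), ∀ v x, p (v, x) =
      Polynomial.eval₂ (polyFunctionsEval v) x q := by
  induction hp using Algebra.adjoin_induction with
  | mem p hp =>
    obtain ⟨f, rfl⟩ := hp
    have h1 : (fun v => (f ∘ₗ LinearMap.inl ℝ V ℝ) v) ∈ polyFunctions V :=
      Algebra.subset_adjoin ⟨_, rfl⟩
    refine ⟨Polynomial.C ⟨_, h1⟩ + Polynomial.C (algebraMap ℝ _ (f (0, 1))) * Polynomial.X, ?_⟩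
    intro v x
    have : (v, x) = (v, (0 : ℝ)) + x • ((0 : V), (1 : ℝ)) := by simp
    change f (v, x) = _
    rw [this, map_add, map_smul]
    rw [Polynomial.eval₂_add, Polynomial.eval₂_mul, Polynomial.eval₂_C, Polynomial.eval₂_C,
      Polynomial.eval₂_X, smul_eq_mul, mul_comm]
    rfl
  | algebraMap r =>
    exact ⟨Polynomial.C (algebraMap ℝ _ r), fun v x => by rw [Polynomial.eval₂_C]; rfl⟩
  | add p q _ _ ih ih' =>
    obtain ⟨a, ha⟩ := ih
    obtain ⟨b, hb⟩ := ih'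
    exact ⟨a + b, fun v x => by rw [Polynomial.eval₂_add, ← ha, ← hb]; rfl⟩
  | mul p q _ _ ih ih' =>
    obtain ⟨a, ha⟩ := ih
    obtain ⟨b, hb⟩ := ih'
    exact ⟨a * b, fun v x => by rw [Polynomial.eval₂_mul, ← ha, ← hb]; rfl⟩

/-- **Tarski–Seidenberg**, one variable. -/
theorem exists_real {S : Set (V × ℝ)} (hS : IsSemialgebraic S) :
    IsSemialgebraic {v | ∃ x, (v, x) ∈ S} := by
  obtain ⟨D, hD, hDp, hDS⟩ := hS.exists_finite_signs
  have : ∀ d ∈ D, ∃ q : Polynomial (polyFunctions V), ∀ v x, d (v, x) =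
      Polynomial.eval₂ (polyFunctionsEval v) x q := fun d hd => exists_polynomial_of_mem (hDp hd)
  choose! q hq using this
  -- The coefficient ring is `polyFunctions V`, and points `v`, `w` act as ring homomorphisms to
  -- `ℝ`. Elimination then compares the sign diagrams on the fibres over `v` and `w`.
  obtain ⟨C, hC, hCs⟩ := exists_finite_signs_determine_diagram (hD.toFinset.val.map q)
  refine of_finite_signs (hC.image Subtype.val) ?_ ?_
  · rintro _ ⟨c, -, rfl⟩
    exact c.2
  · rintro v w h ⟨x, hx⟩
    obtain ⟨φ, hφ⟩ := hCs (polyFunctionsEval v) (polyFunctionsEval w) (fun c hc => h _ ⟨c, hc, rfl⟩)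
    refine ⟨φ x, hDS _ _ (fun d hd => ?_) hx⟩
    rw [hq d hd, hq d hd]
    exact hφ _ (Multiset.mem_map_of_mem q (by simpa using hd)) x

theorem exists_fin (n : ℕ) {S : Set (V × (Fin n → ℝ))} (hS : IsSemialgebraic S) :
    IsSemialgebraic {v | ∃ x, (v, x) ∈ S} := by
  induction n with
  | zero =>
    convert hS.preimage (IsPolynomialMap.id.prodMk (.const 0)) using 1
    ext v
    exact ⟨fun ⟨x, hx⟩ => by simpa [Subsingleton.elim x 0] using hx, fun h => ⟨0, h⟩⟩
  | succ n ih =>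
    have hg : IsPolynomialMap fun p : (V × (Fin n → ℝ)) × ℝ =>
        (p.1.1, (Fin.cons p.2 p.1.2 : Fin (n + 1) → ℝ)) := by
      refine IsPolynomialMap.prodMk (.fst (.fst .id)) ?_
      exact .linear (V := (V × (Fin n → ℝ)) × ℝ) (W := Fin (n + 1) → ℝ)
        { toFun := fun p => Fin.cons p.2 p.1.2
          map_add' := fun p q => by ext i; refine Fin.cases ?_ (fun i => ?_) i <;> simp
          map_smul' := fun c p => by ext i; refine Fin.cases ?_ (fun i => ?_) i <;> simp }
    convert ih (exists_real (hS.preimage hg)) using 1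
    ext v
    constructor
    · rintro ⟨x, hx⟩
      exact ⟨Fin.tail x, x 0, by simpa using hx⟩
    · rintro ⟨x, y, h⟩
      exact ⟨_, h⟩

/-- **Tarski–Seidenberg**. -/
theorem setOf_exists [FiniteDimensional ℝ W] {P : V → W → Prop}
    (h : IsSemialgebraic {p : V × W | P p.1 p.2}) : IsSemialgebraic {v | ∃ w, P v w} := by
  set e := (Module.finBasis ℝ W).equivFun
  have hg : IsPolynomialMap fun p : V × (Fin (Module.finrank ℝ W) → ℝ) => (p.1, e.symm p.2) :=
    .prodMk (.fst .id) ((IsPolynomialMap.linear e.symm.toLinearMap).comp (.snd .id))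
  convert exists_fin _ (h.preimage hg) using 1
  ext v
  exact ⟨fun ⟨w, hw⟩ => ⟨e w, by simpa using hw⟩, fun ⟨x, hx⟩ => ⟨_, hx⟩⟩

theorem setOf_and {P P' : V → Prop} (h : IsSemialgebraic {v | P v})
    (h' : IsSemialgebraic {v | P' v}) : IsSemialgebraic {v | P v ∧ P' v} := h.inter h'

theorem setOf_or {P P' : V → Prop} (h : IsSemialgebraic {v | P v})
    (h' : IsSemialgebraic {v | P' v}) : IsSemialgebraic {v | P v ∨ P' v} := .union _ _ h h'

theorem setOf_not {P : V → Prop} (h : IsSemialgebraic {v | P v}) :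
    IsSemialgebraic {v | ¬ P v} := .compl _ h

theorem setOf_imp {P P' : V → Prop} (h : IsSemialgebraic {v | P v})
    (h' : IsSemialgebraic {v | P' v}) : IsSemialgebraic {v | P v → P' v} := by
  simpa only [imp_iff_not_or] using setOf_or (setOf_not h) h'

theorem setOf_iff {P P' : V → Prop} (h : IsSemialgebraic {v | P v})
    (h' : IsSemialgebraic {v | P' v}) : IsSemialgebraic {v | P v ↔ P' v} := by
  simpa only [iff_iff_implies_and_implies] using setOf_and (setOf_imp h h') (setOf_imp h' h)

theorem setOf_forall [FiniteDimensional ℝ W] {P : V → W → Prop}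
    (h : IsSemialgebraic {p : V × W | P p.1 p.2}) : IsSemialgebraic {v | ∀ w, P v w} := by
  simpa using setOf_not (setOf_exists (P := fun v w => ¬ P v w) (setOf_not h))

theorem setOf_mem {g : V → W} (hg : IsPolynomialMap g) {S : Set W} (hS : IsSemialgebraic S) :
    IsSemialgebraic {v | g v ∈ S} := hS.preimage hg

theorem setOf_lt {f g : V → ℝ} (hf : IsPolynomialMap f) (hg : IsPolynomialMap g) :
    IsSemialgebraic {v | f v < g v} := by
  simpa using IsSemialgebraic.pos _ (hg.sub hf).mem_polyFunctions

theorem setOf_le {f g : V → ℝ} (hf : IsPolynomialMap f) (hg : IsPolynomialMap g) :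
    IsSemialgebraic {v | f v ≤ g v} := by
  simpa using nonneg (hg.sub hf).mem_polyFunctions

theorem setOf_eq [FiniteDimensional ℝ W] {f g : V → W} (hf : IsPolynomialMap f)
    (hg : IsPolynomialMap g) : IsSemialgebraic {v | f v = g v} := by
  set e := Module.finBasis ℝ W
  have : {v | f v = g v} = ⋂ i ∈ (Set.univ : Set (Fin (Module.finrank ℝ W))),
      {v | e.coord i (f v - g v) = 0} := by
    ext v
    simp only [Set.mem_ofPred_eq, Set.mem_univ, Set.iInter_true, Set.mem_iInter]
    rw [← sub_eq_zero]
    exact e.forall_coord_eq_zero_iff.symm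
  rw [this]
  exact biInter Set.finite_univ fun i _ => eq_zero (hf.sub hg _)

theorem submodule [FiniteDimensional ℝ V] (M : Submodule ℝ V) :
    IsSemialgebraic {v | v ∈ M} := by
  have := setOf_eq (.linear M.mkQ) (.const (V := V) (0 : V ⧸ M))
  simpa using this

end IsSemialgebraic

end Semialgebraic

/-! ### Chain sums and the uniqueness of splittings -/

section

variable {𝔤 : Type*} [MetricLieAlgebra 𝔤]

/-- The eigenvectors of a symmetric operator span the space. This is how `A - W` is recognised as a
function of `A`. -/
theorem eq_of_eqOn_eigenvectors [FiniteDimensional ℝ 𝔤] {A B B' : 𝔤 →L[ℝ] 𝔤}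
    (hA : A.toLinearMap.IsSymmetric) (h : ∀ (r : ℝ) (x : 𝔤), A x = r • x → B x = B' x) :
    B = B' := by
  have htop : (⨆ r, Module.End.eigenspace A.toLinearMap r) = ⊤ := by
    rw [← Submodule.orthogonal_eq_bot_iff]
    exact hA.orthogonalComplement_iSup_eigenspaces_eq_bot
  have hle : (⨆ r, Module.End.eigenspace A.toLinearMap r) ≤
      LinearMap.eqLocus B.toLinearMap B'.toLinearMap :=
    iSup_le fun r x hx => h r x (Module.End.mem_eigenspace_iff.1 hx)
  rw [htop] at hle
  ext x
  exact hle (Submodule.mem_top : x ∈ ⊤)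

variable [FiniteDimensional ℝ 𝔤]

/-! ### Orthogonal projections as stand-ins for subalgebras -/

section Projection

variable {𝔭 𝔮 : LieSubalgebra ℝ 𝔤}

theorem subalgebraProjection_mem (𝔭 : LieSubalgebra ℝ 𝔤) (x : 𝔤) :
    subalgebraProjection 𝔭 x ∈ 𝔭 := Submodule.starProjection_apply_mem _ x

theorem subalgebraProjection_eq_self_iff {x : 𝔤} : subalgebraProjection 𝔭 x = x ↔ x ∈ 𝔭 :=
  Submodule.starProjection_eq_self_iff

theorem sub_subalgebraProjection_mem (𝔭 : LieSubalgebra ℝ 𝔤) (x : 𝔤) :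
    x - subalgebraProjection 𝔭 x ∈ 𝔭.toSubmoduleᗮ := Submodule.sub_starProjection_mem_orthogonal x

theorem subalgebraProjection_eq_zero {x : 𝔤} (hx : x ∈ 𝔭.toSubmoduleᗮ) :
    subalgebraProjection 𝔭 x = 0 := (Submodule.starProjection_apply_eq_zero_iff _).2 hx

theorem subalgebraProjection_isSymmetric (𝔭 : LieSubalgebra ℝ 𝔤) :
    (subalgebraProjection 𝔭).toLinearMap.IsSymmetric :=
  Submodule.starProjection_isSymmetric _

theorem subalgebraProjection_injective :
    Function.Injective (subalgebraProjection : LieSubalgebra ℝ 𝔤 → 𝔤 →L[ℝ] 𝔤) := by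
  intro 𝔭 𝔮 h
  ext x
  rw [← subalgebraProjection_eq_self_iff, h, subalgebraProjection_eq_self_iff]

/-- Turns the order of subalgebras into a polynomial equation between projections, a condition both
closed and semialgebraic. -/
theorem subalgebraProjection_mul_eq_iff :
    subalgebraProjection 𝔮 * subalgebraProjection 𝔭 = subalgebraProjection 𝔭 ↔ 𝔭 ≤ 𝔮 := by
  constructor
  · intro h x hx
    rw [← subalgebraProjection_eq_self_iff] at hx ⊢
    have := congrArg (fun T : 𝔤 →L[ℝ] 𝔤 => T x) h
    simpa [hx] using this
  · intro h
    ext x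
    exact subalgebraProjection_eq_self_iff.2 (h (subalgebraProjection_mem 𝔭 x))

theorem inner_sub_subalgebraProjection (𝔭 : LieSubalgebra ℝ 𝔤) (x : 𝔤) :
    ⟪x - subalgebraProjection 𝔭 x, x⟫_ℝ = ‖x - subalgebraProjection 𝔭 x‖ ^ 2 := by
  have := Submodule.inner_left_of_mem_orthogonal (subalgebraProjection_mem 𝔭 x)
    (sub_subalgebraProjection_mem 𝔭 x)
  rw [← real_inner_self_eq_norm_sq]
  conv_rhs => rw [inner_sub_right, this, sub_zero]

theorem inner_sub_subalgebraProjection_le (𝔭 : LieSubalgebra ℝ 𝔤) (x : 𝔤) :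
    ⟪x - subalgebraProjection 𝔭 x, x⟫_ℝ ≤ ‖x‖ ^ 2 := by
  have h1 : ⟪subalgebraProjection 𝔭 x, x⟫_ℝ = ‖subalgebraProjection 𝔭 x‖ ^ 2 := by
    have := Submodule.inner_right_of_mem_orthogonal (subalgebraProjection_mem 𝔭 x)
      (sub_subalgebraProjection_mem 𝔭 x)
    rw [inner_sub_right, sub_eq_zero] at this
    rw [this, real_inner_self_eq_norm_sq]
  rw [inner_sub_left, real_inner_self_eq_norm_sq, h1]
  linarith [sq_nonneg ‖subalgebraProjection 𝔭 x‖]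

end Projection

/-- `W = ∑ aᵢ (1 - 1_𝔭ᵢ)`, `μ = ∑ aᵢ` for a descending chain `𝔮 ≥ 𝔭₁ ≥ ⋯ ≥ 𝔭ₙ = 𝔭` with `𝔮 ∈ K`,
`𝔭ᵢ ∈ J` and coefficients `aᵢ ∈ [0,1]` (and `𝔭 = 𝔮` for `n = 0`). -/
inductive ChainSum (J K : Set (LieSubalgebra ℝ 𝔤)) :
    ℕ → (𝔤 →L[ℝ] 𝔤) → ℝ → LieSubalgebra ℝ 𝔤 → LieSubalgebra ℝ 𝔤 → Prop
  | zero {𝔮 : LieSubalgebra ℝ 𝔤} (h : 𝔮 ∈ K) : ChainSum J K 0 0 0 𝔮 𝔮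
  | succ {n : ℕ} {W : 𝔤 →L[ℝ] 𝔤} {μ : ℝ} {𝔭 𝔮 : LieSubalgebra ℝ 𝔤} (h : ChainSum J K n W μ 𝔭 𝔮)
      {𝔭' : LieSubalgebra ℝ 𝔤} (hJ : 𝔭' ∈ J) (hle : 𝔭' ≤ 𝔭) {a : ℝ} (ha : a ∈ Set.Icc (0 : ℝ) 1) :
      ChainSum J K (n + 1) (W + a • (1 - subalgebraProjection 𝔭')) (μ + a) 𝔭' 𝔮

namespace ChainSum

variable {J K : Set (LieSubalgebra ℝ 𝔤)} {n : ℕ} {W : 𝔤 →L[ℝ] 𝔤} {μ : ℝ}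
  {𝔭 𝔮 : LieSubalgebra ℝ 𝔤}

theorem mem (h : ChainSum J K n W μ 𝔭 𝔮) : 𝔮 ∈ K := by
  induction h with
  | zero h => exact h
  | succ _ _ _ _ ih => exact ih

theorem le (h : ChainSum J K n W μ 𝔭 𝔮) : 𝔭 ≤ 𝔮 := by
  induction h with
  | zero h => exact le_rfl
  | succ _ _ hle _ ih => exact hle.trans ih

theorem nonneg (h : ChainSum J K n W μ 𝔭 𝔮) : 0 ≤ μ := by
  induction h with
  | zero h => exact le_rfl
  | succ _ _ _ ha ih => exact add_nonneg ih ha.1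

theorem isSymmetric (h : ChainSum J K n W μ 𝔭 𝔮) : W.toLinearMap.IsSymmetric := by
  induction h with
  | zero h => intro x y; simp
  | @succ n W μ 𝔭 𝔮 _ 𝔭' hJ hle a ha ih =>
    intro x y
    have h1 := ih x y
    have h2 := subalgebraProjection_isSymmetric 𝔭' x y
    simp only [ContinuousLinearMap.coe_coe] at h1 h2
    simp [inner_add_left, inner_add_right, inner_sub_left, inner_sub_right, inner_smul_left,
      inner_smul_right, h1, h2]

theorem inner_nonneg (h : ChainSum J K n W μ 𝔭 𝔮) (x : 𝔤) : 0 ≤ ⟪W x, x⟫_ℝ := by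
  induction h with
  | zero h => simp
  | @succ n W μ 𝔭 𝔮 _ 𝔭' hJ hle a ha ih =>
    have h1 := inner_sub_subalgebraProjection 𝔭' x
    simp only [add_apply, smul_apply, inner_add_left,
      sub_apply, one_apply_eq_self, real_inner_smul_left, h1]
    have := ha.1
    positivity

theorem inner_le (h : ChainSum J K n W μ 𝔭 𝔮) (x : 𝔤) : ⟪W x, x⟫_ℝ ≤ μ * ‖x‖ ^ 2 := by
  induction h with
  | zero h => simp
  | @succ n W μ 𝔭 𝔮 _ 𝔭' hJ hle a ha ih =>
    have h1 := inner_sub_subalgebraProjection_le 𝔭' x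
    simp only [add_apply, smul_apply, inner_add_left,
      sub_apply, one_apply_eq_self, real_inner_smul_left]
    have := mul_le_mul_of_nonneg_left h1 ha.1
    linarith

theorem apply_eq_zero (h : ChainSum J K n W μ 𝔭 𝔮) {x : 𝔤} (hx : x ∈ 𝔭) : W x = 0 := by
  induction h with
  | zero h => simp
  | @succ n W μ 𝔭 𝔮 _ 𝔭' hJ hle a ha ih =>
    simp [ih (hle hx), subalgebraProjection_eq_self_iff.2 hx]

theorem apply_orthogonal (h : ChainSum J K n W μ 𝔭 𝔮) {x : 𝔤} (hx : x ∈ 𝔮.toSubmoduleᗮ) :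
    W x = μ • x := by
  induction h with
  | zero h => simp
  | @succ n W μ 𝔭 𝔮 h 𝔭' hJ hle a ha ih =>
    have hle' : 𝔭'.toSubmodule ≤ 𝔮.toSubmodule := hle.trans h.le
    simp [ih hx, subalgebraProjection_eq_zero (Submodule.orthogonal_le hle' hx), add_smul]

/-- `𝔮` is spanned by eigenvectors with eigenvalues at most `μ`. -/
theorem mem_span (h : ChainSum J K n W μ 𝔭 𝔮) {x : 𝔤} (hx : x ∈ 𝔮) :
    x ∈ Submodule.span ℝ {y | y ∈ 𝔮 ∧ ∃ r ≤ μ, W y = r • y} := by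
  induction h generalizing x with
  | zero h => exact Submodule.subset_span ⟨hx, 0, le_rfl, by simp⟩
  | @succ n W μ 𝔭 𝔮 h 𝔭' hJ hle a ha ih =>
    set S := {y | y ∈ 𝔮 ∧ ∃ r ≤ μ + a, (W + a • (1 - subalgebraProjection 𝔭')) y = r • y} with hS
    have h1 : subalgebraProjection 𝔭' x ∈ Submodule.span ℝ S := by
      refine Submodule.subset_span ⟨(hle.trans h.le) (subalgebraProjection_mem 𝔭' x), 0,
        add_nonneg h.nonneg ha.1, ?_⟩
      simp [h.apply_eq_zero (hle (subalgebraProjection_mem 𝔭' x)),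
        subalgebraProjection_eq_self_iff.2 (subalgebraProjection_mem 𝔭' x)]
    have h2 : ∀ y ∈ Submodule.span ℝ {y | y ∈ 𝔮 ∧ ∃ r ≤ μ, W y = r • y},
        y - subalgebraProjection 𝔭' y ∈ Submodule.span ℝ S := by
      intro y hy
      have hle' : Submodule.span ℝ {y | y ∈ 𝔮 ∧ ∃ r ≤ μ, W y = r • y} ≤
          (Submodule.span ℝ S).comap (1 - subalgebraProjection 𝔭').toLinearMap := by
        rw [Submodule.span_le]
        rintro y ⟨hy𝔮, r, hr, hy⟩
        have hPW : subalgebraProjection 𝔭' (W y) = 0 := by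
          refine subalgebraProjection_eq_zero fun z hz => ?_
          have := h.isSymmetric z y
          simp only [ContinuousLinearMap.coe_coe] at this
          rw [← this, h.apply_eq_zero (hle hz), inner_zero_left]
        have hWP : W (subalgebraProjection 𝔭' y) = 0 :=
          h.apply_eq_zero (hle (subalgebraProjection_mem 𝔭' y))
        -- `W` is symmetric and kills `𝔭'`, so its range is orthogonal to `𝔭'`. An eigenvector with
        -- `r ≠ 0` thus has no component in `𝔭'`, and `y - 1_𝔭' y` has eigenvalue `r + a` for the
        -- longer sum.
        have hr0 : r • subalgebraProjection 𝔭' y = 0 := by rw [← map_smul, ← hy, hPW]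
        refine Submodule.subset_span ⟨sub_mem hy𝔮 ((hle.trans h.le) (subalgebraProjection_mem 𝔭' y)),
          r + a, by linarith, ?_⟩
        simp [hWP, hy, subalgebraProjection_eq_self_iff.2 (subalgebraProjection_mem 𝔭' y),
          add_smul, smul_sub, hr0]
        abel
      exact hle' hy
    have := add_mem h1 (h2 x (ih hx))
    rwa [add_sub_cancel] at this

/-- Below `μ`, the operator is bounded from below off some member of the chain. -/
theorem exists_lower_bound (h : ChainSum J K n W μ 𝔭 𝔮) {lam : ℝ} (h0 : 0 ≤ lam) (hlam : lam < μ) :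
    ∃ 𝔯 ∈ J, 𝔭 ≤ 𝔯 ∧ 𝔯 ≤ 𝔮 ∧ (∀ x ∈ 𝔯, W x ∈ 𝔯) ∧
      ∃ s, lam < s ∧ ∀ x ∈ 𝔯.toSubmoduleᗮ, s * ‖x‖ ^ 2 ≤ ⟪W x, x⟫_ℝ := by
  induction h generalizing lam with
  | zero h => exact absurd h0 (not_le.2 hlam)
  | @succ n W μ 𝔭 𝔮 h 𝔭' hJ hle a ha ih =>
    -- If the last coefficient alone exceeds `lam`, its subalgebra `𝔭'` will do; otherwise `lam - a`
    -- is handled by the shorter chain and the new summand raises the bound by `a`.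
    by_cases hla : lam < a
    · refine ⟨𝔭', hJ, le_rfl, hle.trans h.le, fun x hx => ?_, a, hla, fun x hx => ?_⟩
      · simp [h.apply_eq_zero (hle hx), subalgebraProjection_eq_self_iff.2 hx]
      · have := h.inner_nonneg x
        simp [subalgebraProjection_eq_zero hx, inner_add_left, real_inner_smul_left, this]
    · push Not at hla
      obtain ⟨𝔯, h𝔯J, h𝔭, h𝔮, hinv, s, hs, hsx⟩ := ih (sub_nonneg.2 hla) (by linarith)
      refine ⟨𝔯, h𝔯J, hle.trans h𝔭, h𝔮, fun x hx => ?_, s + a, by linarith, fun x hx => ?_⟩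
      · simp only [add_apply, smul_apply,
          sub_apply, one_apply_eq_self]
        exact add_mem (hinv x hx) (𝔯.smul_mem a
          (sub_mem hx ((hle.trans h𝔭) (subalgebraProjection_mem 𝔭' x))))
      · have hle' : 𝔭'.toSubmodule ≤ 𝔯.toSubmodule := hle.trans h𝔭
        have := hsx x hx
        simp only [add_apply, smul_apply,
          sub_apply, one_apply_eq_self, inner_add_left,
          subalgebraProjection_eq_zero (Submodule.orthogonal_le hle' hx), sub_zero,
          real_inner_smul_left, real_inner_self_eq_norm_sq]
        linarith

theorem smul (h : ChainSum J K n W μ 𝔭 𝔮) {c : ℝ} (hc : c ∈ Set.Icc (0 : ℝ) 1) :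
    ChainSum J K n (c • W) (c * μ) 𝔭 𝔮 := by
  induction h with
  | zero h => simpa using ChainSum.zero h
  | @succ n W μ 𝔭 𝔮 h 𝔭' hJ hle a ha ih =>
    have := ih.succ hJ hle (a := c * a)
      ⟨mul_nonneg hc.1 ha.1, mul_le_one₀ hc.2 ha.1 ha.2⟩
    rwa [mul_smul, ← smul_add, ← mul_add] at this

end ChainSum

/-- Let `y` be the component of an eigenvector orthogonal to `𝔯`. Invariance of `𝔯` gives `⟪A y, y⟫
= r ‖y‖²` with the same eigenvalue `r ≤ lam < s`, so the lower bound forces `y = 0`. -/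
theorem eigenFiltration_le_of_lower_bound {A : 𝔤 →L[ℝ] 𝔤} {𝔯 : LieSubalgebra ℝ 𝔤} (hinv : ∀ x ∈ 𝔯, A x ∈ 𝔯) {lam s : ℝ} (hs : lam < s)
    (hsx : ∀ x ∈ 𝔯.toSubmoduleᗮ, s * ‖x‖ ^ 2 ≤ ⟪A x, x⟫_ℝ) :
    eigenFiltration A lam ≤ 𝔯.toSubmodule := by
  refine Submodule.span_le.2 ?_
  rintro x ⟨r, hr, hx⟩
  set y := x - subalgebraProjection 𝔯 x with hy
  have hyo : y ∈ 𝔯.toSubmoduleᗮ := sub_subalgebraProjection_mem 𝔯 x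
  have h1 : ⟪A y, y⟫_ℝ = r * ‖y‖ ^ 2 := by
    have h2 : ⟪A (subalgebraProjection 𝔯 x), y⟫_ℝ = 0 :=
      Submodule.inner_right_of_mem_orthogonal (hinv _ (subalgebraProjection_mem 𝔯 x)) hyo
    have h3 : ⟪subalgebraProjection 𝔯 x, y⟫_ℝ = 0 :=
      Submodule.inner_right_of_mem_orthogonal (subalgebraProjection_mem 𝔯 x) hyo
    have h4 : ⟪x, y⟫_ℝ = ‖y‖ ^ 2 := by
      rw [← real_inner_self_eq_norm_sq]
      conv_rhs => rw [hy, inner_sub_left, ← hy, h3, sub_zero]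
    conv_lhs => rw [hy, map_sub, inner_sub_left, ← hy, h2, hx, real_inner_smul_left, h4, sub_zero]
  have h5 := hsx y hyo
  rw [h1] at h5
  have h6 : ‖y‖ ^ 2 = 0 := by
    by_contra hne
    have : 0 < ‖y‖ ^ 2 := lt_of_le_of_ne (sq_nonneg _) (Ne.symm hne)
    nlinarith
  have h7 : y = 0 := by simpa using h6
  rw [hy, sub_eq_zero, eq_comm, subalgebraProjection_eq_self_iff] at h7
  exact h7

/-- `A` is the sum of the chain sum `W` and of a nonnegative operator vanishing on the top `𝔮` of
the chain. -/
def IsSplitting (J K : Set (LieSubalgebra ℝ 𝔤)) (A W : 𝔤 →L[ℝ] 𝔤) : Prop :=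
  ∃ n μ 𝔭 𝔮, ChainSum J K n W μ 𝔭 𝔮 ∧ (A - W).IsPositive ∧ ∀ x ∈ 𝔮, (A - W) x = 0

/-! ### Uniqueness of splittings by spectral truncation -/

section Uniqueness

variable {J K : Set (LieSubalgebra ℝ 𝔤)} {n n' : ℕ} {A W W' : 𝔤 →L[ℝ] 𝔤} {μ μ' : ℝ}
  {𝔭 𝔭' 𝔮 𝔮' : LieSubalgebra ℝ 𝔤}

theorem IsSplitting.isSymmetric (h : IsSplitting J K A W) : A.toLinearMap.IsSymmetric := by
  obtain ⟨n, μ, 𝔭, 𝔮, h, hB, -⟩ := h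
  have := hB.1.add h.isSymmetric
  intro x y
  simpa using this x y

/-- If `μ < μ'`, the second splitting puts `F_μ(A)` inside some `𝔯 ∈ J`, while the first puts `𝔮 ∈
K` inside `F_μ(A)`; so `𝔮 ≤ 𝔯`, which is excluded. -/
theorem splitting_threshold_le (hJK : ∀ 𝔮 ∈ K, ∀ 𝔭 ∈ J, ¬ 𝔮 ≤ 𝔭)
    (h : ChainSum J K n W μ 𝔭 𝔮) (hB : ∀ x ∈ 𝔮, (A - W) x = 0)
    (h' : ChainSum J K n' W' μ' 𝔭' 𝔮') (hB' : (A - W').IsPositive)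
    (hB0' : ∀ x ∈ 𝔮', (A - W') x = 0) : μ' ≤ μ := by
  by_contra hlt
  push Not at hlt
  obtain ⟨𝔯, h𝔯J, -, h𝔯𝔮, hinv, s, hs, hsx⟩ := h'.exists_lower_bound h.nonneg hlt
  refine hJK 𝔮 h.mem 𝔯 h𝔯J ?_
  have h1 : 𝔮.toSubmodule ≤ eigenFiltration A μ := by
    intro x hx
    refine Submodule.span_mono ?_ (h.mem_span hx)
    rintro y ⟨hy, r, hr, hyr⟩
    refine ⟨r, hr, ?_⟩
    have := hB y hy
    rw [sub_apply, sub_eq_zero] at this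
    rw [this, hyr]
  refine h1.trans (eigenFiltration_le_of_lower_bound (fun x hx => ?_) hs fun x hx => ?_)
  · have := hB0' x (h𝔯𝔮 hx)
    rw [sub_apply, sub_eq_zero] at this
    rw [this]
    exact hinv x hx
  · have h2 := hsx x hx
    have h3 := hB'.2 x
    simp only [ContinuousLinearMap.reApplyInnerSelf_apply, sub_apply,
      inner_sub_left, RCLike.re_to_real] at h3
    linarith

/-- `B = A - W` takes values in `𝔮ᗮ`, where `W` is multiplication by `μ`. For `r ≤ μ` one finds `‖B
x‖² = (r - μ) ⟪B x, x⟫ ≤ 0`. For `r ≥ μ` one finds `‖W x - μ x‖² = (r - μ) ⟪W x - μ x, x⟫ ≤ 0`,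
because `W ≤ μ`. -/
theorem splitting_apply_eigenvector (h : ChainSum J K n W μ 𝔭 𝔮) (hB : (A - W).IsPositive)
    (hB0 : ∀ x ∈ 𝔮, (A - W) x = 0) {r : ℝ} {x : 𝔤} (hx : A x = r • x) :
    (A - W) x = max (r - μ) 0 • x := by
  set B := A - W with hBdef
  have hWB : W (B x) = μ • B x := by
    refine h.apply_orthogonal fun z hz => ?_
    have := hB.1 z x
    simp only [ContinuousLinearMap.coe_coe] at this
    rw [← this, hB0 z hz, inner_zero_left]
  have hBx : B x = r • x - W x := by rw [hBdef, sub_apply, hx]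
  have hWs : ⟪W x, B x⟫_ℝ = μ * ⟪x, B x⟫_ℝ := by
    have := h.isSymmetric x (B x)
    simp only [ContinuousLinearMap.coe_coe] at this
    rw [this, hWB, real_inner_smul_right]
  have hBpos : 0 ≤ ⟪B x, x⟫_ℝ := by
    simpa [ContinuousLinearMap.reApplyInnerSelf_apply] using hB.2 x
  rcases le_total r μ with hr | hr
  · rw [max_eq_right (by linarith), zero_smul]
    have : ⟪B x, B x⟫_ℝ = (r - μ) * ⟪B x, x⟫_ℝ := by
      nth_rewrite 1 [hBx]
      rw [inner_sub_left, real_inner_smul_left, hWs, real_inner_comm]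
      ring
    rw [← inner_self_eq_zero (𝕜 := ℝ)]
    refine le_antisymm ?_ real_inner_self_nonneg
    rw [this]
    exact mul_nonpos_of_nonpos_of_nonneg (by linarith) hBpos
  · rw [max_eq_left (by linarith)]
    have hN : W x = μ • x := by
      rw [← sub_eq_zero, ← inner_self_eq_zero (𝕜 := ℝ)]
      refine le_antisymm ?_ real_inner_self_nonneg
      have h1 : W x - μ • x = (r - μ) • x - B x := by rw [hBx, sub_smul]; abel
      have h2 : ⟪W x - μ • x, B x⟫_ℝ = 0 := by
        rw [inner_sub_left, hWs, real_inner_smul_left, sub_self]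
      nth_rewrite 2 [h1]
      rw [inner_sub_right, h2, sub_zero, real_inner_smul_right, inner_sub_left,
        real_inner_smul_left, real_inner_self_eq_norm_sq]
      have := h.inner_le x
      exact mul_nonpos_of_nonneg_of_nonpos (by linarith) (by linarith)
    rw [hBx, hN, sub_smul]

theorem IsSplitting.unique (hJK : ∀ 𝔮 ∈ K, ∀ 𝔭 ∈ J, ¬ 𝔮 ≤ 𝔭) (h : IsSplitting J K A W)
    (h' : IsSplitting J K A W') : W = W' := by
  have hA := h.isSymmetric
  obtain ⟨n, μ, 𝔭, 𝔮, h, hB, hB0⟩ := h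
  obtain ⟨n', μ', 𝔭', 𝔮', h', hB', hB0'⟩ := h'
  obtain rfl : μ = μ' := le_antisymm (splitting_threshold_le hJK h' hB0' h hB hB0)
    (splitting_threshold_le hJK h hB0 h' hB' hB0')
  have := eq_of_eqOn_eigenvectors hA (B := A - W) (B' := A - W') fun r x hx => by
    rw [splitting_apply_eigenvector h hB hB0 hx, splitting_apply_eigenvector h' hB' hB0' hx]
  exact sub_right_injective this

end Uniqueness

end

/-! ### Butterflies and chain sums -/

section

variable {𝔤 : Type*} [MetricLieAlgebra 𝔤]

/-- The trace as a linear functional. -/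
noncomputable def opTraceₗ (𝔤 : Type*) [MetricLieAlgebra 𝔤] : (𝔤 →L[ℝ] 𝔤) →ₗ[ℝ] ℝ :=
  LinearMap.trace ℝ 𝔤 ∘ₗ ContinuousLinearMap.coeLM ℝ

theorem opTrace_add (A B : 𝔤 →L[ℝ] 𝔤) : opTrace (A + B) = opTrace A + opTrace B :=
  map_add (opTraceₗ 𝔤) A B

theorem opTrace_smul (c : ℝ) (A : 𝔤 →L[ℝ] 𝔤) : opTrace (c • A) = c * opTrace A :=
  map_smul (opTraceₗ 𝔤) c A

theorem opTrace_zero : opTrace (0 : 𝔤 →L[ℝ] 𝔤) = 0 := map_zero (opTraceₗ 𝔤)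

theorem opTrace_sum {ι : Type*} (s : Finset ι) (f : ι → 𝔤 →L[ℝ] 𝔤) :
    opTrace (∑ i ∈ s, f i) = ∑ i ∈ s, opTrace (f i) := map_sum (opTraceₗ 𝔤) f s

variable [FiniteDimensional ℝ 𝔤]

theorem opTrace_one_sub_subalgebraProjection (𝔭 : LieSubalgebra ℝ 𝔤) :
    opTrace (1 - subalgebraProjection 𝔭) = Module.finrank ℝ (𝔤 ⧸ 𝔭.toSubmodule) := by
  have h1 : opTrace (subalgebraProjection 𝔭) = Module.finrank ℝ 𝔭.toSubmodule :=
    LinearMap.IsProj.trace (p := 𝔭.toSubmodule) ⟨subalgebraProjection_mem 𝔭,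
      fun _ => subalgebraProjection_eq_self_iff.2⟩
  have h2 : opTrace (1 : 𝔤 →L[ℝ] 𝔤) = Module.finrank ℝ 𝔤 := LinearMap.trace_one ℝ 𝔤
  have h3 : opTrace (1 - subalgebraProjection 𝔭) = opTrace 1 - opTrace (subalgebraProjection 𝔭) :=
    map_sub (opTraceₗ 𝔤) _ _
  rw [h3, h1, h2, ← 𝔭.toSubmodule.finrank_quotient_add_finrank]
  push_cast
  ring

theorem finrank_quotient_pos_of_ne_top {𝔭 : LieSubalgebra ℝ 𝔤} (h : 𝔭 ≠ ⊤) :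
    0 < Module.finrank ℝ (𝔤 ⧸ 𝔭.toSubmodule) := by
  rw [Module.finrank_pos_iff, Submodule.Quotient.nontrivial_iff]
  simpa using h

theorem opTrace_chiBar {𝔭 : LieSubalgebra ℝ 𝔤} (h : 𝔭 ≠ ⊤) : opTrace (chiBar 𝔭) = 1 := by
  rw [chiBar, opTrace_smul, opTrace_one_sub_subalgebraProjection, inv_mul_cancel₀]
  exact_mod_cast (finrank_quotient_pos_of_ne_top h).ne'

/-- The dimension is injective on a chain. The bound is uniform in the flag, so finitely many
lengths of chain sums suffice. -/
theorem card_le_of_isChain {φ : Finset (LieSubalgebra ℝ 𝔤)}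
    (h : IsChain (· ≤ ·) (φ : Set (LieSubalgebra ℝ 𝔤))) : φ.card ≤ Module.finrank ℝ 𝔤 + 1 := by
  rw [← Finset.card_range (Module.finrank ℝ 𝔤 + 1)]
  refine Finset.card_le_card_of_injOn (fun 𝔭 => Module.finrank ℝ 𝔭.toSubmodule) ?_ ?_
  · intro 𝔭 _
    simpa [Nat.lt_succ_iff] using Submodule.finrank_le 𝔭.toSubmodule
  · intro 𝔭 h𝔭 𝔮 h𝔮 heq
    rcases h.total h𝔭 h𝔮 with hle | hle
    · exact LieSubalgebra.toSubmodule_injective (Submodule.eq_of_le_of_finrank_eq hle heq)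
    · exact (LieSubalgebra.toSubmodule_injective (Submodule.eq_of_le_of_finrank_eq hle heq.symm)).symm

variable {J K 𝒦 : Set (LieSubalgebra ℝ 𝔤)}

/-- Chain sums grow downwards, so the least element of `φ` is added last. The clause on common lower
bounds ensures that it fits below the chain already built. -/
theorem exists_chainSum_of_finset {𝔮 : LieSubalgebra ℝ 𝔤} (h𝔮 : 𝔮 ∈ K)
    (w : LieSubalgebra ℝ 𝔤 → ℝ) (φ : Finset (LieSubalgebra ℝ 𝔤))
    (hφJ : (φ : Set (LieSubalgebra ℝ 𝔤)) ⊆ J)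
    (hφ : IsChain (· ≤ ·) (φ : Set (LieSubalgebra ℝ 𝔤))) (hle : ∀ 𝔣 ∈ φ, 𝔣 ≤ 𝔮)
    (hw : ∀ 𝔣 ∈ φ, w 𝔣 ∈ Set.Icc (0 : ℝ) 1) :
    ∃ μ 𝔭, ChainSum J K φ.card (∑ 𝔣 ∈ φ, w 𝔣 • (1 - subalgebraProjection 𝔣)) μ 𝔭 𝔮 ∧
      ∀ 𝔩, 𝔩 ≤ 𝔮 → (∀ 𝔣 ∈ φ, 𝔩 ≤ 𝔣) → 𝔩 ≤ 𝔭 := by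
  classical
  induction φ using Finset.strongInduction with
  | H φ ih =>
    rcases φ.eq_empty_or_nonempty with rfl | hne
    · exact ⟨0, 𝔮, by simpa using ChainSum.zero h𝔮, fun 𝔩 h _ => h⟩
    · obtain ⟨m, hm, hmin⟩ := φ.exists_minimal hne
      have hmle : ∀ 𝔣 ∈ φ, m ≤ 𝔣 := fun 𝔣 h𝔣 =>
        (hφ.total hm h𝔣).elim id fun h => hmin h𝔣 h
      have hsub : (φ.erase m : Finset _) ⊆ φ := Finset.erase_subset _ _
      obtain ⟨μ, 𝔭, h, hlb⟩ := ih (φ.erase m) (Finset.erase_ssubset hm)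
        (fun 𝔣 h𝔣 => hφJ (hsub h𝔣)) (hφ.mono hsub)
        (fun 𝔣 h𝔣 => hle 𝔣 (hsub h𝔣)) (fun 𝔣 h𝔣 => hw 𝔣 (hsub h𝔣))
      refine ⟨μ + w m, m, ?_, fun 𝔩 _ h𝔩 => h𝔩 m hm⟩
      have := h.succ (hφJ hm) (hlb m (hle m hm) fun 𝔣 h𝔣 => hmle 𝔣 (hsub h𝔣)) (hw m hm)
      rwa [Finset.sum_erase_add _ _ hm, Finset.card_erase_add_one hm] at this

theorem ChainSum.exists_finset {n : ℕ} {W : 𝔤 →L[ℝ] 𝔤} {μ : ℝ} {𝔭 𝔮 : LieSubalgebra ℝ 𝔤}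
    (h : ChainSum J K n W μ 𝔭 𝔮) : ∃ (φ : Finset (LieSubalgebra ℝ 𝔤)) (w : LieSubalgebra ℝ 𝔤 → ℝ),
      (φ : Set (LieSubalgebra ℝ 𝔤)) ⊆ J ∧ IsChain (· ≤ ·) (φ : Set (LieSubalgebra ℝ 𝔤)) ∧
      (∀ 𝔣 ∈ φ, 𝔭 ≤ 𝔣 ∧ 𝔣 ≤ 𝔮) ∧ (∀ 𝔣, 0 ≤ w 𝔣) ∧
      W = ∑ 𝔣 ∈ φ, w 𝔣 • (1 - subalgebraProjection 𝔣) := by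
  classical
  -- The weights are also required to vanish off `φ`: a chain sum may repeat a subalgebra, whose new
  -- coefficient is then added to the old weight.
  suffices ∃ (φ : Finset (LieSubalgebra ℝ 𝔤)) (w : LieSubalgebra ℝ 𝔤 → ℝ),
      (φ : Set (LieSubalgebra ℝ 𝔤)) ⊆ J ∧ IsChain (· ≤ ·) (φ : Set (LieSubalgebra ℝ 𝔤)) ∧
      (∀ 𝔣 ∈ φ, 𝔭 ≤ 𝔣 ∧ 𝔣 ≤ 𝔮) ∧ (∀ 𝔣, 0 ≤ w 𝔣) ∧ (∀ 𝔣, 𝔣 ∉ φ → w 𝔣 = 0) ∧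
      W = ∑ 𝔣 ∈ φ, w 𝔣 • (1 - subalgebraProjection 𝔣) by
    obtain ⟨φ, w, h1, h2, h3, h4, -, h5⟩ := this
    exact ⟨φ, w, h1, h2, h3, h4, h5⟩
  induction h with
  | zero h => exact ⟨∅, 0, by simp, by simp, by simp, by simp, by simp, by simp⟩
  | @succ n W μ 𝔭 𝔮 h 𝔭' hJ hle a ha ih =>
    obtain ⟨φ, w, h1, h2, h3, h4, h5, h6⟩ := ih
    refine ⟨insert 𝔭' φ, w + Pi.single 𝔭' a, ?_, ?_, ?_, ?_, ?_, ?_⟩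
    · rw [Finset.coe_insert]
      exact Set.insert_subset hJ h1
    · rw [Finset.coe_insert]
      exact h2.insert fun 𝔣 h𝔣 _ => Or.inl (hle.trans (h3 𝔣 h𝔣).1)
    · intro 𝔣 h𝔣
      rcases Finset.mem_insert.1 h𝔣 with rfl | h𝔣
      · exact ⟨le_rfl, hle.trans h.le⟩
      · exact ⟨hle.trans (h3 𝔣 h𝔣).1, (h3 𝔣 h𝔣).2⟩
    · intro 𝔣
      refine add_nonneg (h4 𝔣) ?_
      by_cases hf : 𝔣 = 𝔭'
      · subst hf; simpa using ha.1
      · simp [hf]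
    · intro 𝔣 h𝔣
      rw [Finset.mem_insert, not_or] at h𝔣
      simp [h5 𝔣 h𝔣.2, h𝔣.1]
    · simp only [Pi.add_apply, add_smul, Finset.sum_add_distrib]
      congr 1
      · rw [h6, Finset.sum_insert_of_eq_zero_if_notMem]
        intro hn
        rw [h5 _ hn, zero_smul]
      · rw [Finset.sum_eq_single 𝔭' (fun b _ hb => by simp [hb]) (by simp)]
        simp

theorem exists_weights_of_mem_convexHull {φ : Finset (LieSubalgebra ℝ 𝔤)} {A : 𝔤 →L[ℝ] 𝔤}
    (hA : A ∈ convexHull ℝ (chiBar '' (φ : Set (LieSubalgebra ℝ 𝔤)))) :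
    ∃ w : LieSubalgebra ℝ 𝔤 → ℝ, (∀ 𝔣 ∈ φ, 0 ≤ w 𝔣) ∧ ∑ 𝔣 ∈ φ, w 𝔣 = 1 ∧
      A = ∑ 𝔣 ∈ φ, w 𝔣 • chiBar 𝔣 := by
  classical
  set C : Set (𝔤 →L[ℝ] 𝔤) := {A | ∃ w : LieSubalgebra ℝ 𝔤 → ℝ, (∀ 𝔣 ∈ φ, 0 ≤ w 𝔣) ∧
    ∑ 𝔣 ∈ φ, w 𝔣 = 1 ∧ A = ∑ 𝔣 ∈ φ, w 𝔣 • chiBar 𝔣} with hC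
  have hconv : Convex ℝ C := by
    rintro _ ⟨w, hw0, hw1, rfl⟩ _ ⟨w', hw0', hw1', rfl⟩ a b ha hb hab
    refine ⟨a • w + b • w', fun 𝔣 h𝔣 => ?_, ?_, ?_⟩
    · exact add_nonneg (mul_nonneg ha (hw0 𝔣 h𝔣)) (mul_nonneg hb (hw0' 𝔣 h𝔣))
    · simp [Finset.sum_add_distrib, ← Finset.mul_sum, hw1, hw1', hab]
    · simp [Finset.sum_add_distrib, add_smul, Finset.smul_sum, smul_smul]
  refine convexHull_min ?_ hconv hA
  rintro _ ⟨𝔣, h𝔣, rfl⟩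
  have h𝔣' : 𝔣 ∈ φ := h𝔣
  refine ⟨Pi.single 𝔣 1, fun 𝔩 _ => ?_, ?_, ?_⟩
  · by_cases hf : 𝔩 = 𝔣
    · subst hf; simp
    · simp [hf]
  · simp [h𝔣']
  · rw [Finset.sum_eq_single 𝔣 (fun b _ hb => by simp [hb]) (fun h => absurd h𝔣' h)]
    simp

/-- A scaled point of the simplex of a flag is a chain sum. -/
theorem exists_chainSum_of_mem_convexHull {φ : Finset (LieSubalgebra ℝ 𝔤)} {C : 𝔤 →L[ℝ] 𝔤}
    {𝔮 : LieSubalgebra ℝ 𝔤} (h𝔮 : 𝔮 ∈ K) (hφJ : (φ : Set (LieSubalgebra ℝ 𝔤)) ⊆ J)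
    (hφ : IsChain (· ≤ ·) (φ : Set (LieSubalgebra ℝ 𝔤))) (hle : ∀ 𝔣 ∈ φ, 𝔣 ≤ 𝔮)
    (hC : C ∈ convexHull ℝ (chiBar '' (φ : Set (LieSubalgebra ℝ 𝔤)))) {t : ℝ}
    (ht : t ∈ Set.Icc (0 : ℝ) 1) :
    ∃ n < Module.finrank ℝ 𝔤 + 2, ∃ μ 𝔭, ChainSum J K n (t • C) μ 𝔭 𝔮 := by
  obtain ⟨w, hw0, hw1, rfl⟩ := exists_weights_of_mem_convexHull hC
  obtain ⟨μ, 𝔭, h, -⟩ := exists_chainSum_of_finset h𝔮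
    (fun 𝔣 => t * (w 𝔣 * (Module.finrank ℝ (𝔤 ⧸ 𝔣.toSubmodule) : ℝ)⁻¹)) φ hφJ hφ hle (by
      intro 𝔣 h𝔣
      have h1 : w 𝔣 ≤ 1 := hw1 ▸ Finset.single_le_sum hw0 h𝔣
      have h2 : ((Module.finrank ℝ (𝔤 ⧸ 𝔣.toSubmodule) : ℝ))⁻¹ ≤ 1 := Nat.cast_inv_le_one _
      have h3 : 0 ≤ ((Module.finrank ℝ (𝔤 ⧸ 𝔣.toSubmodule) : ℝ))⁻¹ := by positivity
      have h4 := hw0 𝔣 h𝔣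
      exact ⟨mul_nonneg ht.1 (mul_nonneg h4 h3),
        mul_le_one₀ ht.2 (mul_nonneg h4 h3) (mul_le_one₀ h1 h3 h2)⟩)
  refine ⟨φ.card, Nat.lt_succ_of_le (card_le_of_isChain hφ), μ, 𝔭, ?_⟩
  simpa only [chiBar, Finset.smul_sum, smul_smul, mul_assoc] using h

/-- `A = W + c B` with `W` a chain sum with top `𝔮`, `c > 0` and `B ∈ V 𝔮`. -/
def IsSplitPoint (V : LieSubalgebra ℝ 𝔤 → Set (𝔤 →L[ℝ] 𝔤)) (J K : Set (LieSubalgebra ℝ 𝔤))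
    (A W : 𝔤 →L[ℝ] 𝔤) (c : ℝ) (B : 𝔤 →L[ℝ] 𝔤) : Prop :=
  ∃ n < Module.finrank ℝ 𝔤 + 2, ∃ μ 𝔭 𝔮, ChainSum J K n W μ 𝔭 𝔮 ∧ 0 < c ∧ B ∈ V 𝔮 ∧
    A = W + c • B ∧ opTrace A = 1

/-- The cells consist of nonnegative operators of trace one vanishing on the subalgebra. -/
def IsCellFamily (V : LieSubalgebra ℝ 𝔤 → Set (𝔤 →L[ℝ] 𝔤)) : Prop :=
  ∀ 𝔣, ∀ B ∈ V 𝔣, B.IsPositive ∧ opTrace B = 1 ∧ ∀ x ∈ 𝔣, B x = 0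

theorem IsCellFamily.notMem_top {V : LieSubalgebra ℝ 𝔤 → Set (𝔤 →L[ℝ] 𝔤)} (hV : IsCellFamily V)
    (B : 𝔤 →L[ℝ] 𝔤) : B ∉ V ⊤ := by
  intro hB
  obtain ⟨-, h1, h2⟩ := hV ⊤ B hB
  have : B = 0 := by
    ext x
    exact h2 x (LieSubalgebra.mem_top x)
  rw [this, opTrace_zero] at h1
  exact zero_ne_one h1

/-! ### Split points and their uniqueness -/

section SplitPoint

variable {V : LieSubalgebra ℝ 𝔤 → Set (𝔤 →L[ℝ] 𝔤)} {A W W' B B' : 𝔤 →L[ℝ] 𝔤} {c c' : ℝ}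

theorem IsSplitPoint.isSplitting (hV : IsCellFamily V) (h : IsSplitPoint V J K A W c B) :
    IsSplitting J K A W := by
  obtain ⟨n, -, μ, 𝔭, 𝔮, h, hc, hB, rfl, -⟩ := h
  obtain ⟨hpos, -, h0⟩ := hV 𝔮 B hB
  refine ⟨n, μ, 𝔭, 𝔮, h, ?_, fun x hx => ?_⟩
  · rw [add_sub_cancel_left]
    exact hpos.smul_of_nonneg hc.le
  · simp [h0 x hx]

/-- Since `B` has trace one, `c` is determined by `W`. -/
theorem IsSplitPoint.opTrace_add_eq (hV : IsCellFamily V) (h : IsSplitPoint V J K A W c B) :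
    opTrace W + c = 1 := by
  obtain ⟨n, -, μ, 𝔭, 𝔮, h, hc, hB, rfl, h1⟩ := h
  rwa [opTrace_add, opTrace_smul, (hV 𝔮 B hB).2.1, mul_one] at h1

theorem IsSplitPoint.unique (hV : IsCellFamily V) (hJK : ∀ 𝔮 ∈ K, ∀ 𝔭 ∈ J, ¬ 𝔮 ≤ 𝔭)
    (h : IsSplitPoint V J K A W c B) (h' : IsSplitPoint V J K A W' c' B') :
    W = W' ∧ c = c' ∧ B = B' := by
  obtain rfl := (h.isSplitting hV).unique hJK (h'.isSplitting hV)
  have hc : c = c' := by linarith [h.opTrace_add_eq hV, h'.opTrace_add_eq hV]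
  subst hc
  obtain ⟨n, -, μ, 𝔭, 𝔮, -, hc, -, h1, -⟩ := h
  obtain ⟨n, -, μ, 𝔭, 𝔮, -, -, -, h2, -⟩ := h'
  have := add_left_cancel (h1.symm.trans h2)
  exact ⟨rfl, rfl, smul_right_injective _ hc.ne' this⟩

theorem isSplitPoint_self (hV : IsCellFamily V) {𝔣 : LieSubalgebra ℝ 𝔤} (h𝔣 : 𝔣 ∈ K)
    (hA : A ∈ V 𝔣) : IsSplitPoint V J K A 0 1 A :=
  ⟨0, by omega, 0, 𝔣, 𝔣, .zero h𝔣, one_pos, hA, by simp, (hV 𝔣 A hA).2.1⟩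

/-- The straight line from `A` to `B`. -/
theorem IsSplitPoint.lineMap (hV : IsCellFamily V) (h : IsSplitPoint V J K A W c B) {s : ℝ}
    (hs : s ∈ Set.Icc (0 : ℝ) 1) :
    IsSplitPoint V J K ((1 - s) • A + s • B) ((1 - s) • W) ((1 - s) * c + s) B := by
  obtain ⟨n, hn, μ, 𝔭, 𝔮, h, hc, hB, rfl, h1⟩ := h
  refine ⟨n, hn, (1 - s) * μ, 𝔭, 𝔮, h.smul ⟨by linarith [hs.2], by linarith [hs.1]⟩, ?_, hB, ?_, ?_⟩
  · rcases eq_or_lt_of_le hs.1 with rfl | h0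
    · simpa using hc
    · have := mul_nonneg (sub_nonneg.2 hs.2) hc.le
      linarith
  · rw [smul_add, smul_smul, add_smul, add_assoc]
  · rw [opTrace_add, opTrace_smul, opTrace_smul, h1, (hV 𝔮 B hB).2.1]
    ring

end SplitPoint

/-- An order ideal of a set of subalgebras containing `𝔤`, not containing `𝔤`. -/
structure IsProperIdeal (𝒦 J : Set (LieSubalgebra ℝ 𝔤)) : Prop where
  subset : J ⊆ 𝒦
  lower : ∀ 𝔩 ∈ 𝒦, ∀ 𝔧 ∈ J, 𝔩 ≤ 𝔧 → 𝔩 ∈ J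
  top_notMem : ⊤ ∉ J
  top_mem : ⊤ ∈ 𝒦

/-! ### Butterflies of flags in terms of split points -/

namespace IsProperIdeal

variable {V : LieSubalgebra ℝ 𝔤 → Set (𝔤 →L[ℝ] 𝔤)} {A : 𝔤 →L[ℝ] 𝔤}

theorem not_le (h : IsProperIdeal 𝒦 J) : ∀ 𝔮 ∈ 𝒦 \ J, ∀ 𝔭 ∈ J, ¬ 𝔮 ≤ 𝔭 :=
  fun 𝔮 h𝔮 𝔭 h𝔭 hle => h𝔮.2 (h.lower 𝔮 h𝔮.1 𝔭 h𝔭 hle)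

/-- Such a flag contains `𝔤`, as otherwise it would be a flag of `J`. The flag `{𝔤}` contributes
nothing, its cell being empty; every other one gives a simplex, whose points are chain sums with top
`𝔤` and zero remainder. -/
theorem isSplitting_of_mem_flagsJ (h : IsProperIdeal 𝒦 J) (hV : IsCellFamily V)
    (hA : A ∈ butterflyUnion V (flagsJ 𝒦 J)) : IsSplitting J (𝒦 \ J) A A := by
  classical
  simp only [butterflyUnion, Set.mem_iUnion] at hA
  obtain ⟨φ, ⟨⟨hφ𝒦, hφ⟩, hφJ, hφtop⟩, m, hm, hA⟩ := hA
  have htop : ⊤ ∈ φ := by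
    by_contra hno
    exact hφJ ⟨fun 𝔩 h𝔩 => hφtop 𝔩 h𝔩 fun h0 => hno (h0 ▸ h𝔩), hφ⟩
  obtain rfl : m = ⊤ := top_unique (hm.2 htop)
  rcases hA with ⟨-, hA⟩ | ⟨-, -, hA⟩ | ⟨-, hne, -⟩
  · exact absurd hA (hV.notMem_top A)
  · rw [← Finset.coe_erase] at hA
    obtain ⟨n, -, μ, 𝔭, hs⟩ := exists_chainSum_of_mem_convexHull (K := 𝒦 \ J) (J := J) (t := 1)
      ⟨h.top_mem, h.top_notMem⟩
      (fun 𝔣 h𝔣 => hφtop 𝔣 (Finset.mem_of_mem_erase h𝔣) (Finset.ne_of_mem_erase h𝔣))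
      (hφ.mono (Finset.erase_subset _ _)) (fun _ _ => le_top) hA ⟨zero_le_one, le_rfl⟩
    rw [one_smul] at hs
    exact ⟨n, μ, 𝔭, ⊤, hs, by simp [ContinuousLinearMap.isPositive_zero], by simp⟩
  · exact absurd rfl hne

theorem mem_flagsJ_of_mem_convexHull (h : IsProperIdeal 𝒦 J) {ψ : Finset (LieSubalgebra ℝ 𝔤)}
    (hψJ : (ψ : Set (LieSubalgebra ℝ 𝔤)) ⊆ J)
    (hψ : IsChain (· ≤ ·) (ψ : Set (LieSubalgebra ℝ 𝔤)))
    (hA : A ∈ convexHull ℝ (chiBar '' (ψ : Set (LieSubalgebra ℝ 𝔤)))) :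
    A ∈ butterflyUnion V (flagsJ 𝒦 J) := by
  classical
  have htop : ⊤ ∉ ψ := fun h0 => h.top_notMem (hψJ h0)
  have hψ0 : ψ.Nonempty := by
    have := convexHull_nonempty_iff.1 ⟨A, hA⟩
    simpa using this
  simp only [butterflyUnion, Set.mem_iUnion]
  refine ⟨insert ⊤ ψ, ⟨⟨?_, ?_⟩, fun h0 => h.top_notMem (h0.1 (by simp)), ?_⟩, ⊤, ⟨by simp,
    fun _ _ => le_top⟩, Or.inr (Or.inl ⟨fun h0 => ?_, rfl, ?_⟩)⟩
  · rw [Finset.coe_insert]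
    exact Set.insert_subset h.top_mem (hψJ.trans h.subset)
  · rw [Finset.coe_insert]
    exact hψ.insert fun _ _ _ => Or.inr le_top
  · intro 𝔩 h𝔩 hne
    exact hψJ ((Finset.mem_insert.1 h𝔩).resolve_left hne)
  · obtain ⟨𝔣, h𝔣⟩ := hψ0
    have : 𝔣 ∈ ({⊤} : Finset (LieSubalgebra ℝ 𝔤)) := h0 ▸ Finset.mem_insert_of_mem h𝔣
    exact htop (Finset.mem_singleton.1 this ▸ h𝔣)
  · rwa [← Finset.coe_erase, Finset.erase_insert htop]

/-- The maximum of the flag is outside `J` and the rest inside. Second kind butterflies, and the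
points of a third kind butterfly with no contribution from the cell, lie in simplices of flags of
`J`, hence in the set that has been removed. -/
theorem exists_isSplitPoint (h : IsProperIdeal 𝒦 J) (hV : IsCellFamily V)
    (hA : A ∈ butterflyUnion V (flagsI 𝒦 J)) (hA' : A ∉ butterflyUnion V (flagsJ 𝒦 J)) :
    ∃ W c B, IsSplitPoint V J (𝒦 \ J) A W c B := by
  classical
  simp only [butterflyUnion, Set.mem_iUnion] at hA
  obtain ⟨φ, ⟨⟨hφ𝒦, hφ⟩, hφJ, hφmax⟩, m, hm, hA⟩ := hA
  have hmK : m ∈ 𝒦 \ J := by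
    refine ⟨hφ𝒦 hm.1, fun hmJ => hφJ ⟨fun 𝔩 h𝔩 => ?_, hφ⟩⟩
    by_cases h0 : 𝔩 = m
    · exact h0 ▸ hmJ
    · exact hφmax m hm 𝔩 h𝔩 h0
  have hψJ : ((φ.erase m : Finset _) : Set (LieSubalgebra ℝ 𝔤)) ⊆ J := fun 𝔣 h𝔣 =>
    hφmax m hm 𝔣 (Finset.mem_of_mem_erase h𝔣) (Finset.ne_of_mem_erase h𝔣)
  have hψ : IsChain (· ≤ ·) ((φ.erase m : Finset _) : Set (LieSubalgebra ℝ 𝔤)) :=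
    hφ.mono (Finset.erase_subset _ _)
  rw [← Finset.coe_erase] at hA
  rcases hA with ⟨-, hA⟩ | ⟨-, -, hA⟩ | ⟨-, -, hA⟩
  · exact ⟨0, 1, A, isSplitPoint_self hV hmK hA⟩
  · exact absurd (h.mem_flagsJ_of_mem_convexHull hψJ hψ hA) hA'
  · obtain ⟨B, hB, C, hC, a, b, ha, hb, hab, rfl⟩ := mem_convexJoin.1 hA
    obtain ⟨n, hn, μ, 𝔭, hs⟩ := exists_chainSum_of_mem_convexHull hmK hψJ hψ
      (fun 𝔣 h𝔣 => hm.2 (Finset.mem_of_mem_erase h𝔣)) hC (t := b) ⟨hb, by linarith⟩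
    have hCtr : opTrace C = 1 := by
      obtain ⟨w, -, hw1, rfl⟩ := exists_weights_of_mem_convexHull hC
      rw [opTrace_sum, ← hw1]
      refine Finset.sum_congr rfl fun 𝔣 h𝔣 => ?_
      rw [opTrace_smul, opTrace_chiBar fun h0 => h.top_notMem (h0 ▸ hψJ h𝔣), mul_one]
    refine ⟨b • C, a, B, n, hn, μ, 𝔭, m, hs, ?_, hB, add_comm _ _, ?_⟩
    · refine lt_of_le_of_ne ha fun h0 => hA' ?_
      have hb1 : b = 1 := by linarith
      rw [← h0, hb1, zero_smul, one_smul, zero_add]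
      exact h.mem_flagsJ_of_mem_convexHull hψJ hψ hC
    · rw [opTrace_add, opTrace_smul, opTrace_smul, hCtr, (hV m B hB).2.1]
      linarith

/-- Rewritten in the trace-one operators `chiBar`, the chain sum is `t` times a point of a simplex,
and `t + c = 1`. This is a point of a third kind butterfly, or of the cell itself if `t = 0`. -/
theorem mem_flagsI_of_isSplitPoint (h : IsProperIdeal 𝒦 J) (hV : IsCellFamily V)
    {W B : 𝔤 →L[ℝ] 𝔤} {c : ℝ} (hA : IsSplitPoint V J (𝒦 \ J) A W c B) :
    A ∈ butterflyUnion V (flagsI 𝒦 J) := by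
  classical
  have htr := hA.opTrace_add_eq hV
  obtain ⟨n, hn, μ, 𝔭, 𝔮, hs, hc, hB, rfl, -⟩ := hA
  obtain ⟨φ, w, hφJ, hφ, hle, hw, rfl⟩ := hs.exists_finset
  have h𝔮 := hs.mem
  have h𝔮top : 𝔮 ≠ ⊤ := by
    rintro rfl
    exact hV.notMem_top B hB
  have hφtop : ∀ 𝔣 ∈ φ, 𝔣 ≠ ⊤ := fun 𝔣 h𝔣 h0 => h.top_notMem (h0 ▸ hφJ h𝔣)
  have h𝔮φ : 𝔮 ∉ φ := fun h0 => h𝔮.2 (hφJ h0)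
  set v : LieSubalgebra ℝ 𝔤 → ℝ := fun 𝔣 => w 𝔣 * Module.finrank ℝ (𝔤 ⧸ 𝔣.toSubmodule) with hv
  have hv0 : ∀ 𝔣, 0 ≤ v 𝔣 := fun 𝔣 => mul_nonneg (hw 𝔣) (by positivity)
  have hsum : ∑ 𝔣 ∈ φ, w 𝔣 • (1 - subalgebraProjection 𝔣) = ∑ 𝔣 ∈ φ, v 𝔣 • chiBar 𝔣 := by
    refine Finset.sum_congr rfl fun 𝔣 h𝔣 => ?_
    have : (Module.finrank ℝ (𝔤 ⧸ 𝔣.toSubmodule) : ℝ) ≠ 0 := by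
      exact_mod_cast (finrank_quotient_pos_of_ne_top (hφtop 𝔣 h𝔣)).ne'
    rw [chiBar, smul_smul, hv]
    simp only
    rw [mul_assoc, mul_inv_cancel₀ this, mul_one]
  rw [hsum] at htr ⊢
  set t := ∑ 𝔣 ∈ φ, v 𝔣 with ht
  have htr' : t + c = 1 := by
    rw [opTrace_sum] at htr
    rw [ht, ← htr]
    congr 1
    refine Finset.sum_congr rfl fun 𝔣 h𝔣 => ?_
    rw [opTrace_smul, opTrace_chiBar (hφtop 𝔣 h𝔣), mul_one]
  have ht0 : 0 ≤ t := Finset.sum_nonneg fun 𝔣 _ => hv0 𝔣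
  simp only [butterflyUnion, Set.mem_iUnion]
  rcases eq_or_lt_of_le ht0 with ht0 | ht0
  · have hz : ∀ 𝔣 ∈ φ, v 𝔣 = 0 := (Finset.sum_eq_zero_iff_of_nonneg fun 𝔣 _ => hv0 𝔣).1 ht0.symm
    have hc1 : c = 1 := by linarith
    rw [Finset.sum_eq_zero fun 𝔣 h𝔣 => by rw [hz 𝔣 h𝔣, zero_smul], zero_add, hc1, one_smul]
    refine ⟨{𝔮}, ⟨⟨by simpa using h𝔮.1, by simp⟩, fun h0 => h𝔮.2 (h0.1 (by simp)), ?_⟩, 𝔮,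
      by simp, Or.inl ⟨rfl, hB⟩⟩
    intro m hm 𝔩 h𝔩 hne
    have h1 : m = 𝔮 := by simpa using hm.1
    have h2 : 𝔩 = 𝔮 := by simpa using h𝔩
    exact absurd (h2.trans h1.symm) hne
  · have hφ0 : φ.Nonempty := by
      rw [Finset.nonempty_iff_ne_empty]
      rintro rfl
      simp [ht] at ht0
    have hgr : IsGreatest ((insert 𝔮 φ : Finset _) : Set (LieSubalgebra ℝ 𝔤)) 𝔮 := by
      refine ⟨by simp, fun 𝔣 h𝔣 => ?_⟩
      rcases Finset.mem_insert.1 h𝔣 with rfl | h𝔣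
      · exact le_rfl
      · exact (hle 𝔣 h𝔣).2
    refine ⟨insert 𝔮 φ, ⟨⟨?_, ?_⟩, fun h0 => h𝔮.2 (h0.1 (by simp)), ?_⟩, 𝔮, hgr,
      Or.inr (Or.inr ⟨fun h0 => ?_, h𝔮top, ?_⟩)⟩
    · rw [Finset.coe_insert]
      exact Set.insert_subset h𝔮.1 (hφJ.trans h.subset)
    · rw [Finset.coe_insert]
      exact hφ.insert fun 𝔣 h𝔣 _ => Or.inr (hle 𝔣 h𝔣).2
    · intro m hm 𝔩 h𝔩 hne
      rw [hm.unique hgr] at hne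
      exact hφJ ((Finset.mem_insert.1 h𝔩).resolve_left hne)
    · obtain ⟨𝔣, h𝔣⟩ := hφ0
      have : 𝔣 ∈ ({𝔮} : Finset (LieSubalgebra ℝ 𝔤)) := h0 ▸ Finset.mem_insert_of_mem h𝔣
      exact h𝔮φ (Finset.mem_singleton.1 this ▸ h𝔣)
    · rw [← Finset.coe_erase, Finset.erase_insert h𝔮φ, mem_convexJoin]
      refine ⟨B, hB, ∑ 𝔣 ∈ φ, (t⁻¹ * v 𝔣) • chiBar 𝔣, ?_, c, t, hc.le, ht0.le, by linarith, ?_⟩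
      · refine (convex_convexHull ℝ _).sum_mem (fun 𝔣 _ => mul_nonneg (inv_nonneg.2 ht0.le) (hv0 𝔣))
          ?_ fun 𝔣 h𝔣 => subset_convexHull ℝ _ ⟨𝔣, h𝔣, rfl⟩
        rw [← Finset.mul_sum, ← ht, inv_mul_cancel₀ ht0.ne']
      · rw [Finset.smul_sum, add_comm]
        simp only [smul_smul, mul_inv_cancel_left₀ ht0.ne']

/-- The points of `V[𝕀] ∖ V[𝕁]`. -/
theorem mem_diff_iff (h : IsProperIdeal 𝒦 J) (hV : IsCellFamily V) :
    A ∈ butterflyUnion V (flagsI 𝒦 J) \ butterflyUnion V (flagsJ 𝒦 J) ↔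
      ∃ W c B, IsSplitPoint V J (𝒦 \ J) A W c B := by
  constructor
  · exact fun hA => h.exists_isSplitPoint hV hA.1 hA.2
  · rintro ⟨W, c, B, hA⟩
    refine ⟨h.mem_flagsI_of_isSplitPoint hV hA, fun hA' => ?_⟩
    -- A point of `V[𝕁]` is its own chain sum, so uniqueness gives `W = A`. Then `W` has trace one
    -- and `c = 0`, a contradiction.
    obtain rfl := (hA.isSplitting hV).unique h.not_le (h.isSplitting_of_mem_flagsJ hV hA')
    have h1 := hA.opTrace_add_eq hV
    obtain ⟨n, hn, μ, 𝔭, 𝔮, hs, hc, hB, -, h2⟩ := hA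
    linarith

end IsProperIdeal

end

/-! ### The deformation retraction -/

section

variable {V W : Type*} [AddCommGroup V] [Module ℝ V] [AddCommGroup W] [Module ℝ W]

theorem IsSemialgebraic.image [FiniteDimensional ℝ V] [FiniteDimensional ℝ W] {g : V → W}
    (hg : IsPolynomialMap g) {S : Set V} (hS : IsSemialgebraic S) : IsSemialgebraic (g '' S) :=
  setOf_exists (P := fun w v => v ∈ S ∧ g v = w)
    (setOf_and (setOf_mem (.snd .id) hS) (setOf_eq (hg.comp (.snd .id)) (.fst .id)))

end

section

variable {𝔤 : Type*} [MetricLieAlgebra 𝔤] [FiniteDimensional ℝ 𝔤]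

theorem IsPolynomialMap.opMul {V : Type*} [AddCommGroup V] [Module ℝ V] {f g : V → 𝔤 →L[ℝ] 𝔤}
    (hf : IsPolynomialMap f) (hg : IsPolynomialMap g) : IsPolynomialMap fun v => f v * g v :=
  bilinear (LinearMap.mul ℝ (𝔤 →L[ℝ] 𝔤)) hf hg

theorem IsPolynomialMap.opTrace {V : Type*} [AddCommGroup V] [Module ℝ V] {f : V → 𝔤 →L[ℝ] 𝔤}
    (hf : IsPolynomialMap f) : IsPolynomialMap fun v => opTrace (f v) :=
  (linear (opTraceₗ 𝔤)).comp hf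

variable {J K 𝒦 : Set (LieSubalgebra ℝ 𝔤)}

/-- The tuples `(W, μ, 1_𝔭, 1_𝔮)` for chain sums `W` of length `n`. -/
def chainSumSet (J K : Set (LieSubalgebra ℝ 𝔤)) (n : ℕ) :
    Set ((𝔤 →L[ℝ] 𝔤) × ℝ × (𝔤 →L[ℝ] 𝔤) × (𝔤 →L[ℝ] 𝔤)) :=
  {t | ∃ 𝔭 𝔮, ChainSum J K n t.1 t.2.1 𝔭 𝔮 ∧ t.2.2.1 = subalgebraProjection 𝔭 ∧
    t.2.2.2 = subalgebraProjection 𝔮}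

theorem chainSumSet_zero : chainSumSet J K 0 =
    (fun Q => ((0 : 𝔤 →L[ℝ] 𝔤), (0 : ℝ), Q, Q)) '' (subalgebraProjection '' K) := by
  ext ⟨W, μ, P, Q⟩
  constructor
  · rintro ⟨𝔭, 𝔮, h, h1, h2⟩
    simp only at h h1 h2
    cases h with
    | zero h => exact ⟨_, ⟨𝔭, h, rfl⟩, by simp [h1, h2]⟩
  · rintro ⟨_, ⟨𝔮, h, rfl⟩, heq⟩
    obtain ⟨rfl, rfl, rfl, rfl⟩ : 0 = W ∧ 0 = μ ∧ subalgebraProjection 𝔮 = P ∧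
      subalgebraProjection 𝔮 = Q := by simpa using heq
    exact ⟨𝔮, 𝔮, .zero h, rfl, rfl⟩

/-- One more summand is a polynomial image of a product cut out by a polynomial equation.
Compactness and semialgebraicity therefore both pass from `n` to `n + 1`. -/
theorem chainSumSet_succ (n : ℕ) : chainSumSet J K (n + 1) =
    (fun p : ((𝔤 →L[ℝ] 𝔤) × ℝ × (𝔤 →L[ℝ] 𝔤) × (𝔤 →L[ℝ] 𝔤)) × (𝔤 →L[ℝ] 𝔤) × ℝ =>
      (p.1.1 + p.2.2 • (1 - p.2.1), p.1.2.1 + p.2.2, p.2.1, p.1.2.2.2)) ''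
    ((chainSumSet J K n ×ˢ ((subalgebraProjection '' J) ×ˢ Set.Icc (0 : ℝ) 1)) ∩
      {p | p.1.2.2.1 * p.2.1 = p.2.1}) := by
  ext ⟨W, μ, P, Q⟩
  constructor
  · rintro ⟨𝔭, 𝔮, h, h1, h2⟩
    simp only at h h1 h2
    cases h with
    | @succ n W μ 𝔭₀ 𝔮 h 𝔭' hJ hle a ha =>
      exact ⟨((W, μ, subalgebraProjection 𝔭₀, subalgebraProjection 𝔮), subalgebraProjection 𝔭, a),
        ⟨⟨⟨𝔭₀, 𝔮, h, rfl, rfl⟩, ⟨𝔭, hJ, rfl⟩, ha⟩, subalgebraProjection_mul_eq_iff.2 hle⟩,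
        by simp [h1, h2]⟩
  · rintro ⟨⟨⟨W₀, μ₀, P₀, Q₀⟩, P', a⟩, ⟨⟨⟨𝔭₀, 𝔮, h, h1, h2⟩, ⟨𝔭', hJ, hP'⟩, ha⟩, hle⟩, heq⟩
    simp only at h h1 h2 hP' ha
    subst h1 h2 hP'
    obtain ⟨rfl, rfl, rfl, rfl⟩ : W₀ + a • (1 - subalgebraProjection 𝔭') = W ∧ μ₀ + a = μ ∧
      subalgebraProjection 𝔭' = P ∧ subalgebraProjection 𝔮 = Q := by simpa using heq
    exact ⟨𝔭', 𝔮, h.succ hJ (subalgebraProjection_mul_eq_iff.1 hle) ha, rfl, rfl⟩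

theorem isCompact_chainSumSet (hJ : IsCompact (subalgebraProjection '' J))
    (hK : IsCompact (subalgebraProjection '' K)) (n : ℕ) : IsCompact (chainSumSet J K n) := by
  induction n with
  | zero =>
    rw [chainSumSet_zero]
    exact hK.image (by fun_prop)
  | succ n ih =>
    rw [chainSumSet_succ]
    refine IsCompact.image ?_ (by fun_prop)
    exact (ih.prod (hJ.prod isCompact_Icc)).inter_right (isClosed_eq (by fun_prop) (by fun_prop))

theorem isSemialgebraic_Icc : IsSemialgebraic (Set.Icc (0 : ℝ) 1) :=
  .setOf_and (.setOf_le (.const 0) .id) (.setOf_le .id (.const 1))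

theorem isSemialgebraic_chainSumSet (hJ : IsSemialgebraic (subalgebraProjection '' J))
    (hK : IsSemialgebraic (subalgebraProjection '' K)) (n : ℕ) :
    IsSemialgebraic (chainSumSet J K n) := by
  induction n with
  | zero =>
    rw [chainSumSet_zero]
    exact hK.image (.prodMk (.const 0) (.prodMk (.const 0) (.prodMk .id .id)))
  | succ n ih =>
    rw [chainSumSet_succ]
    refine IsSemialgebraic.image ?_ ?_
    · have h2 := IsPolynomialMap.id
        (V := ((𝔤 →L[ℝ] 𝔤) × ℝ × (𝔤 →L[ℝ] 𝔤) × (𝔤 →L[ℝ] 𝔤)) × (𝔤 →L[ℝ] 𝔤) × ℝ)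
      exact .prodMk (.add h2.fst.fst (.smul h2.snd.snd (.sub (.const 1) h2.snd.fst)))
        (.prodMk (.add h2.fst.snd.fst h2.snd.snd) (.prodMk h2.snd.fst h2.fst.snd.snd.snd))
    · have h2 := IsPolynomialMap.id
        (V := ((𝔤 →L[ℝ] 𝔤) × ℝ × (𝔤 →L[ℝ] 𝔤) × (𝔤 →L[ℝ] 𝔤)) × (𝔤 →L[ℝ] 𝔤) × ℝ)
      exact .inter (.setOf_and (.setOf_mem h2.fst ih) (.setOf_and (.setOf_mem h2.snd.fst hJ)
        (.setOf_mem h2.snd.snd isSemialgebraic_Icc)))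
        (.setOf_eq (.opMul h2.fst.snd.snd.fst h2.snd.fst) h2.snd.fst)

theorem isClosed_setOf_isPositive : IsClosed {A : 𝔤 →L[ℝ] 𝔤 | A.IsPositive} := by
  have : {A : 𝔤 →L[ℝ] 𝔤 | A.IsPositive} =
      (⋂ x : 𝔤, ⋂ y : 𝔤, {A | ⟪A x, y⟫_ℝ = ⟪x, A y⟫_ℝ}) ∩ ⋂ x : 𝔤, {A | 0 ≤ ⟪A x, x⟫_ℝ} := by
    ext A
    simp only [Set.mem_inter_iff, Set.mem_iInter, Set.mem_ofPred_eq]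
    exact Iff.rfl
  rw [this]
  exact (isClosed_iInter fun x => isClosed_iInter fun y =>
    isClosed_eq (by fun_prop) (by fun_prop)).inter
    (isClosed_iInter fun x => isClosed_le (by fun_prop) (by fun_prop))

variable {V : LieSubalgebra ℝ 𝔤 → Set (𝔤 →L[ℝ] 𝔤)}

/-- Splittings depend continuously on the operator. -/
theorem continuousOn_of_isSplitting (hJ : IsCompact (subalgebraProjection '' J))
    (hK : IsCompact (subalgebraProjection '' K)) (hJK : ∀ 𝔮 ∈ K, ∀ 𝔭 ∈ J, ¬ 𝔮 ≤ 𝔭) (N : ℕ)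
    {X : Set (𝔤 →L[ℝ] 𝔤)} {w : (𝔤 →L[ℝ] 𝔤) → 𝔤 →L[ℝ] 𝔤}
    (hw : ∀ A ∈ X, ∃ n < N, ∃ μ 𝔭 𝔮, ChainSum J K n (w A) μ 𝔭 𝔮 ∧ (A - w A).IsPositive ∧
      ∀ x ∈ 𝔮, (A - w A) x = 0) : ContinuousOn w X := by
  set T := ⋃ n ∈ Finset.range N, chainSumSet J K n with hT
  have hTc : IsCompact T := (Finset.range N).isCompact_biUnion fun n _ =>
    isCompact_chainSumSet hJ hK n
  have : ∀ A ∈ X, ∃ t ∈ T, t.1 = w A ∧ (A - t.1).IsPositive ∧ (A - t.1) * t.2.2.2 = 0 := by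
    intro A hA
    obtain ⟨n, hn, μ, 𝔭, 𝔮, h, hpos, h0⟩ := hw A hA
    refine ⟨(w A, μ, subalgebraProjection 𝔭, subalgebraProjection 𝔮), ?_, rfl, hpos, ?_⟩
    · exact Set.mem_biUnion (x := n) (by simpa using hn) ⟨𝔭, 𝔮, h, rfl, rfl⟩
    · ext x
      exact h0 _ (subalgebraProjection_mem 𝔮 x)
  choose! t htT htw htpos ht0 using this
  intro A hA
  obtain ⟨n₀, -, μ₀, 𝔭₀, 𝔮₀, hA₀⟩ := hw A hA
  -- Along an ultrafilter tending to `A`, the data `t` converge in the compact set `T`. Positivity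
  -- and the vanishing of `(A - W) 1_𝔮` survive in the limit, which is thus a splitting of `A` and
  -- equals `w A` by uniqueness.
  rw [ContinuousWithinAt, Filter.tendsto_iff_ultrafilter]
  intro u hu
  have huX : ∀ᶠ A' in (u : Filter _), A' ∈ X := hu self_mem_nhdsWithin
  have huA : Filter.Tendsto id (u : Filter (𝔤 →L[ℝ] 𝔤)) (nhds A) := hu.trans nhdsWithin_le_nhds
  obtain ⟨t₀, ht₀T, ht₀⟩ := hTc.ultrafilter_le_nhds (u.map t)
    (by
      rw [Filter.le_principal_iff]
      exact huX.mono fun A' hA' => htT A' hA')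
  have hlim : Filter.Tendsto t (u : Filter (𝔤 →L[ℝ] 𝔤)) (nhds t₀) := ht₀
  have hlim1 : Filter.Tendsto (fun A' => (t A').1) (u : Filter (𝔤 →L[ℝ] 𝔤)) (nhds t₀.1) :=
    (continuous_fst.tendsto _).comp hlim
  have hlimQ : Filter.Tendsto (fun A' => (t A').2.2.2) (u : Filter (𝔤 →L[ℝ] 𝔤)) (nhds t₀.2.2.2) :=
    ((continuous_snd.snd.snd).tendsto _).comp hlim
  have hlimB := huA.sub hlim1
  have hpos : (A - t₀.1).IsPositive := isClosed_setOf_isPositive.mem_of_tendsto hlimB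
    (huX.mono fun A' hA' => htpos A' hA')
  have h0 : (A - t₀.1) * t₀.2.2.2 = 0 := by
    refine tendsto_nhds_unique_of_eventuallyEq (hlimB.mul hlimQ) tendsto_const_nhds
      (huX.mono fun A' hA' => ht0 A' hA')
  have heq : t₀.1 = w A := by
    simp only [hT, Set.mem_iUnion] at ht₀T
    obtain ⟨n, -, 𝔭, 𝔮, h, -, hQ⟩ := ht₀T
    refine IsSplitting.unique hJK ⟨n, _, 𝔭, 𝔮, h, hpos, fun x hx => ?_⟩
      ⟨n₀, μ₀, 𝔭₀, 𝔮₀, hA₀⟩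
    have := congrArg (fun L : 𝔤 →L[ℝ] 𝔤 => L x) h0
    rw [hQ] at this
    simpa [subalgebraProjection_eq_self_iff.2 hx] using this
  rw [← heq]
  exact hlim1.congr' (huX.mono fun A' hA' => htw A' hA')

/-- Quantifiers over subalgebras become quantifiers over projections confined to semialgebraic sets,
to which Tarski–Seidenberg applies. Injectivity of `subalgebraProjection` ensures that the top of
the chain and the index of the cell are the same subalgebra. -/
theorem isSemialgebraic_setOf_isSplitPoint_graph
    (hJ : IsSemialgebraic (subalgebraProjection '' J))
    (hK : IsSemialgebraic (subalgebraProjection '' K))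
    (hVs : IsSemialgebraic {p : (𝔤 →L[ℝ] 𝔤) × (𝔤 →L[ℝ] 𝔤) |
      ∃ 𝔣 ∈ K, p.2 = subalgebraProjection 𝔣 ∧ p.1 ∈ V 𝔣}) :
    IsSemialgebraic {p : (𝔤 →L[ℝ] 𝔤) × ℝ × (𝔤 →L[ℝ] 𝔤) | p.2.1 ∈ Set.Icc (0 : ℝ) 1 ∧
      ∃ W c B, IsSplitPoint V J K p.1 W c B ∧ p.2.2 = (1 - p.2.1) • p.1 + p.2.1 • B} := by
  set T : Set ((𝔤 →L[ℝ] 𝔤) × ℝ × (𝔤 →L[ℝ] 𝔤) × (𝔤 →L[ℝ] 𝔤)) :=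
    ⋃ n ∈ {n | n < Module.finrank ℝ 𝔤 + 2}, chainSumSet J K n with hT
  have hTs : IsSemialgebraic T :=
    .biUnion (Set.finite_lt_nat _) fun n _ => isSemialgebraic_chainSumSet hJ hK n
  set VQ : Set ((𝔤 →L[ℝ] 𝔤) × (𝔤 →L[ℝ] 𝔤)) := {p | ∃ 𝔣 ∈ K, p.2 = subalgebraProjection 𝔣 ∧ p.1 ∈ V 𝔣} with hVQ
  have hset : {p : (𝔤 →L[ℝ] 𝔤) × ℝ × (𝔤 →L[ℝ] 𝔤) | p.2.1 ∈ Set.Icc (0 : ℝ) 1 ∧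
      ∃ W c B, IsSplitPoint V J K p.1 W c B ∧ p.2.2 = (1 - p.2.1) • p.1 + p.2.1 • B} =
      {p : (𝔤 →L[ℝ] 𝔤) × ℝ × (𝔤 →L[ℝ] 𝔤) | p.2.1 ∈ Set.Icc (0 : ℝ) 1 ∧ ∃ q : ((𝔤 →L[ℝ] 𝔤) × ℝ × (𝔤 →L[ℝ] 𝔤) × (𝔤 →L[ℝ] 𝔤)) × ℝ × (𝔤 →L[ℝ] 𝔤),
        q.1 ∈ T ∧ 0 < q.2.1 ∧ (q.2.2, q.1.2.2.2) ∈ VQ ∧ p.1 = q.1.1 + q.2.1 • q.2.2 ∧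
        opTrace p.1 = 1 ∧ p.2.2 = (1 - p.2.1) • p.1 + p.2.1 • q.2.2} := by
    ext ⟨A, s, A'⟩
    refine and_congr_right fun _ => ⟨?_, ?_⟩
    · rintro ⟨W, c, B, ⟨n, hn, μ, 𝔭, 𝔮, h, hc, hB, h1, h2⟩, h3⟩
      refine ⟨((W, μ, subalgebraProjection 𝔭, subalgebraProjection 𝔮), c, B), ?_, hc,
        ⟨𝔮, h.mem, rfl, hB⟩, h1, h2, h3⟩
      exact Set.mem_biUnion (x := n) hn ⟨𝔭, 𝔮, h, rfl, rfl⟩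
    · rintro ⟨⟨⟨W, μ, P, Q⟩, c, B⟩, hT', hc, ⟨𝔮, h𝔮, hQ, hB⟩, h1, h2, h3⟩
      simp only [hT, Set.mem_iUnion] at hT'
      obtain ⟨n, hn, 𝔭, 𝔮', h, -, hQ'⟩ := hT'
      obtain rfl : 𝔮' = 𝔮 := subalgebraProjection_injective (hQ'.symm.trans hQ)
      exact ⟨W, c, B, ⟨n, hn, μ, 𝔭, 𝔮', h, hc, hB, h1, h2⟩, h3⟩
  rw [hset]
  refine .setOf_and (.setOf_mem (.fst (.snd .id)) isSemialgebraic_Icc) (.setOf_exists ?_)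
  have hp := IsPolynomialMap.id (V := ((𝔤 →L[ℝ] 𝔤) × ℝ × (𝔤 →L[ℝ] 𝔤)) × ((𝔤 →L[ℝ] 𝔤) × ℝ × (𝔤 →L[ℝ] 𝔤) × (𝔤 →L[ℝ] 𝔤)) × ℝ × (𝔤 →L[ℝ] 𝔤))
  exact .setOf_and (.setOf_mem hp.snd.fst hTs) <|
    .setOf_and (.setOf_lt (.const 0) hp.snd.snd.fst) <|
    .setOf_and (.setOf_mem (.prodMk hp.snd.snd.snd hp.snd.fst.snd.snd.snd) hVs) <|
    .setOf_and (.setOf_eq hp.fst.fst (.add hp.snd.fst.fst (.smul hp.snd.snd.fst hp.snd.snd.snd))) <|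
    .setOf_and (.setOf_eq hp.fst.fst.opTrace (.const 1)) <|
    .setOf_eq hp.fst.snd.snd (.add (.smul (.sub (.const 1) hp.fst.snd.fst) hp.fst.fst)
      (.smul hp.fst.snd.fst hp.snd.snd.snd))

/-- The retraction theorem for a semialgebraic family of cells. -/
theorem IsProperIdeal.isSemialgebraicStrongDeformationRetract (h : IsProperIdeal 𝒦 J)
    (hV : IsCellFamily V)
    (hJc : IsCompact (subalgebraProjection '' J))
    (hKc : IsCompact (subalgebraProjection '' (𝒦 \ J)))
    (hJs : IsSemialgebraic (subalgebraProjection '' J))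
    (hKs : IsSemialgebraic (subalgebraProjection '' (𝒦 \ J)))
    (hVs : IsSemialgebraic {p : (𝔤 →L[ℝ] 𝔤) × (𝔤 →L[ℝ] 𝔤) |
      ∃ 𝔣 ∈ 𝒦 \ J, p.2 = subalgebraProjection 𝔣 ∧ p.1 ∈ V 𝔣}) :
    IsSemialgebraicStrongDeformationRetract (⋃ 𝔣 ∈ 𝒦 \ J, V 𝔣)
      (butterflyUnion V (flagsI 𝒦 J) \ butterflyUnion V (flagsJ 𝒦 J)) := by
  set X := butterflyUnion V (flagsI 𝒦 J) \ butterflyUnion V (flagsJ 𝒦 J) with hX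
  have hmem : ∀ A, A ∈ X ↔ ∃ W c B, IsSplitPoint V J (𝒦 \ J) A W c B :=
    fun A => h.mem_diff_iff hV
  have hex : ∀ A ∈ X, ∃ W c B, IsSplitPoint V J (𝒦 \ J) A W c B := fun A => (hmem A).1
  choose! w c b hwcb using hex
  have hself : ∀ A ∈ ⋃ 𝔣 ∈ 𝒦 \ J, V 𝔣, IsSplitPoint V J (𝒦 \ J) A 0 1 A := by
    intro A hA
    simp only [Set.mem_iUnion] at hA
    obtain ⟨𝔣, h𝔣, hA⟩ := hA
    exact isSplitPoint_self hV h𝔣 hA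
  have hsub : ⋃ 𝔣 ∈ 𝒦 \ J, V 𝔣 ⊆ X := fun A hA => (hmem A).2 ⟨0, 1, A, hself A hA⟩
  -- Both `c` and `b` are explicit in `w`, with a positive denominator `1 - opTrace (w A) = c A`, so
  -- only `w` needs the compactness argument.
  have hc : ∀ A ∈ X, 1 - opTrace (w A) = c A := fun A hA => by
    linarith [(hwcb A hA).opTrace_add_eq hV]
  have hc0 : ∀ A ∈ X, 0 < c A := fun A hA => by
    obtain ⟨n, -, μ, 𝔭, 𝔮, -, hc, -⟩ := hwcb A hA
    exact hc
  have hb : ∀ A ∈ X, b A = (1 - opTrace (w A))⁻¹ • (A - w A) := fun A hA => by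
    have h0 := hc0 A hA
    rw [hc A hA]
    obtain ⟨n, -, μ, 𝔭, 𝔮, -, -, -, h1, -⟩ := hwcb A hA
    rw [sub_eq_of_eq_add' h1, smul_smul, inv_mul_cancel₀ h0.ne', one_smul]
  have hwcont : ContinuousOn w X := by
    refine continuousOn_of_isSplitting hJc hKc h.not_le (Module.finrank ℝ 𝔤 + 2) fun A hA => ?_
    obtain ⟨n, hn, μ, 𝔭, 𝔮, h, hc, hB, h1, -⟩ := hwcb A hA
    obtain ⟨hpos, -, h0⟩ := hV 𝔮 _ hB
    have hsub : A - w A = c A • b A := sub_eq_of_eq_add' h1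
    refine ⟨n, hn, μ, 𝔭, 𝔮, h, ?_, fun x hx => ?_⟩
    · rw [hsub]
      exact hpos.smul_of_nonneg hc.le
    · rw [hsub]
      simp [h0 x hx]
  have hbcont : ContinuousOn b X := by
    have htr : Continuous (opTrace : (𝔤 →L[ℝ] 𝔤) → ℝ) :=
      LinearMap.continuous_of_finiteDimensional (opTraceₗ 𝔤)
    refine ContinuousOn.congr (f := fun A => (1 - opTrace (w A))⁻¹ • (A - w A)) ?_ hb
    have hinv : ContinuousOn (fun A => (1 - opTrace (w A))⁻¹) X :=
      (continuousOn_const.sub (htr.comp_continuousOn hwcont)).inv₀ fun A hA => by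
        exact (hc A hA).trans_ne (hc0 A hA).ne'
    exact hinv.smul (continuousOn_id.sub hwcont)
  refine ⟨fun p => (1 - p.2) • p.1 + p.2 • b p.1, ⟨hsub, ?_, ?_, ?_, ?_, ?_⟩, ?_⟩
  · have h1 : ContinuousOn (fun p : (𝔤 →L[ℝ] 𝔤) × ℝ => b p.1) (X ×ˢ Set.Icc (0 : ℝ) 1) :=
      hbcont.comp continuousOn_fst fun p hp => hp.1
    have h2 : Continuous fun p : (𝔤 →L[ℝ] 𝔤) × ℝ => (1 - p.2) • p.1 := by fun_prop
    exact h2.continuousOn.add (continuousOn_snd.smul h1)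
  · exact fun A hA s hs => (hmem _).2 ⟨_, _, _, (hwcb A hA).lineMap hV hs⟩
  · intro A _
    simp
  · intro A hA
    obtain ⟨n, -, μ, 𝔭, 𝔮, h, -, hB, -⟩ := hwcb A hA
    simpa using ⟨𝔮, h.mem, hB⟩
  · intro A hA s _
    obtain ⟨-, -, h3⟩ := (hwcb A (hsub hA)).unique hV h.not_le (hself A hA)
    simp only [h3]
    rw [← add_smul, sub_add_cancel, one_smul]
  -- By uniqueness the chosen `b A` may be replaced by any `B` occurring in a decomposition of `A`,
  -- so the graph is described without choices.
  · convert isSemialgebraic_setOf_isSplitPoint_graph hJs hKs hVs using 1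
    ext ⟨A, s, A'⟩
    constructor
    · rintro ⟨hA, hs, h1⟩
      exact ⟨hs, w A, c A, b A, hwcb A hA, h1⟩
    · rintro ⟨hs, W, c', B, hA, h1⟩
      have hAX : A ∈ X := (hmem A).2 ⟨W, c', B, hA⟩
      obtain ⟨-, -, rfl⟩ := (hwcb A hAX).unique hV h.not_le hA
      exact ⟨hAX, hs, h1⟩

end

/-! ### Semialgebraicity of the cells -/

section

variable {𝔤 : Type*} [MetricLieAlgebra 𝔤]

/-- For symmetric operators, `F_a` is the orthogonal complement of the eigenvectors with
eigenvalues greater than `a`. -/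
theorem mem_eigenFiltration_iff [FiniteDimensional ℝ 𝔤] {A : 𝔤 →L[ℝ] 𝔤}
    (hA : A.toLinearMap.IsSymmetric) (a : ℝ) (x : 𝔤) :
    x ∈ eigenFiltration A a ↔ ∀ (r : ℝ) (y : 𝔤), a < r → A y = r • y → ⟪x, y⟫_ℝ = 0 := by
  have horth : ∀ x ∈ eigenFiltration A a, ∀ (r : ℝ) (y : 𝔤), a < r → A y = r • y →
      ⟪x, y⟫_ℝ = 0 := by
    intro x hx r y hr hy
    have hle : eigenFiltration A a ≤ (ℝ ∙ y)ᗮ := by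
      refine Submodule.span_le.2 ?_
      rintro z ⟨s, hs, hz⟩
      refine Submodule.mem_orthogonal_singleton_iff_inner_left.2 ?_
      have h1 : ⟪A z, y⟫_ℝ = ⟪z, A y⟫_ℝ := hA z y
      rw [hz, hy, real_inner_smul_left, real_inner_smul_right] at h1
      have h2 : (s - r) * ⟪z, y⟫_ℝ = 0 := by linear_combination h1
      exact (mul_eq_zero.1 h2).resolve_left (by linarith)
    exact Submodule.mem_orthogonal_singleton_iff_inner_left.1 (hle hx)
  refine ⟨horth x, fun h => ?_⟩
  set S := eigenFiltration A a with hS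
  -- The part `y` of `x` orthogonal to `F_a` is orthogonal to every eigenvector: by construction for
  -- eigenvalues up to `a`, by hypothesis for larger ones. Eigenvectors span, so `y = 0`.
  set y := x - S.starProjection x with hy
  have hyS : y ∈ Sᗮ := Submodule.sub_starProjection_mem_orthogonal x
  have htop : (⨆ r, Module.End.eigenspace A.toLinearMap r) = ⊤ := by
    rw [← Submodule.orthogonal_eq_bot_iff]
    exact hA.orthogonalComplement_iSup_eigenspaces_eq_bot
  have hle : (⨆ r, Module.End.eigenspace A.toLinearMap r) ≤ (ℝ ∙ y)ᗮ := by
    refine iSup_le fun r z hz => ?_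
    have hz' : A z = r • z := Module.End.mem_eigenspace_iff.1 hz
    rw [Submodule.mem_orthogonal_singleton_iff_inner_left]
    rcases le_or_gt r a with hr | hr
    · exact Submodule.inner_right_of_mem_orthogonal
        (Submodule.subset_span ⟨r, hr, hz'⟩ : z ∈ S) hyS
    · rw [hy, inner_sub_right, real_inner_comm, h r z hr hz', real_inner_comm,
        horth _ (Submodule.starProjection_apply_mem S x) r z hr hz', sub_zero]
  rw [htop] at hle
  have hyy : ⟪y, y⟫_ℝ = 0 :=
    Submodule.mem_orthogonal_singleton_iff_inner_left.1 (hle (Submodule.mem_top : y ∈ ⊤))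
  rw [inner_self_eq_zero, hy, sub_eq_zero] at hyy
  exact hyy ▸ Submodule.starProjection_apply_mem S x

namespace IsPolynomialMap

variable {V : Type*} [AddCommGroup V] [Module ℝ V] [FiniteDimensional ℝ 𝔤]

theorem opApply {f : V → 𝔤 →L[ℝ] 𝔤} {g : V → 𝔤} (hf : IsPolynomialMap f)
    (hg : IsPolynomialMap g) : IsPolynomialMap fun v => f v (g v) :=
  bilinear (ContinuousLinearMap.coeLM ℝ) hf hg

theorem inner {f g : V → 𝔤} (hf : IsPolynomialMap f)
    (hg : IsPolynomialMap g) : IsPolynomialMap fun v => ⟪f v, g v⟫_ℝ :=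
  bilinear (innerₗ 𝔤) hf hg

theorem lie {f g : V → 𝔤} (hf : IsPolynomialMap f)
    (hg : IsPolynomialMap g) : IsPolynomialMap fun v => ⁅f v, g v⁆ :=
  bilinear (LinearMap.mk₂ ℝ (fun X Y : 𝔤 => ⁅X, Y⁆) add_lie smul_lie lie_add lie_smul) hf hg

end IsPolynomialMap

/-! ### First-order descriptions of the cells -/

namespace IsSemialgebraic

variable {V : Type*} [AddCommGroup V] [Module ℝ V] [FiniteDimensional ℝ 𝔤]
  {f : V → 𝔤 →L[ℝ] 𝔤} {g : V → 𝔤} {a : V → ℝ}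

theorem setOf_isSymmetric (hf : IsPolynomialMap f) :
    IsSemialgebraic {v | (f v).toLinearMap.IsSymmetric} := by
  refine setOf_forall (setOf_forall ?_)
  have h := IsPolynomialMap.id (V := (V × 𝔤) × 𝔤)
  exact setOf_eq (((hf.comp h.fst.fst).opApply h.fst.snd).inner h.snd)
    (h.fst.snd.inner ((hf.comp h.fst.fst).opApply h.snd))

theorem setOf_isPositive (hf : IsPolynomialMap f) : IsSemialgebraic {v | (f v).IsPositive} := by
  have h := IsPolynomialMap.id (V := V × 𝔤)
  exact setOf_and (setOf_isSymmetric hf) (setOf_forall (P := fun v x => 0 ≤ ⟪f v x, x⟫_ℝ)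
    (setOf_le (.const 0) (((hf.comp h.fst).opApply h.snd).inner h.snd)))

theorem setOf_mem_invariantOperators (hf : IsPolynomialMap f) (𝒜 : Subgroup (𝔤 ≃ₗᵢ[ℝ] 𝔤)) :
    IsSemialgebraic {v | f v ∈ invariantOperators 𝒜} :=
  setOf_mem hf <| submodule
    { carrier := invariantOperators 𝒜
      add_mem' := fun {A B} hA hB a ha X => by simp [hA a ha X, hB a ha X]
      zero_mem' := fun a _ X => by simp
      smul_mem' := fun c A hA a ha X => by simp [hA a ha X] }

theorem setOf_mem_lieSubalgebra (hg : IsPolynomialMap g) (𝔥 : LieSubalgebra ℝ 𝔤) :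
    IsSemialgebraic {v | g v ∈ 𝔥} := setOf_mem hg (submodule 𝔥.toSubmodule)

/-- The condition that `A X = 0` and that `A` commutes with `ad X`. -/
theorem setOf_commutes (hf : IsPolynomialMap f) (hg : IsPolynomialMap g) :
    IsSemialgebraic {v | f v (g v) = 0 ∧ ∀ Y : 𝔤, f v ⁅g v, Y⁆ = ⁅g v, f v Y⁆} := by
  have h := IsPolynomialMap.id (V := V × 𝔤)
  exact setOf_and (setOf_eq (hf.opApply hg) (.const 0)) (setOf_forall (setOf_eq
    ((hf.comp h.fst).opApply ((hg.comp h.fst).lie h.snd))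
    ((hg.comp h.fst).lie ((hf.comp h.fst).opApply h.snd))))

theorem coarseSpace (𝒜 : Subgroup (𝔤 ≃ₗᵢ[ℝ] 𝔤)) (𝔥 : LieSubalgebra ℝ 𝔤) :
    IsSemialgebraic (coarseSpace 𝒜 𝔥) := by
  have h0 := IsPolynomialMap.id (V := 𝔤 →L[ℝ] 𝔤)
  have h := IsPolynomialMap.id (V := (𝔤 →L[ℝ] 𝔤) × 𝔤)
  refine setOf_and (setOf_isPositive h0) <| setOf_and (setOf_eq h0.opTrace (.const 1)) <|
    setOf_and (setOf_mem_invariantOperators h0 𝒜) <| setOf_and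
    (setOf_forall (setOf_imp (setOf_mem_lieSubalgebra h.snd 𝔥) (setOf_commutes h.fst h.snd))) <|
    setOf_exists (setOf_and (setOf_not (setOf_mem_lieSubalgebra h.snd 𝔥))
      (setOf_commutes h.fst h.snd))

theorem coarseCell {K : Set (LieSubalgebra ℝ 𝔤)}
    (hK : IsSemialgebraic (subalgebraProjection '' K)) (𝒜 : Subgroup (𝔤 ≃ₗᵢ[ℝ] 𝔤))
    (𝔥 : LieSubalgebra ℝ 𝔤) : IsSemialgebraic {p : (𝔤 →L[ℝ] 𝔤) × (𝔤 →L[ℝ] 𝔤) |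
      ∃ 𝔣 ∈ K, p.2 = subalgebraProjection 𝔣 ∧ p.1 ∈ coarseCell 𝒜 𝔥 𝔣} := by
  have h0 := IsPolynomialMap.id (V := (𝔤 →L[ℝ] 𝔤) × (𝔤 →L[ℝ] 𝔤))
  have h := IsPolynomialMap.id (V := ((𝔤 →L[ℝ] 𝔤) × (𝔤 →L[ℝ] 𝔤)) × 𝔤)
  -- The quantifier over `𝔣` becomes one over all of `𝔤`: as `X` varies, `p.2 X` runs through `𝔣`.
  have key : IsSemialgebraic {p : (𝔤 →L[ℝ] 𝔤) × (𝔤 →L[ℝ] 𝔤) | p.2 ∈ subalgebraProjection '' K ∧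
      p.1 ∈ _root_.coarseSpace 𝒜 𝔥 ∧
      ∀ X : 𝔤, p.1 (p.2 X) = 0 ∧ ∀ Y : 𝔤, p.1 ⁅p.2 X, Y⁆ = ⁅p.2 X, p.1 Y⁆} :=
    setOf_and (setOf_mem h0.snd hK) <| setOf_and
    (setOf_mem h0.fst (IsSemialgebraic.coarseSpace 𝒜 𝔥)) <|
    setOf_forall (setOf_commutes h.fst.fst (h.fst.snd.opApply h.snd))
  convert key using 1
  ext ⟨B, Q⟩
  constructor
  · rintro ⟨𝔣, h𝔣, hQ, hB, hB'⟩
    simp only at hQ hB hB'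
    subst hQ
    exact ⟨⟨𝔣, h𝔣, rfl⟩, hB, fun x => hB' _ (subalgebraProjection_mem 𝔣 x)⟩
  · rintro ⟨⟨𝔣, h𝔣, hQ⟩, hB, hB'⟩
    simp only at hQ hB hB'
    subst hQ
    refine ⟨𝔣, h𝔣, rfl, hB, fun x hx => ?_⟩
    have := hB' x
    rwa [subalgebraProjection_eq_self_iff.2 hx] at this

/-- Membership in `F_a` for symmetric operators, in first order terms. -/
theorem setOf_mem_eigenFiltration (hf : IsPolynomialMap f) (ha : IsPolynomialMap a)
    (hg : IsPolynomialMap g) : IsSemialgebraic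
      {v | ∀ (r : ℝ) (y : 𝔤), a v < r → f v y = r • y → ⟪g v, y⟫_ℝ = 0} := by
  have h := IsPolynomialMap.id (V := (V × ℝ) × 𝔤)
  exact setOf_forall (setOf_forall (setOf_imp (setOf_lt (ha.comp h.fst.fst) h.fst.snd)
    (setOf_imp (setOf_eq ((hf.comp h.fst.fst).opApply h.snd) (.smul h.fst.snd h.snd))
      (setOf_eq ((hg.comp h.fst.fst).inner h.snd) (.const 0)))))

theorem isFiltering : IsSemialgebraic {A : 𝔤 →L[ℝ] 𝔤 | IsFiltering A} := by
  have h0 := IsPolynomialMap.id (V := 𝔤 →L[ℝ] 𝔤)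
  have h := IsPolynomialMap.id (V := ((((𝔤 →L[ℝ] 𝔤) × ℝ) × ℝ) × 𝔤) × 𝔤)
  have hA := h.fst.fst.fst.fst
  have key : IsSemialgebraic {A : 𝔤 →L[ℝ] 𝔤 | A.toLinearMap.IsSymmetric ∧
      ∀ (a b : ℝ) (X Y : 𝔤),
      (∀ (r : ℝ) (y : 𝔤), a < r → A y = r • y → ⟪X, y⟫_ℝ = 0) →
      (∀ (r : ℝ) (y : 𝔤), b < r → A y = r • y → ⟪Y, y⟫_ℝ = 0) →
      ∀ (r : ℝ) (y : 𝔤), a + b < r → A y = r • y → ⟪⁅X, Y⁆, y⟫_ℝ = 0} :=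
    setOf_and (setOf_isSymmetric h0) <|
    setOf_forall <| setOf_forall <| setOf_forall <| setOf_forall <| setOf_imp
    (setOf_mem_eigenFiltration hA h.fst.fst.fst.snd h.fst.snd) <| setOf_imp
    (setOf_mem_eigenFiltration hA h.fst.fst.snd h.snd)
    (setOf_mem_eigenFiltration hA (h.fst.fst.fst.snd.add h.fst.fst.snd) (h.fst.snd.lie h.snd))
  convert key using 1
  ext A
  refine and_congr_right fun hA => ?_
  simp only [← mem_eigenFiltration_iff hA]
  exact forall₃_congr fun a b X => ⟨fun h Y hX hY => h hX Y hY, fun h hX Y hY => h Y hX hY⟩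

/-- `F_0` enters through its orthogonality description, and the strict inclusions are expressed by
witnesses. -/
theorem fineSpace (𝒜 : Subgroup (𝔤 ≃ₗᵢ[ℝ] 𝔤)) (𝔥 : LieSubalgebra ℝ 𝔤) :
    IsSemialgebraic (fineSpace 𝒜 𝔥) := by
  have h0 := IsPolynomialMap.id (V := 𝔤 →L[ℝ] 𝔤)
  have h := IsPolynomialMap.id (V := (𝔤 →L[ℝ] 𝔤) × 𝔤)
  have hF := setOf_mem_eigenFiltration h.fst (.const 0) h.snd
  have hker := setOf_eq (h.fst.opApply h.snd) (.const (0 : 𝔤))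
  have key : IsSemialgebraic {A : 𝔤 →L[ℝ] 𝔤 | (IsFiltering A ∧ A.IsPositive ∧ opTrace A = 1) ∧
      A ∈ invariantOperators 𝒜 ∧
      ((∀ X : 𝔤, X ∈ 𝔥 → ∀ (r : ℝ) (y : 𝔤), 0 < r → A y = r • y → ⟪X, y⟫_ℝ = 0) ∧
        ∃ X : 𝔤, (∀ (r : ℝ) (y : 𝔤), 0 < r → A y = r • y → ⟪X, y⟫_ℝ = 0) ∧ X ∉ 𝔥) ∧
      (∀ X : 𝔤, (∀ (r : ℝ) (y : 𝔤), 0 < r → A y = r • y → ⟪X, y⟫_ℝ = 0) ↔ A X = 0) ∧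
      ∃ X : 𝔤, ¬ A X = 0} := setOf_and (setOf_and isFiltering <| setOf_and (setOf_isPositive h0) <|
      setOf_eq h0.opTrace (.const 1)) <|
    setOf_and (setOf_mem_invariantOperators h0 𝒜) <|
    setOf_and (setOf_and
      (setOf_forall (setOf_imp (setOf_mem_lieSubalgebra h.snd 𝔥) hF))
      (setOf_exists (setOf_and hF (setOf_not (setOf_mem_lieSubalgebra h.snd 𝔥))))) <|
    setOf_and (setOf_forall (setOf_iff hF hker)) (setOf_exists (setOf_not hker))
  convert key using 1
  ext A
  refine and_congr_right fun hA => and_congr_right fun _ => and_congr ?_ (and_congr ?_ ?_)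
  · simp only [← mem_eigenFiltration_iff hA.1.1, SetLike.lt_iff_le_and_exists]
    exact Iff.rfl
  · simp only [← mem_eigenFiltration_iff hA.1.1]
    rw [Submodule.ext_iff]
    exact Iff.rfl
  · rw [lt_top_iff_ne_top, ne_eq, Submodule.eq_top_iff', not_forall]
    exact Iff.rfl

theorem fineCell {K : Set (LieSubalgebra ℝ 𝔤)}
    (hK : IsSemialgebraic (subalgebraProjection '' K)) (𝒜 : Subgroup (𝔤 ≃ₗᵢ[ℝ] 𝔤))
    (𝔥 : LieSubalgebra ℝ 𝔤) : IsSemialgebraic {p : (𝔤 →L[ℝ] 𝔤) × (𝔤 →L[ℝ] 𝔤) |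
      ∃ 𝔣 ∈ K, p.2 = subalgebraProjection 𝔣 ∧ p.1 ∈ fineCell 𝒜 𝔥 𝔣} := by
  have h0 := IsPolynomialMap.id (V := (𝔤 →L[ℝ] 𝔤) × (𝔤 →L[ℝ] 𝔤))
  have h := IsPolynomialMap.id (V := ((𝔤 →L[ℝ] 𝔤) × (𝔤 →L[ℝ] 𝔤)) × 𝔤)
  have key : IsSemialgebraic {p : (𝔤 →L[ℝ] 𝔤) × (𝔤 →L[ℝ] 𝔤) | p.2 ∈ subalgebraProjection '' K ∧
      p.1 ∈ _root_.fineSpace 𝒜 𝔥 ∧ ∀ X : 𝔤, p.1 (p.2 X) = 0} :=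
    setOf_and (setOf_mem h0.snd hK) <| setOf_and
    (setOf_mem h0.fst (IsSemialgebraic.fineSpace 𝒜 𝔥)) <|
    setOf_forall (setOf_eq (h.fst.fst.opApply (h.fst.snd.opApply h.snd)) (.const 0))
  convert key using 1
  ext ⟨B, Q⟩
  constructor
  · rintro ⟨𝔣, h𝔣, hQ, hB, hB'⟩
    simp only at hQ hB hB'
    subst hQ
    exact ⟨⟨𝔣, h𝔣, rfl⟩, hB, fun x => hB' _ (subalgebraProjection_mem 𝔣 x)⟩
  · rintro ⟨⟨𝔣, h𝔣, hQ⟩, hB, hB'⟩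
    simp only at hQ hB hB'
    subst hQ
    refine ⟨𝔣, h𝔣, rfl, hB, fun x hx => ?_⟩
    have := hB' x
    rwa [subalgebraProjection_eq_self_iff.2 hx] at this

end IsSemialgebraic

theorem isCellFamily_coarseCell [FiniteDimensional ℝ 𝔤] (𝒜 : Subgroup (𝔤 ≃ₗᵢ[ℝ] 𝔤))
    (𝔥 : LieSubalgebra ℝ 𝔤) : IsCellFamily (coarseCell 𝒜 𝔥) :=
  fun _ _ hB => ⟨hB.1.1, hB.1.2.1, fun x hx => (hB.2 x hx).1⟩

theorem isCellFamily_fineCell [FiniteDimensional ℝ 𝔤] (𝒜 : Subgroup (𝔤 ≃ₗᵢ[ℝ] 𝔤))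
    (𝔥 : LieSubalgebra ℝ 𝔤) : IsCellFamily (fineCell 𝒜 𝔥) :=
  fun _ _ hB => ⟨hB.1.1.2.1, hB.1.1.2.2, hB.2⟩

end

theorem theorem6p1 {𝔤 : Type*} [MetricLieAlgebra 𝔤] [FiniteDimensional ℝ 𝔤]
    (𝔥 : LieSubalgebra ℝ 𝔤) (h𝔥 : 𝔥 < ⊤)
    (𝒜 : Subgroup (𝔤 ≃ₗᵢ[ℝ] 𝔤))
    (h𝒜_lie : ∀ a ∈ 𝒜, ∀ X Y : 𝔤, a ⁅X, Y⁆ = ⁅a X, a Y⁆)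
    (h𝒜_𝔥 : ∀ a ∈ 𝒜, ∀ X ∈ 𝔥, a X ∈ 𝔥)
    (h𝒜_compact : IsCompact
      ((fun a : 𝔤 ≃ₗᵢ[ℝ] 𝔤 => (a.toContinuousLinearEquiv : 𝔤 →L[ℝ] 𝔤)) '' (𝒜 : Set (𝔤 ≃ₗᵢ[ℝ] 𝔤))))
    (J : Set (LieSubalgebra ℝ 𝔤)) (hJ : IsAdmissibleIdeal 𝒜 𝔥 J) :
    IsSemialgebraicStrongDeformationRetract
      (⋃ 𝔣 ∈ invariantSubalgebras 𝒜 𝔥 \ J, coarseCell 𝒜 𝔥 𝔣)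
      (butterflyUnion (coarseCell 𝒜 𝔥) (flagsI (invariantSubalgebras 𝒜 𝔥) J) \
        butterflyUnion (coarseCell 𝒜 𝔥) (flagsJ (invariantSubalgebras 𝒜 𝔥) J)) ∧
    IsSemialgebraicStrongDeformationRetract
      (⋃ 𝔣 ∈ invariantSubalgebras 𝒜 𝔥 \ J, fineCell 𝒜 𝔥 𝔣)
      (butterflyUnion (fineCell 𝒜 𝔥) (flagsI (invariantSubalgebras 𝒜 𝔥) J) \
        butterflyUnion (fineCell 𝒜 𝔥) (flagsJ (invariantSubalgebras 𝒜 𝔥) J)) := by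
  have hideal : IsProperIdeal (invariantSubalgebras 𝒜 𝔥) J :=
    ⟨hJ.subset, hJ.lower, hJ.top_notMem, h𝔥, fun _ _ _ _ => LieSubalgebra.mem_top _⟩
  exact ⟨hideal.isSemialgebraicStrongDeformationRetract (isCellFamily_coarseCell 𝒜 𝔥)
      hJ.isCompact hJ.isCompact_compl hJ.isSemialgebraic hJ.isSemialgebraic_compl
      (.coarseCell hJ.isSemialgebraic_compl 𝒜 𝔥),
    hideal.isSemialgebraicStrongDeformationRetract (isCellFamily_fineCell 𝒜 𝔥)
      hJ.isCompact hJ.isCompact_compl hJ.isSemialgebraic hJ.isSemialgebraic_compl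
      (.fineCell hJ.isSemialgebraic_compl 𝒜 𝔥)⟩
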